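/- Let $k\ge 2$ be an integer, $\gamma=4^{1-k}$, let $\alpha>1$ be irrational and $\varepsilon>0$. For a real number $\beta$ let $\mathcal B(\alpha,\beta)=\{\lfloor n\alpha+\beta\rfloor : n=1,2,3,\dots\}$. Let $g(x)=a_0+a_1x+\dots+a_kx^k$ with $a_0,\dots,a_k\in\mathbb Z$ and $a_k\ge 1$. The letter $p$ denotes primes. (i) For all integers $N\ge 3$, $q\ge 1$ and $a$ with $(a,q)=1$ and $\left|\frac{a_k}{\alpha}-\frac aq\right|\le\frac1{q^2}$, $$\sum_{\substack{p\le N\\ g(p)\in\mathcal B(\alpha,\beta)}}\log p=\frac1\alpha\sum_{p\le N}\log p+O\Big(N^{\varepsilon}\big(Nq^{-\gamma}+N^{1-\gamma/2}+q^{\frac{\gamma}{1-\gamma}}N^{\frac{1-(k+1)\gamma}{1-\gamma}}+q^{\gamma}N^{1-k\gamma}\big)\Big),$$ where the implied constant depends only on $g,\alpha,\beta,\varepsilon$. Moreover, there is a constant $C$ depending only on $k,\alpha,\varepsilon$ such that for all such $g,\beta,N,a,q$ the difference of the left-hand side and $\frac1\alpha\sum_{p\le N}\log p$ is in absolute value at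 most $$C\,N^{\varepsilon}\big(Nq^{-\gamma}+N^{1-\gamma/2}+q^{\frac{\gamma}{1-\gamma}}N^{\frac{1-(k+1)\gamma}{1-\gamma}}+q^{\gamma}N^{1-k\gamma}\big)+\sum_{\substack{p\le N\\ g(p)\le\alpha+\beta-1}}\log p .$$ (ii) Suppose that $a_k/\alpha$ is an irrational number of finite type $t$, that is, $t\in\mathbb R$ is the supremum of all $\rho\in\mathbb R$ with $\liminf_{n\to\infty}n^{\rho}\Vert na_k/\alpha\Vert=0$, where $\Vert x\Vert$ is the distance of $x$ from the nearest integer. Then for all integers $N\ge 3$ $$\sum_{\substack{p\le N\\ g(p)\in\mathcal B(\alpha,\beta)}}\log p=\frac1\alpha\sum_{p\le N}\log p+O\big(N^{1-\frac{k\gamma}{t+1}+\varepsilon}+N^{1-\frac{\gamma}{2}+\varepsilon}\big),$$ where the implied constant depends only on $g,\alpha,\beta,\varepsilon$. Moreover, there is a constant $C$ depending only on $k,a_k,\alpha,\varepsilon$ (and not on $a_0,\dots,a_{k-1},\beta,N$) such that the difference of the left-hand side and $\frac1\alpha\sum_{p\le N}\log p$ is in absolute value at most $C\big(N^{1-\frac{k\gamma}{t+1}+\varepsilon}+N^{1-\frac{\gamma}{2}+\varepsilon}\big)+\sum_{p\le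 N,\ g(p)\le\alpha+\beta-1}\log p$. -/

import Mathlib

namespace BeattyPrimes

/-- The Beatty sequence `{⌊n α + β⌋ : n = 1, 2, 3, …}`, as a set of integers. -/
def beatty (α β : ℝ) : Set ℤ := {m | ∃ n : ℕ, 1 ≤ n ∧ m = ⌊(n : ℝ) * α + β⌋}

/-- The distance of `x` from the nearest integer. -/
noncomputable def distInt (x : ℝ) : ℝ := |x - round x|

/-- The irrational number `x` is of finite type `t`, that is, `t` is the (finite) supremum of the
real `ρ` with `liminf n ^ ρ * ‖n x‖ = 0`. The lower limit is taken in `[0, ∞]`, where it always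
exists, and the supremum is a genuine least upper bound in `ℝ`. -/
def IsOfFiniteType (x t : ℝ) : Prop :=
  Irrational x ∧
    IsLUB {ρ : ℝ | Filter.liminf
      (fun n : ℕ => ENNReal.ofReal ((n : ℝ) ^ ρ * distInt ((n : ℝ) * x))) Filter.atTop = 0} t

/-- The primes `p ≤ N`. -/
def primesUpTo (N : ℕ) : Finset ℕ := (Finset.range (N + 1)).filter Nat.Prime

/-- `∑ log p` over the primes `p ≤ N`. -/
noncomputable def primeSum (N : ℕ) : ℝ := ∑ p ∈ primesUpTo N, Real.log p

open Classical in
/-- `∑ log p` over the primes `p ≤ N` such that `g(p)` lies in the Beatty sequence. -/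
noncomputable def beattyPrimeSum (g : Polynomial ℤ) (α β : ℝ) (N : ℕ) : ℝ :=
  ∑ p ∈ (primesUpTo N).filter (fun p => g.eval (p : ℤ) ∈ beatty α β), Real.log p

open Classical in
/-- `∑ log p` over the primes `p ≤ N` such that `g(p) ≤ α + β - 1`; for these primes `g(p)` is
smaller than every element of the Beatty sequence. -/
noncomputable def initialPrimeSum (g : Polynomial ℤ) (α β : ℝ) (N : ℕ) : ℝ :=
  ∑ p ∈ (primesUpTo N).filter (fun p => ((g.eval (p : ℤ) : ℤ) : ℝ) ≤ α + β - 1), Real.log p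

/-- `γ = 4 ^ (1 - k)`. -/
noncomputable def gam (k : ℕ) : ℝ := (4 : ℝ) ^ (1 - (k : ℝ))

/-- `N^ε (N q^{-γ} + N^{1-γ/2} + q^{γ/(1-γ)} N^{(1-(k+1)γ)/(1-γ)} + q^γ N^{1-kγ})`. -/
noncomputable def errorBound (k : ℕ) (ε : ℝ) (N q : ℕ) : ℝ :=
  (N : ℝ) ^ ε *
    ((N : ℝ) * (q : ℝ) ^ (-gam k)
      + (N : ℝ) ^ (1 - gam k / 2)
      + (q : ℝ) ^ (gam k / (1 - gam k)) * (N : ℝ) ^ ((1 - ((k : ℝ) + 1) * gam k) / (1 - gam k))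
      + (q : ℝ) ^ gam k * (N : ℝ) ^ (1 - (k : ℝ) * gam k))

/-- `N^{1-kγ/(t+1)+ε} + N^{1-γ/2+ε}`. -/
noncomputable def typeErrorBound (k : ℕ) (t ε : ℝ) (N : ℕ) : ℝ :=
  (N : ℝ) ^ (1 - (k : ℝ) * gam k / (t + 1) + ε) + (N : ℝ) ^ (1 - gam k / 2 + ε)

end BeattyPrimes

namespace BeattyPrimes
open Finset

/-! ### The additive character and linear exponential sums -/

/-! An integer m > α+β-1 lies in the Beatty sequence exactly when [(m-β)/α, (m-β+1)/α) contains an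
integer. As 1/α < 1, the indicator of this is 1/α plus a difference of two sawtooth values at shifts
of -m/α (`abs_beattyPrimeSum_sub_le`). An Erdős–Turán inequality (`abs_sum_saw_le`) reduces the
theorem to sums of log p · e(h g(p)/α) over p ≤ N, averaged over h ≤ H ≤ N.

Write k = n+1 and let θ be a_k/α up to sign. The saving is s^γ with γ = 4^(-n) and s = 1/q +
N^(-1/2) + q/N^k (`sav`). The average over h is never given up: h becomes part of the frequency.
Vaughan's identity leaves linear and bilinear sums. Weyl differencing bounds their inner sums by
averages of `kern` at θu, where u is a product of h, an expression in the outer variables and the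
differencing parameters. Each u has few representations by the divisor bound, and the average over
consecutive u is controlled by q (`sum_kern_le`).

In a bilinear sum Cauchy's inequality creates pairs r₁, r₂. If the shorter variable is very short,
it is taken as the pair variable: the diagonal is bounded trivially, and off it h(r₁^k - r₂^k) has
few representations (`exists_bilin_short_le`). Otherwise the longer variable forms the pairs: Fejér
kernels turn the average of `kern` over all pairs into a mean square of Weyl sums in r, and Weyl's
inequality is applied a second time (`exists_bilin_long_le`). The roots 2^n, 2^(n-1) and 2 of the
two Weyl steps and of Cauchy's inequality multiply to 4^n.

For part (ii), q is chosen by Dirichlet's theorem; finite type keeps it from being small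
(`exists_sav_le_typeErrorBound`). -/

/-- `e(x) = exp(2πix)`. -/
noncomputable def ex (x : ℝ) : ℂ := Complex.exp (((2 * Real.pi * x : ℝ) : ℂ) * Complex.I)

lemma norm_ex (x : ℝ) : ‖ex x‖ = 1 := Complex.norm_exp_ofReal_mul_I _

lemma ex_add (x y : ℝ) : ex (x + y) = ex x * ex y := by
  simp only [ex, ← Complex.exp_add]; congr 1; push_cast; ring

@[simp] lemma ex_zero : ex 0 = 1 := by simp [ex]

lemma ex_neg (x : ℝ) : ex (-x) = (starRingEnd ℂ) (ex x) := by
  simp only [ex, ← Complex.exp_conj]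
  congr 1
  rw [map_mul, Complex.conj_ofReal, Complex.conj_I]
  push_cast; ring

lemma ex_sub (x y : ℝ) : ex (x - y) = ex x * (starRingEnd ℂ) (ex y) := by
  rw [sub_eq_add_neg, ex_add, ex_neg]

lemma ex_int (n : ℤ) : ex n = 1 := by
  rw [ex, Complex.exp_eq_one_iff]
  exact ⟨n, by push_cast; ring⟩

lemma distInt_nonneg (x : ℝ) : 0 ≤ distInt x := abs_nonneg _

lemma distInt_le_half (x : ℝ) : distInt x ≤ 1 / 2 := abs_sub_round x

lemma distInt_le (x : ℝ) (n : ℤ) : distInt x ≤ |x - n| := round_le x n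

lemma distInt_neg (x : ℝ) : distInt (-x) = distInt x := by
  apply le_antisymm
  · refine (distInt_le _ (-round x)).trans (le_of_eq ?_)
    rw [distInt, ← abs_neg]; congr 1; push_cast; ring
  · refine (distInt_le _ (-round (-x))).trans (le_of_eq ?_)
    rw [distInt, ← abs_neg]; congr 1; push_cast; ring

@[simp] lemma distInt_zero : distInt 0 = 0 := by simp [distInt]

lemma norm_ex_sub_one (x : ℝ) : ‖ex x - 1‖ = 2 * |Real.sin (Real.pi * x)| := by
  have h := Complex.norm_exp_I_mul_ofReal_sub_one (2 * Real.pi * x)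
  rw [ex, mul_comm, h, Real.norm_eq_abs, abs_mul, abs_two]
  congr 3; ring

/-- Periodicity replaces x by a residue of size at most 1/2, where Jordan's inequality sin(πy) ≥ 2y
applies. -/
lemma norm_ex_sub_one_ge (x : ℝ) : 4 * distInt x ≤ ‖ex x - 1‖ := by
  have h0 : ex x = ex (x - round x) := by
    conv_lhs => rw [show x = (x - round x) + (round x : ℤ) by ring, ex_add, ex_int, mul_one]
  rw [h0, norm_ex_sub_one]
  set y := x - round x with hy
  have hd : distInt x = |y| := rfl
  have hy2 : |y| ≤ 1 / 2 := abs_sub_round x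
  have h1 : |Real.sin (Real.pi * y)| = Real.sin (Real.pi * |y|) := by
    rcases le_or_gt 0 y with h | h
    · rw [abs_of_nonneg h] at *
      rw [abs_of_nonneg]
      exact Real.sin_nonneg_of_nonneg_of_le_pi (by positivity) (by nlinarith [Real.pi_pos])
    · rw [abs_of_neg h] at *
      rw [mul_neg, Real.sin_neg, abs_of_nonpos]
      have : 0 ≤ Real.sin (Real.pi * (-y)) :=
        Real.sin_nonneg_of_nonneg_of_le_pi (by nlinarith [Real.pi_pos]) (by nlinarith [Real.pi_pos])
      rw [mul_neg, Real.sin_neg] at this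
      linarith
  have h2 := Real.mul_le_sin (x := Real.pi * |y|) (by positivity) (by nlinarith [Real.pi_pos])
  have h3 : 2 / Real.pi * (Real.pi * |y|) = 2 * |y| := by field_simp
  rw [h1, hd]; linarith

lemma sum_Ioc_int_telescope {E : Type*} [AddCommGroup E] (F : ℤ → E) {a b : ℤ} (h : a ≤ b) :
    ∑ x ∈ Ioc a b, (F (x + 1) - F x) = F (b + 1) - F (a + 1) := by
  induction b, h using Int.leInduction with
  | base => simp
  | succ n hn ih =>
    have : Ioc a (n + 1) = insert (n + 1) (Ioc a n) := by
      ext x; simp only [mem_Ioc, mem_insert]; omega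
    rw [this, sum_insert (by simp), ih]; abel

lemma sum_Ioc_natCast {E : Type*} [AddCommMonoid E] (F : ℤ → E) (a b : ℕ) :
    ∑ n ∈ Ioc a b, F n = ∑ x ∈ Ioc (a : ℤ) b, F x := by
  refine sum_bij (fun n _ => (n : ℤ)) ?_ ?_ ?_ ?_
  · intro n hn; simp only [mem_Ioc] at hn ⊢; omega
  · intro n _ n' _ h; exact_mod_cast h
  · intro x hx
    simp only [mem_Ioc] at hx
    exact ⟨x.toNat, by simp only [mem_Ioc]; omega, by omega⟩
  · intro n _; rfl

/-- A smooth version of `min(P, 1 / ‖x‖)`. -/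
noncomputable def kern (P : ℕ) (x : ℝ) : ℝ := 2 * P / (1 + P * distInt x)

lemma kern_nonneg (P : ℕ) (x : ℝ) : 0 ≤ kern P x := by
  have := distInt_nonneg x
  unfold kern; positivity

lemma kern_neg (P : ℕ) (x : ℝ) : kern P (-x) = kern P x := by
  simp [kern, distInt_neg]

lemma kern_zero (P : ℕ) : kern P 0 = 2 * P := by simp [kern]

lemma norm_sum_le_length (F : ℤ → ℝ) {a b : ℤ} {P : ℕ} (hP : b - a ≤ P) :
    ‖∑ x ∈ Ioc a b, ex (F x)‖ ≤ P := by
  refine (norm_sum_le _ _).trans ?_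
  simp only [norm_ex, sum_const, Int.card_Ioc, nsmul_eq_mul, mul_one]
  exact_mod_cast Int.toNat_le.mpr hP

/-- Multiplication by e(c) - 1 telescopes the geometric sum, so its norm times `distInt c` is at
most 1/2. Together with the trivial bound P this fits under the single majorant `kern`. -/
lemma norm_sum_linear_le (c d : ℝ) {a b : ℤ} {P : ℕ} (hP : b - a ≤ P) :
    ‖∑ x ∈ Ioc a b, ex (c * x + d)‖ ≤ kern P c := by
  have h1 := norm_sum_le_length (fun x => c * x + d) hP
  have h0 := distInt_nonneg c
  set S := ∑ x ∈ Ioc a b, ex (c * x + d) with hS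
  have h2 : ‖S‖ * distInt c ≤ 1 / 2 := by
    rcases le_or_gt a b with hab | hab
    · have h3 : (ex c - 1) * S = ex (c * (b + 1 : ℤ) + d) - ex (c * (a + 1 : ℤ) + d) := by
        rw [← sum_Ioc_int_telescope (fun x : ℤ => ex (c * x + d)) hab, hS, mul_sum]
        refine sum_congr rfl fun x _ => ?_
        rw [sub_mul, one_mul, ← ex_add]
        congr 2; push_cast; ring
      have h4 : ‖(ex c - 1) * S‖ ≤ 2 := by
        rw [h3]
        refine (norm_sub_le _ _).trans ?_
        rw [norm_ex, norm_ex]; norm_num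
      rw [norm_mul] at h4
      have := norm_ex_sub_one_ge c
      nlinarith [norm_nonneg S]
    · have : S = 0 := by rw [hS, Ioc_eq_empty (by omega), sum_empty]
      rw [this]; simp
  rw [kern, le_div_iff₀ (by positivity)]
  have hP0 : (0 : ℝ) ≤ P := by positivity
  nlinarith [norm_nonneg S]

/-! ### Polynomial phases and Weyl's inequality -/

/-- `F` is a polynomial function of degree at most `k` whose coefficient of `x ^ k` is `c`. -/
def IsPhase : ℕ → ℝ → (ℤ → ℝ) → Prop
  | 0, c, F => ∀ x, F x = c
  | k + 1, c, F => ∀ j : ℤ, IsPhase k ((k + 1) * c * j) (fun x => F (x + j) - F x)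

lemma IsPhase.sub {k : ℕ} : ∀ {c d : ℝ} {F G : ℤ → ℝ}, IsPhase k c F → IsPhase k d G →
    IsPhase k (c - d) (fun x => F x - G x) := by
  induction k with
  | zero => intro c d F G h1 h2 x; simp only [h1 x, h2 x]
  | succ k ih =>
    intro c d F G h1 h2 j
    convert ih (h1 j) (h2 j) using 1
    · ring
    · ext x; ring

lemma IsPhase.add {k : ℕ} : ∀ {c d : ℝ} {F G : ℤ → ℝ}, IsPhase k c F → IsPhase k d G →
    IsPhase k (c + d) (fun x => F x + G x) := by
  induction k with
  | zero => intro c d F G h1 h2 x; simp only [h1 x, h2 x]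
  | succ k ih =>
    intro c d F G h1 h2 j
    convert ih (h1 j) (h2 j) using 1
    · ring
    · ext x; ring

lemma IsPhase.const_mul {k : ℕ} (r : ℝ) : ∀ {c : ℝ} {F : ℤ → ℝ}, IsPhase k c F →
    IsPhase k (r * c) (fun x => r * F x) := by
  induction k with
  | zero => intro c F h x; simp only [h x]
  | succ k ih =>
    intro c F h j
    convert ih (h j) using 1
    · ring
    · ext x; ring

lemma IsPhase.comp_mul {k : ℕ} (m : ℤ) : ∀ {c : ℝ} {F : ℤ → ℝ}, IsPhase k c F →
    IsPhase k (m ^ k * c) (fun x => F (m * x)) := by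
  induction k with
  | zero => intro c F h x; simp only [h _]; simp
  | succ k ih =>
    intro c F h j
    convert ih (h (m * j)) using 1
    · push_cast; ring
    · ext x; congr 2; ring_nf

lemma IsPhase.comp_add {k : ℕ} (m : ℤ) : ∀ {c : ℝ} {F : ℤ → ℝ}, IsPhase k c F →
    IsPhase k c (fun x => F (x + m)) := by
  induction k with
  | zero => intro c F h x; simp only [h _]
  | succ k ih =>
    intro c F h j
    convert ih (h j) using 1
    ext x; congr 2; ring_nf

lemma IsPhase.succ {k : ℕ} : ∀ {c : ℝ} {F : ℤ → ℝ}, IsPhase k c F → IsPhase (k + 1) 0 F := by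
  induction k with
  | zero => intro c F h j x; simp only [h _]; simp
  | succ k ih =>
    intro c F h j
    convert ih (h j) using 1
    ring

/-- Product rule for differences: (x+j)F(x+j) - xF(x) = x(F(x+j) - F(x)) + jF(x+j). The last term
raises the factor k+1 in the leading coefficient to k+2. -/
lemma IsPhase.id_mul {k : ℕ} : ∀ {c : ℝ} {F : ℤ → ℝ}, IsPhase k c F →
    IsPhase (k + 1) c (fun x => x * F x) := by
  induction k with
  | zero => intro c F h j x; simp only [h _]; push_cast; ring
  | succ k ih =>
    intro c F h j
    have h1 := ih (h j)
    have h2 := (h.comp_add j).const_mul (j : ℝ)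
    convert h1.add h2 using 1
    · push_cast; ring
    · ext x; push_cast; ring

lemma isPhase_pow (k : ℕ) : IsPhase k 1 (fun x => (x : ℝ) ^ k) := by
  induction k with
  | zero => intro x; simp
  | succ k ih =>
    convert ih.id_mul using 1
    ext x; ring

lemma IsPhase.of_lt {k : ℕ} {c : ℝ} {F : ℤ → ℝ} (h : IsPhase k c F) {n : ℕ} (hn : k < n) :
    IsPhase n 0 F := by
  induction n, hn using Nat.le_induction with
  | base => exact h.succ
  | succ n _ ih => exact ih.succ

/-- Lower terms enter with leading coefficient 0, so later bounds see g only through its degree and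
leading coefficient. This is the source of the uniformity in the other coefficients. -/
lemma isPhase_eval (g : Polynomial ℤ) (r : ℝ) :
    IsPhase g.natDegree (r * g.leadingCoeff) (fun x => r * (g.eval x : ℤ)) := by
  have key : ∀ n ≤ g.natDegree, IsPhase g.natDegree (if n = g.natDegree then r * g.coeff n else 0)
      (fun x => r * (g.coeff n * (x : ℝ) ^ n)) := by
    intro n hn
    have h1 := ((isPhase_pow n).const_mul (g.coeff n : ℝ)).const_mul r
    split_ifs with h
    · subst h; simpa using h1
    · exact h1.of_lt (lt_of_le_of_ne hn h)
  have h2 : ∀ m ≤ g.natDegree + 1, IsPhase g.natDegree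
      (∑ n ∈ range m, if n = g.natDegree then r * g.coeff n else 0)
      (fun x => ∑ n ∈ range m, r * (g.coeff n * (x : ℝ) ^ n)) := by
    intro m
    induction m with
    | zero =>
      intro _
      simp only [range_zero, sum_empty]
      have := (isPhase_pow g.natDegree).const_mul 0
      simpa using this
    | succ m ih =>
      intro hm
      simp only [sum_range_succ]
      exact (ih (by omega)).add (key m (by omega))
  convert h2 _ le_rfl using 1
  · rw [sum_ite_eq' (range _) g.natDegree, if_pos (by simp), Polynomial.coeff_natDegree]
  · ext x
    rw [Polynomial.eval_eq_sum_range, ← mul_sum]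
    push_cast; rfl

/-- Iterated sums over differencing parameters. -/
noncomputable def diffSum (P : ℕ) : ℕ → (ℤ → ℝ) → ℤ → ℝ
  | 0, G, s => G s
  | n + 1, G, s => ∑ j ∈ Icc (-(P : ℤ)) P, diffSum P n G ((n + 2) * s * j)

/-- Weyl differencing: expand the square over pairs x, y and group by j = y - x. The x with both x
and x+j in the interval form an interval again, so the step can be iterated. -/
lemma norm_sq_sum_le (F : ℤ → ℝ) {a b : ℤ} {P : ℕ} (hP : b - a ≤ P) :
    ‖∑ x ∈ Ioc a b, ex (F x)‖ ^ 2 ≤ ∑ j ∈ Icc (-(P : ℤ)) P,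
      ‖∑ x ∈ Ioc (max a (a - j)) (min b (b - j)), ex (F (x + j) - F x)‖ := by
  have h1 : (∑ y ∈ Ioc a b, ex (F y)) * (starRingEnd ℂ) (∑ x ∈ Ioc a b, ex (F x)) =
      ∑ j ∈ Icc (-(P : ℤ)) P,
        ∑ x ∈ Ioc (max a (a - j)) (min b (b - j)), ex (F (x + j) - F x) := by
    rw [map_sum, sum_mul_sum, sum_comm]
    have h2 : ∀ x ∈ Ioc a b, ∑ y ∈ Ioc a b, ex (F y) * (starRingEnd ℂ) (ex (F x)) =
        ∑ j ∈ Icc (-(P : ℤ)) P, if x + j ∈ Ioc a b then ex (F (x + j) - F x) else 0 := by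
      intro x hx
      rw [← sum_filter]
      symm
      refine sum_bij (fun j _ => x + j) ?_ ?_ ?_ ?_
      · intro j hj; exact (mem_filter.mp hj).2
      · intro j _ j' _ h; simpa using h
      · intro y hy
        refine ⟨y - x, ?_, by ring⟩
        simp only [mem_filter, mem_Icc, mem_Ioc] at *
        omega
      · intro j _; rw [ex_sub]
    rw [sum_congr rfl h2, sum_comm]
    refine sum_congr rfl fun j _ => ?_
    rw [← sum_filter]
    refine sum_congr ?_ fun _ _ => rfl
    ext x
    simp only [mem_filter, mem_Ioc]
    omega
  rw [Complex.mul_conj] at h1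
  have h3 : ‖∑ x ∈ Ioc a b, ex (F x)‖ ^ 2 =
      ‖((Complex.normSq (∑ y ∈ Ioc a b, ex (F y)) : ℝ) : ℂ)‖ := by
    rw [Complex.norm_real, Complex.normSq_eq_norm_sq, Real.norm_of_nonneg (by positivity)]
  rw [h3, h1]
  exact norm_sum_le _ _

lemma pow_sum_le {ι : Type*} (s : Finset ι) (f : ι → ℝ) (hf : ∀ i ∈ s, 0 ≤ f i) {n : ℕ}
    (hn : 1 ≤ n) {M : ℝ} (hM : (s.card : ℝ) ≤ M) :
    (∑ i ∈ s, f i) ^ n ≤ M ^ (n - 1) * ∑ i ∈ s, f i ^ n := by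
  obtain ⟨m, rfl⟩ : ∃ m, n = m + 1 := ⟨n - 1, by omega⟩
  have h := pow_sum_div_card_le_sum_pow (s := s) (f := f) hf m
  have h0 : 0 ≤ ∑ i ∈ s, f i ^ (m + 1) := sum_nonneg fun i hi => pow_nonneg (hf i hi) _
  rcases s.eq_empty_or_nonempty with rfl | hs
  · simp
  have hc : (0 : ℝ) < s.card := by exact_mod_cast hs.card_pos
  rw [div_le_iff₀ (by positivity)] at h
  simp only [Nat.add_sub_cancel]
  calc _ ≤ _ := h
    _ = (s.card : ℝ) ^ m * ∑ i ∈ s, f i ^ (m + 1) := by ring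
    _ ≤ _ := by gcongr

/-- Weyl's inequality, before averaging over the leading coefficient. -/
lemma weyl_inequality (θ : ℝ) {P : ℕ} (hP1 : 1 ≤ P) (n : ℕ) : ∀ (s : ℤ) (F : ℤ → ℝ),
    IsPhase (n + 1) (θ * s) F → ∀ a b : ℤ, b - a ≤ P →
    ‖∑ x ∈ Ioc a b, ex (F x)‖ ^ (2 ^ n) ≤
      (3 * P : ℝ) ^ (2 ^ n - (n + 1)) * diffSum P n (fun u => kern P (θ * u)) s := by
  induction n with
  | zero =>
    intro s F hF a b hab
    have h1 : ∀ x, F x = (θ * s) * x + F 0 := by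
      intro x
      have := hF x 0
      simp only [zero_add] at this
      rw [sub_eq_iff_eq_add] at this
      rw [this]; push_cast; ring
    simp only [diffSum]
    have h2 := norm_sum_linear_le (θ * s) (F 0) hab
    simpa [← h1] using h2
  | succ n ih =>
    intro s F hF a b hab
    have hn : n + 1 ≤ 2 ^ n := Nat.lt_two_pow_self
    have h1 := norm_sq_sum_le F hab
    have hcard : ((Icc (-(P : ℤ)) P).card : ℝ) ≤ 3 * P := by
      rw [Int.card_Icc]
      have : ((P : ℤ) + 1 - -(P : ℤ)).toNat ≤ 3 * P := by omega
      exact_mod_cast this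
    have h2 := pow_sum_le (Icc (-(P : ℤ)) P)
      (fun j => ‖∑ x ∈ Ioc (max a (a - j)) (min b (b - j)), ex (F (x + j) - F x)‖)
      (fun _ _ => norm_nonneg _) (n := 2 ^ n) Nat.one_le_two_pow hcard
    have h3 : ∀ j ∈ Icc (-(P : ℤ)) P,
        ‖∑ x ∈ Ioc (max a (a - j)) (min b (b - j)), ex (F (x + j) - F x)‖ ^ (2 ^ n) ≤
        (3 * P : ℝ) ^ (2 ^ n - (n + 1)) *
          diffSum P n (fun u => kern P (θ * u)) ((n + 2) * s * j) := by
      intro j _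
      refine ih _ (fun x => F (x + j) - F x) ?_ _ _ (by omega)
      convert hF j using 1
      push_cast; ring
    calc ‖∑ x ∈ Ioc a b, ex (F x)‖ ^ (2 ^ (n + 1))
        = (‖∑ x ∈ Ioc a b, ex (F x)‖ ^ 2) ^ (2 ^ n) := by rw [← pow_mul, pow_succ']
      _ ≤ _ := pow_le_pow_left₀ (by positivity) h1 _
      _ ≤ _ := h2
      _ ≤ (3 * P : ℝ) ^ (2 ^ n - 1) * ∑ j ∈ Icc (-(P : ℤ)) P, ((3 * P : ℝ) ^ (2 ^ n - (n + 1)) *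
          diffSum P n (fun u => kern P (θ * u)) ((n + 2) * s * j)) := by
          gcongr with j hj; exact h3 j hj
      _ = _ := by
          -- The exponents add up as (2^n - 1) + (2^n - (n+1)) = 2^(n+1) - (n+2); the truncated
          -- subtractions are exact because n+1 ≤ 2^n.
          rw [← mul_sum, ← mul_assoc, ← pow_add, diffSum]
          congr 2
          rw [pow_succ]; omega

/-! ### Averages of the linear kernel over multiples of `θ` -/

/-- `a / q` is a reduced fraction with `|θ - a / q| ≤ 1 / q ^ 2`. -/
structure IsApprox (θ : ℝ) (a : ℤ) (q : ℕ) : Prop where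
  one_le : 1 ≤ q
  coprime : IsCoprime a (q : ℤ)
  abs_sub_le : |θ - a / q| ≤ 1 / (q : ℝ) ^ 2

/-- `D` bounds the number of divisors and the logarithm of every positive integer up to `L`. -/
structure DivBound (D : ℝ) (L : ℕ) : Prop where
  one_le : 1 ≤ D
  card_le : ∀ n, 1 ≤ n → n ≤ L → (n.divisors.card : ℝ) ≤ D
  log_le : 1 + Real.log L ≤ D

lemma distInt_ge_of_eq {t η : ℝ} {m : ℤ} {ρ q : ℕ} (hq : 0 < q)
    (ht : t = m + ρ / q + η) (hη : |η| ≤ 2 / q) :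
    min (ρ : ℝ) (q - ρ) / q - 2 / q ≤ distInt t := by
  have hq' : (0 : ℝ) < q := by exact_mod_cast hq
  have h1 := abs_le.mp hη
  rw [distInt]
  set n := round t - m with hn
  have h2 : t - round t = ρ / q + η - n := by
    rw [hn]; push_cast; linarith
  rw [h2]
  rcases le_or_gt n 0 with h | h
  · have : (n : ℝ) ≤ 0 := by exact_mod_cast h
    have h3 : min (ρ : ℝ) (q - ρ) / q ≤ ρ / q := by gcongr; exact min_le_left _ _
    exact le_trans (by linarith [h1.1]) (le_abs_self _)
  · have : (1 : ℝ) ≤ n := by exact_mod_cast h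
    have h3 : min (ρ : ℝ) (q - ρ) / q ≤ (q - ρ) / q := by gcongr; exact min_le_right _ _
    have h4 : ((q : ℝ) - ρ) / q = 1 - ρ / q := by field_simp
    exact le_trans (by linarith [h1.2]) (neg_le_abs _)

lemma kern_le (P : ℕ) (x : ℝ) : kern P x ≤ 2 * P := by
  have := distInt_nonneg x
  rw [kern, div_le_iff₀ (by positivity)]
  have : (0 : ℝ) ≤ P * (P * distInt x) := by positivity
  nlinarith

lemma kern_le_div {P : ℕ} {x d : ℝ} (hd : 0 < d) (h : d ≤ distInt x) : kern P x ≤ 2 / d := by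
  have := distInt_nonneg x
  rw [kern, div_le_div_iff₀ (by positivity) hd]
  have : (P : ℝ) * d ≤ P * distInt x := by gcongr
  nlinarith

/-- As s runs over q consecutive integers, qθs stays within 2 of integers that run through all
residues mod q. At most three residues at either end are bounded by 2P; the others give a harmonic
sum. -/
lemma sum_block_kern_le {θ : ℝ} {a : ℤ} {q : ℕ} (h : IsApprox θ a q) (P : ℕ) (s₀ : ℤ) :
    ∑ r ∈ range q, kern P (θ * ((s₀ + r : ℤ) : ℝ)) ≤ 24 * (P + q * (1 + Real.log q)) := by
  have hq : 0 < q := h.one_le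
  have hq' : (0 : ℝ) < q := by exact_mod_cast hq
  set c : ℤ := ⌊q * (θ * s₀)⌋ with hc
  let ρ : ℕ → ℕ := fun r => ((r * a + c) % q).toNat
  have hρ : ∀ r, ((ρ r : ℕ) : ℤ) = (r * a + c) % q := fun r =>
    Int.toNat_of_nonneg (Int.emod_nonneg _ (by omega))
  have hρlt : ∀ r, ρ r < q := fun r => by
    have := Int.emod_lt_of_pos (r * a + c) (by omega : (0 : ℤ) < q)
    have := hρ r
    omega
  -- Dividing by x+1 rather than x avoids a zero denominator and doubles the constant 6 to 12. The
  -- terms in q-1-x measure the distance to the other end and are summed by reflecting `range q`.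
  let B : ℕ → ℝ := fun x => (if x ≤ 2 then 2 * (P : ℝ) else 0) +
    (if q - 1 - x ≤ 2 then 2 * (P : ℝ) else 0) + 12 * q * (1 / ((x : ℝ) + 1)) +
    12 * q * (1 / (((q - 1 - x : ℕ) : ℝ) + 1))
  have key : ∀ r ∈ range q, kern P (θ * ((s₀ + r : ℤ) : ℝ)) ≤ B (ρ r) := by
    intro r hr
    have hrq : (r : ℝ) ≤ q := by exact_mod_cast (mem_range.mp hr).le
    have hp1 : 0 ≤ 12 * q * (1 / ((ρ r : ℝ) + 1)) := by positivity
    have hp2 : 0 ≤ 12 * q * (1 / (((q - 1 - ρ r : ℕ) : ℝ) + 1)) := by positivity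
    have hP0 : (0 : ℝ) ≤ P := by positivity
    by_cases h1 : ρ r ≤ 2
    · refine (kern_le _ _).trans ?_
      simp only [B, if_pos h1]
      split_ifs <;> linarith
    by_cases h2 : q - 1 - ρ r ≤ 2
    · refine (kern_le _ _).trans ?_
      simp only [B, if_pos h2]
      split_ifs; linarith
    simp only [B, if_neg h1, if_neg h2, zero_add]
    have hlt := hρlt r
    push Not at h1 h2
    obtain ⟨m, hm⟩ : ∃ m : ℤ, r * a + c = m * q + ρ r :=
      ⟨(r * a + c) / q, by rw [hρ]; exact (Int.mul_comm _ _ ▸ Int.mul_ediv_add_emod _ _).symm⟩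
    have hm' : (r : ℝ) * a + c = m * q + ρ r := by exact_mod_cast hm
    have hfl := Int.floor_le (q * (θ * s₀))
    have hfl2 := Int.lt_floor_add_one (q * (θ * s₀))
    rw [← hc] at hfl hfl2
    have hd := h.abs_sub_le
    set η : ℝ := θ * ((s₀ + r : ℤ) : ℝ) - m - ρ r / q with hη
    have hη1 : η = (q * (θ * s₀) - c) / q + r * (θ - a / q) := by
      have e1 : (m : ℝ) + ρ r / q = (r * a + c) / q := by rw [hm']; field_simp
      have : η = θ * ((s₀ + r : ℤ) : ℝ) - (m + ρ r / q) := by rw [hη]; ring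
      rw [this, e1]; push_cast; field_simp; ring
    have hη2 : |η| ≤ 2 / q := by
      rw [hη1]
      refine (abs_add_le _ _).trans ?_
      have e1 : |(q * (θ * s₀) - c) / q| ≤ 1 / q := by
        rw [abs_div, abs_of_pos hq']
        gcongr
        rw [abs_of_nonneg (by linarith)]; linarith
      have e2 : |r * (θ - a / q)| ≤ 1 / q := by
        rw [abs_mul, Nat.abs_cast]
        calc (r : ℝ) * |θ - a / q| ≤ q * (1 / (q : ℝ) ^ 2) := by gcongr
          _ = 1 / q := by field_simp
      calc _ ≤ 1 / (q : ℝ) + 1 / q := add_le_add e1 e2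
        _ = 2 / q := by ring
    have hdist := distInt_ge_of_eq (t := θ * ((s₀ + r : ℤ) : ℝ)) (m := m) (ρ := ρ r) hq
      (by rw [hη]; ring) hη2
    have hx3 : (3 : ℝ) ≤ ρ r := by exact_mod_cast h1
    have hy3 : (3 : ℝ) ≤ q - ρ r := by
      have : ρ r + 3 ≤ q := by omega
      have : ((ρ r : ℝ)) + 3 ≤ q := by exact_mod_cast this
      linarith
    have hcast : ((q - 1 - ρ r : ℕ) : ℝ) + 1 = q - ρ r := by
      have : (q - 1 - ρ r) + 1 + ρ r = q := by omega
      have : (((q - 1 - ρ r : ℕ) : ℝ)) + 1 + ρ r = q := by exact_mod_cast this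
      linarith
    rw [hcast]
    have hmin : 3 ≤ min (ρ r : ℝ) (q - ρ r) := le_min hx3 hy3
    have hd2 : min (ρ r : ℝ) (q - ρ r) / (3 * q) ≤ distInt (θ * ((s₀ + r : ℤ) : ℝ)) := by
      refine le_trans ?_ hdist
      rw [← sub_div, div_le_div_iff₀ (by positivity) hq']
      nlinarith
    refine (kern_le_div (by positivity) hd2).trans ?_
    have e1 : 2 / (min (ρ r : ℝ) (q - ρ r) / (3 * q)) = 6 * q / min (ρ r : ℝ) (q - ρ r) := by
      field_simp; norm_num
    rw [e1]
    rcases min_choice (ρ r : ℝ) (q - ρ r) with hh | hh <;> rw [hh]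
    · have : 6 * (q : ℝ) / ρ r ≤ 12 * q * (1 / ((ρ r : ℝ) + 1)) := by
        rw [mul_one_div, div_le_div_iff₀ (by linarith) (by linarith)]; nlinarith
      have : 0 ≤ 12 * q * (1 / ((q : ℝ) - ρ r)) := by
        have : (0 : ℝ) < q - ρ r := by linarith
        positivity
      linarith
    · have : 6 * (q : ℝ) / (q - ρ r) ≤ 12 * q * (1 / ((q : ℝ) - ρ r)) := by
        rw [mul_one_div]
        have : (0 : ℝ) < q - ρ r := by linarith
        gcongr; norm_num
      linarith
  -- Coprimality of a and q makes r ↦ ra + c a permutation of the residues mod q.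
  have hinj : Set.InjOn ρ (range q) := by
    intro r hr r' hr' hrr
    have hr := mem_range.mp (mem_coe.mp hr)
    have hr' := mem_range.mp (mem_coe.mp hr')
    have e1 : ((r : ℤ) * a + c) % q = ((r' : ℤ) * a + c) % q := by rw [← hρ, ← hρ, hrr]
    have e2 : (q : ℤ) ∣ ((r : ℤ) - r') * a := by
      have := Int.ModEq.dvd (Int.ModEq.symm e1 : _ ≡ _ [ZMOD q])
      convert this using 1; ring
    have e3 : (q : ℤ) ∣ (r : ℤ) - r' := h.coprime.symm.dvd_of_dvd_mul_right e2
    have e4 := Int.eq_zero_of_abs_lt_dvd e3 (by rw [abs_lt]; omega)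
    omega
  have himg : (range q).image ρ = range q := by
    apply eq_of_subset_of_card_le
    · intro x hx
      obtain ⟨r, _, rfl⟩ := mem_image.mp hx
      exact mem_range.mpr (hρlt r)
    · rw [card_image_of_injOn hinj]
  have hH : ∑ x ∈ range q, 1 / ((x : ℝ) + 1) ≤ 1 + Real.log q := by
    have := harmonic_le_one_add_log q
    simpa [harmonic] using this
  have hrefl : ∀ f : ℕ → ℝ, ∑ x ∈ range q, f (q - 1 - x) = ∑ x ∈ range q, f x :=
    fun f => sum_range_reflect f q
  have h3 : ∑ x ∈ range q, (if x ≤ 2 then 2 * (P : ℝ) else 0) ≤ 6 * P := by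
    rw [← sum_filter, sum_const, nsmul_eq_mul]
    have : ((range q).filter (· ≤ 2)).card ≤ 3 := by
      calc _ ≤ (range 3).card := card_le_card (by
            intro x hx; simp only [mem_filter, mem_range] at *; omega)
        _ = 3 := card_range 3
    have : (((range q).filter (· ≤ 2)).card : ℝ) ≤ 3 := by exact_mod_cast this
    nlinarith [(Nat.cast_nonneg P : (0 : ℝ) ≤ P)]
  calc _ ≤ ∑ r ∈ range q, B (ρ r) := sum_le_sum key
    _ = ∑ x ∈ (range q).image ρ, B x := (sum_image hinj).symm
    _ = ∑ x ∈ range q, B x := by rw [himg]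
    _ ≤ 6 * P + 6 * P + 12 * q * (1 + Real.log q) + 12 * q * (1 + Real.log q) := by
      simp only [B, sum_add_distrib, ← mul_sum]
      rw [hrefl (fun x => if x ≤ 2 then 2 * (P : ℝ) else 0), hrefl (fun x => 1 / ((x : ℝ) + 1))]
      gcongr
    _ ≤ _ := by nlinarith [(Nat.cast_nonneg P : (0 : ℝ) ≤ P)]

/-- Cover [1, S] by blocks of length q; the last one may be completed because `kern` is nonnegative.
-/
lemma sum_kern_le {θ : ℝ} {a : ℤ} {q : ℕ} (h : IsApprox θ a q) (P S : ℕ) :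
    ∑ s ∈ Icc 1 S, kern P (θ * ((s : ℤ) : ℝ)) ≤
      (S / q + 1) * (24 * (P + q * (1 + Real.log q))) := by
  have hq : 0 < q := h.one_le
  have key : ∀ n : ℕ, ∑ s ∈ range (n * q), kern P (θ * ((1 + s : ℤ) : ℝ)) ≤
      n * (24 * (P + q * (1 + Real.log q))) := by
    intro n
    induction n with
    | zero => simp
    | succ n ih =>
      rw [Nat.succ_mul, sum_range_add]
      have := sum_block_kern_le h P (1 + n * q)
      push_cast at *
      simp only [← add_assoc]
      linarith
  have h2 := key (S / q + 1)
  have h3 : ∑ s ∈ Icc 1 S, kern P (θ * ((s : ℤ) : ℝ)) =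
      ∑ s ∈ range S, kern P (θ * ((1 + s : ℤ) : ℝ)) := by
    refine sum_nbij' (fun s => s - 1) (fun s => s + 1) ?_ ?_ ?_ ?_ ?_
    · intro s hs; simp only [mem_Icc, mem_range] at *; omega
    · intro s hs; simp only [mem_Icc, mem_range] at *; omega
    · intro s hs; simp only [mem_Icc] at *; omega
    · intro s hs; simp
    · intro s hs
      have : 1 ≤ s := (mem_Icc.mp hs).1
      congr 3; push_cast [this]; ring
  have hlog : 0 ≤ Real.log q := Real.log_natCast_nonneg q
  rw [h3]
  calc _ ≤ ∑ s ∈ range ((S / q + 1) * q), kern P (θ * ((1 + s : ℤ) : ℝ)) := by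
        refine sum_le_sum_of_subset_of_nonneg ?_ fun _ _ _ => kern_nonneg _ _
        intro x hx
        have := Nat.lt_div_mul_add (a := S) hq
        simp only [mem_range] at *
        rw [Nat.succ_mul]; omega
    _ ≤ _ := h2
    _ ≤ _ := by
        gcongr
        push_cast
        gcongr
        exact Nat.cast_div_le

/-! ### Sums over products -/

/-- A multiplicity count: φ and ψ together are injective, and ψ has at most M possible values once φ
is known, so φ takes each value at most M times. In the applications ψ consists of divisors of φ. -/
lemma sum_comp_le_of_fibers {ι κ : Type*} [DecidableEq κ] (T : Finset ι) (φ : ι → ℕ) (ψ : ι → κ)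
    (E : ℕ → Finset κ) {W : ℕ} {M : ℝ} {G : ℕ → ℝ} (hG : ∀ n, 0 ≤ G n)
    (hφ : ∀ i ∈ T, φ i ∈ Icc 1 W) (hψ : ∀ i ∈ T, ψ i ∈ E (φ i))
    (hinj : ∀ i ∈ T, ∀ j ∈ T, φ i = φ j → ψ i = ψ j → i = j)
    (hE : ∀ n ∈ Icc 1 W, ((E n).card : ℝ) ≤ M) :
    ∑ i ∈ T, G (φ i) ≤ M * ∑ w ∈ Icc 1 W, G w := by
  rw [← sum_fiberwise_of_maps_to hφ, mul_sum]
  refine sum_le_sum fun w hw => ?_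
  have h1 : ∑ i ∈ T with φ i = w, G (φ i) = ((T.filter (φ · = w)).card : ℝ) * G w := by
    rw [← nsmul_eq_mul, ← sum_const]
    exact sum_congr rfl fun i hi => by rw [(mem_filter.mp hi).2]
  rw [h1]
  refine mul_le_mul_of_nonneg_right (le_trans ?_ (hE w hw)) (hG w)
  have : (T.filter (φ · = w)).card ≤ (E w).card := by
    refine card_le_card_of_injOn ψ ?_ ?_
    · intro i hi
      have hi := mem_filter.mp hi
      exact hi.2 ▸ hψ i hi.1
    · intro i hi j hj hij
      have hi := mem_filter.mp (mem_coe.mp hi)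
      have hj := mem_filter.mp (mem_coe.mp hj)
      exact hinj i hi.1 j hj.1 (hi.2.trans hj.2.symm) hij
  exact_mod_cast this

lemma sum_sum_mul_le {D : ℝ} {L : ℕ} (hD : DivBound D L) {c S P : ℕ} (hc : 1 ≤ c)
    (hL : c * S * P ≤ L) {G : ℕ → ℝ} (hG : ∀ n, 0 ≤ G n) :
    ∑ s ∈ Icc 1 S, ∑ j ∈ Icc 1 P, G (c * s * j) ≤ D * ∑ w ∈ Icc 1 (c * S * P), G w := by
  rw [← sum_product']
  refine sum_comp_le_of_fibers (Icc 1 S ×ˢ Icc 1 P) (fun i => c * i.1 * i.2) (fun i => i.2)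
    Nat.divisors hG ?_ ?_ ?_ ?_
  · rintro ⟨s, j⟩ h
    simp only [mem_product, mem_Icc] at h ⊢
    obtain ⟨⟨h1, h2⟩, h3, h4⟩ := h
    exact ⟨Nat.mul_pos (Nat.mul_pos hc h1) h3, by gcongr⟩
  · rintro ⟨s, j⟩ h
    simp only [mem_product, mem_Icc] at h
    simp only [Nat.mem_divisors]
    exact ⟨Dvd.intro_left _ rfl, (Nat.mul_pos (Nat.mul_pos hc h.1.1) h.2.1).ne'⟩
  · rintro ⟨s, j⟩ h ⟨s', j'⟩ h' h1 h2
    simp only [mem_product, mem_Icc] at h h' h1 h2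
    subst h2
    have := Nat.eq_of_mul_eq_mul_right h.2.1 h1
    have := Nat.eq_of_mul_eq_mul_left hc this
    rw [this]
  · intro n hn
    have := mem_Icc.mp hn
    exact hD.card_le n this.1 (this.2.trans hL)

/-! ### Averages of iterated difference sums -/

lemma diffSum_neg {P : ℕ} {G : ℤ → ℝ} (hG : ∀ s, G (-s) = G s) (n : ℕ) (s : ℤ) :
    diffSum P n G (-s) = diffSum P n G s := by
  induction n generalizing s with
  | zero => exact hG s
  | succ n ih =>
    simp only [diffSum]
    refine sum_congr rfl fun j _ => ?_
    rw [← ih]; congr 1; ring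

lemma diffSum_nonneg {P : ℕ} {G : ℤ → ℝ} (hG : ∀ s, 0 ≤ G s) (n : ℕ) (s : ℤ) :
    0 ≤ diffSum P n G s := by
  induction n generalizing s with
  | zero => exact hG s
  | succ n ih => exact sum_nonneg fun j _ => ih _

lemma card_Icc_neg_le {P : ℕ} (hP : 1 ≤ P) : ((Icc (-(P : ℤ)) P).card : ℝ) ≤ 3 * P := by
  rw [Int.card_Icc]
  have : ((P : ℤ) + 1 - -(P : ℤ)).toNat ≤ 3 * P := by omega
  exact_mod_cast this

lemma diffSum_zero_le {P : ℕ} (hP : 1 ≤ P) {G : ℤ → ℝ} (hG : ∀ s, 0 ≤ G s) (n : ℕ) :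
    diffSum P n G 0 ≤ (3 * P) ^ n * G 0 := by
  induction n with
  | zero => simp [diffSum]
  | succ n ih =>
    simp only [diffSum, mul_zero, zero_mul, sum_const, nsmul_eq_mul]
    calc _ ≤ (3 * P : ℝ) * ((3 * P) ^ n * G 0) :=
          mul_le_mul (card_Icc_neg_le hP) ih (diffSum_nonneg hG _ _) (by positivity)
      _ = _ := by ring

lemma sum_Icc_neg_eq (P : ℕ) {f : ℤ → ℝ} (hf : ∀ j, f (-j) = f j) :
    ∑ j ∈ Icc (-(P : ℤ)) P, f j = f 0 + 2 * ∑ j ∈ Icc 1 P, f (j : ℕ) := by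
  induction P with
  | zero => simp
  | succ P ih =>
    have : Icc (-((P + 1 : ℕ) : ℤ)) ((P + 1 : ℕ) : ℤ) =
        insert (-((P + 1 : ℕ) : ℤ)) (insert ((P + 1 : ℕ) : ℤ) (Icc (-(P : ℤ)) P)) := by
      ext x; simp only [mem_Icc, mem_insert]; omega
    rw [this, sum_insert, sum_insert, ih, sum_Icc_succ_top (by omega), hf]
    · ring
    · simp
    · simp only [mem_insert, mem_Icc]; omega

/-- Induction on n: the term j = 0 is bounded trivially, the terms ±j agree, and each product
(n+2)sj repeats at most D times, so the double sum becomes a single sum over a longer range. The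
parameter g₀ is left free because it is 2 for one kernel and 2R² for a sum over pairs. -/
lemma exists_sum_diffSum_le (n : ℕ) : ∃ c : ℝ, 0 < c ∧ ∀ (D : ℝ) (L P S : ℕ) (G : ℤ → ℝ) (g₀ : ℝ),
    DivBound D L → 1 ≤ P → (n + 1).factorial * S * P ^ n ≤ L → (∀ s, 0 ≤ G s) →
    (∀ s, G (-s) = G s) → G 0 ≤ P * g₀ →
    ∑ s ∈ Icc 1 S, diffSum P n G (s : ℕ) ≤
      c * D ^ n * (S * P ^ n * g₀ + ∑ w ∈ Icc 1 ((n + 1).factorial * S * P ^ n), G (w : ℕ)) := by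
  induction n with
  | zero =>
    refine ⟨1, one_pos, ?_⟩
    intro D L P S G g₀ hD hP hL hG hG' hg
    have h0 : 0 ≤ g₀ := by
      have h1 : (0 : ℝ) < P := by exact_mod_cast hP
      exact nonneg_of_mul_nonneg_right ((hG 0).trans hg) h1
    simp only [diffSum, zero_add, Nat.factorial_one, one_mul, pow_zero, mul_one]
    have : (0 : ℝ) ≤ S * g₀ := by positivity
    linarith
  | succ n ih =>
    obtain ⟨c, hc, ih⟩ := ih
    refine ⟨3 ^ n + 2 * (n + 2) * c, by positivity, ?_⟩
    intro D L P S G g₀ hD hP hL hG hG' hg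
    have hP' : (0 : ℝ) < P := by exact_mod_cast hP
    have h0 : 0 ≤ g₀ := nonneg_of_mul_nonneg_right ((hG 0).trans hg) hP'
    have hD0 : 1 ≤ D := hD.one_le
    have hL1 : (n + 2) * S * P ≤ L := by
      refine le_trans ?_ hL
      have e1 : n + 2 ≤ (n + 1 + 1).factorial := Nat.self_le_factorial _
      have e2 : P ≤ P ^ (n + 1) := Nat.le_self_pow (by omega) _
      gcongr
    have hfac : (n + 1).factorial * ((n + 2) * S * P) * P ^ n =
        (n + 1 + 1).factorial * S * P ^ (n + 1) := by
      rw [Nat.factorial_succ (n + 1)]; ring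
    have h1 : ∑ s ∈ Icc 1 S, diffSum P (n + 1) G (s : ℕ) =
        S * diffSum P n G 0 + 2 * ∑ s ∈ Icc 1 S, ∑ j ∈ Icc 1 P,
          (fun m : ℕ => diffSum P n G (m : ℕ)) ((n + 2) * s * j) := by
      have : ∀ s ∈ Icc 1 S, diffSum P (n + 1) G (s : ℕ) = diffSum P n G 0 +
          2 * ∑ j ∈ Icc 1 P, (fun m : ℕ => diffSum P n G (m : ℕ)) ((n + 2) * s * j) := by
        intro s _
        rw [diffSum, sum_Icc_neg_eq]
        · push_cast; simp
        · intro j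
          rw [← diffSum_neg hG']; congr 1; ring
      rw [sum_congr rfl this, sum_add_distrib, ← mul_sum]
      simp
    have h2 := sum_sum_mul_le hD (c := n + 2) (S := S) (P := P) (by omega) hL1
      (G := fun m : ℕ => diffSum P n G (m : ℕ)) (fun _ => diffSum_nonneg hG _ _)
    have h3 := ih D L P ((n + 2) * S * P) G g₀ hD hP (by rw [hfac]; exact hL) hG hG' hg
    rw [hfac] at h3
    have h4 : diffSum P n G 0 ≤ (3 * P) ^ n * (P * g₀) :=
      (diffSum_zero_le hP hG n).trans (by gcongr)
    set T := ∑ w ∈ Icc 1 ((n + 1 + 1).factorial * S * P ^ (n + 1)), G (w : ℕ) with hT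
    have hT0 : 0 ≤ T := sum_nonneg fun _ _ => hG _
    have hX : 0 ≤ (S : ℝ) * P ^ (n + 1) * g₀ := by positivity
    rw [h1]
    calc _ ≤ S * ((3 * P) ^ n * (P * g₀)) + 2 * (D * (c * D ^ n *
          (((n + 2) * S * P : ℕ) * P ^ n * g₀ + T))) := by
          gcongr
          exact h2.trans (by gcongr)
      _ = 3 ^ n * (S * P ^ (n + 1) * g₀) * 1 +
          2 * c * D ^ (n + 1) * ((n + 2) * (S * P ^ (n + 1) * g₀) + T) := by
          push_cast; rw [mul_pow]; ring
      _ ≤ 3 ^ n * (S * P ^ (n + 1) * g₀ + T) * D ^ (n + 1) +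
          2 * c * D ^ (n + 1) * ((n + 2) * (S * P ^ (n + 1) * g₀ + T)) := by
          gcongr
          · linarith
          · exact one_le_pow₀ hD0
          · nlinarith
      _ = _ := by ring

/-- The U = (n+1)! S P^n frequencies contribute about (U/q + 1)(P + q log q); relative to S P^(n+1)
this is 1/P + 1/q + q/(S P^(n+1)). For n ≥ 1 a stray P is absorbed by S P^n. -/
lemma exists_sum_diffSum_kern_le (n : ℕ) (hn : 1 ≤ n) : ∃ c : ℝ, 0 < c ∧
    ∀ (D : ℝ) (L P S : ℕ) (θ : ℝ) (a : ℤ) (q : ℕ),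
    DivBound D L → IsApprox θ a q → q ≤ L → 1 ≤ P → 1 ≤ S → (n + 1).factorial * S * P ^ n ≤ L →
    ∑ s ∈ Icc 1 S, diffSum P n (fun u => kern P (θ * u)) (s : ℕ) ≤
      c * D ^ (n + 1) * (S * P ^ (n + 1)) * (1 / P + 1 / q + q / (S * P ^ (n + 1))) := by
  obtain ⟨c, hc, h⟩ := exists_sum_diffSum_le n
  refine ⟨c * (2 + 48 * (n + 1).factorial), by positivity, ?_⟩
  intro D L P S θ a q hD hθ hqL hP hS hL
  have hq : (0 : ℝ) < q := by exact_mod_cast hθ.one_le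
  have hP' : (1 : ℝ) ≤ P := by exact_mod_cast hP
  have hS' : (1 : ℝ) ≤ S := by exact_mod_cast hS
  have hD1 := hD.one_le
  have h1 := h D L P S (fun u => kern P (θ * u)) 2 hD hP hL (fun _ => kern_nonneg _ _)
    (fun s => by simp only [Int.cast_neg, mul_neg, kern_neg]) (by simp [kern_zero, mul_comm])
  have h2 := sum_kern_le hθ P ((n + 1).factorial * S * P ^ n)
  have hlog : 1 + Real.log q ≤ D := by
    refine le_trans ?_ hD.log_le
    gcongr
  have hlog0 : 0 ≤ Real.log q := Real.log_natCast_nonneg q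
  set f : ℝ := ((n + 1).factorial : ℝ) with hf
  have hf1 : 1 ≤ f := by rw [hf]; exact_mod_cast Nat.factorial_pos _
  have h3 : ∑ w ∈ Icc 1 ((n + 1).factorial * S * P ^ n), kern P (θ * ((w : ℤ) : ℝ)) ≤
      (f * S * P ^ n / q + 1) * (24 * D * (P + q)) := by
    refine h2.trans ?_
    push_cast
    rw [← hf]
    refine mul_le_mul_of_nonneg_left ?_ (by positivity)
    have e : (q : ℝ) * (1 + Real.log q) ≤ q * D := by gcongr
    have e2 : (P : ℝ) ≤ P * D := le_mul_of_one_le_right (by positivity) hD1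
    nlinarith
  refine h1.trans ?_
  have hY : (P : ℝ) ≤ S * P ^ n := by
    calc (P : ℝ) = 1 * P ^ 1 := by ring
      _ ≤ S * P ^ n := by gcongr
  set Y : ℝ := S * P ^ n with hYd
  have hY0 : 0 < Y := by positivity
  have hSP : (S : ℝ) * P ^ (n + 1) = Y * P := by rw [hYd]; ring
  rw [hSP]
  calc _ ≤ c * D ^ n * (Y * 2 + (f * Y / q + 1) * (24 * D * (P + q))) := by
        have : f * S * (P : ℝ) ^ n = f * Y := by rw [hYd]; ring
        rw [this] at h3
        gcongr
    _ ≤ c * D ^ n * (D * (2 + 48 * f) * (Y + Y * P / q + q)) := by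
        gcongr
        have e1 : (f * Y / q + 1) * (24 * D * (P + q)) =
            24 * D * (f * (Y * P / q) + f * Y + P + q) := by field_simp; ring
        have e2 : Y * 2 ≤ D * (Y * 2) := le_mul_of_one_le_left (by positivity) hD1
        have hX : 0 ≤ Y * P / q := by positivity
        have e3 : f * (Y * P / q) + f * Y + P + q ≤ 2 * f * (Y + Y * P / q + q) := by
          nlinarith [mul_nonneg (sub_nonneg.mpr hf1) hY0.le, mul_nonneg (sub_nonneg.mpr hf1) hX,
            mul_nonneg (sub_nonneg.mpr hf1) hq.le]
        rw [e1]
        have e4 : D * (f * (Y * P / q) + f * Y + P + q) ≤ D * (2 * f * (Y + Y * P / q + q)) := by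
          gcongr
        have e5 : 0 ≤ D * (Y * P / q) := by positivity
        have e6 : 0 ≤ D * q := by positivity
        nlinarith
    _ = _ := by field_simp; ring

/-! ### Linear averages of Weyl sums -/

/-- Hölder's inequality over the whole family keeps the average over the leading coefficients θ
s(i), which is where the saving comes from; a single one could lie close to an integer. -/
lemma weyl_family {ι : Type*} (T : Finset ι) (θ : ℝ) {P : ℕ} (hP : 1 ≤ P) (n : ℕ) (s : ι → ℤ)
    (F : ι → ℤ → ℝ) (hF : ∀ i ∈ T, IsPhase (n + 1) (θ * s i) (F i)) (a b : ι → ℤ)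
    (hab : ∀ i ∈ T, b i - a i ≤ P) {M : ℝ} (hM : (T.card : ℝ) ≤ M) :
    (∑ i ∈ T, ‖∑ x ∈ Ioc (a i) (b i), ex (F i x)‖) ^ (2 ^ n) ≤
      M ^ (2 ^ n - 1) * ((3 * P : ℝ) ^ (2 ^ n - (n + 1)) *
        ∑ i ∈ T, diffSum P n (fun u => kern P (θ * u)) (s i)) := by
  have hM0 : 0 ≤ M := le_trans (by positivity) hM
  refine (pow_sum_le T _ (fun _ _ => norm_nonneg _) Nat.one_le_two_pow hM).trans ?_
  refine mul_le_mul_of_nonneg_left ?_ (by positivity)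
  rw [mul_sum]
  exact sum_le_sum fun i hi => weyl_inequality θ hP n (s i) (F i) (hF i hi) _ _ (hab i hi)

lemma pow_split {x : ℝ} {n : ℕ} : x ^ (2 ^ n - (n + 1)) * x ^ (n + 1) = x ^ 2 ^ n := by
  have hn : n + 1 ≤ 2 ^ n := Nat.lt_two_pow_self
  rw [← pow_add]; congr 1; omega

lemma pow_split_one {x : ℝ} {n : ℕ} : x ^ (2 ^ n - 1) * x = x ^ 2 ^ n := by
  have hn : 1 ≤ 2 ^ n := Nat.one_le_two_pow
  rw [← pow_succ]; congr 1; omega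

lemma diffSum_natAbs {P : ℕ} {G : ℤ → ℝ} (hG : ∀ s, G (-s) = G s) (n : ℕ) (s : ℤ) :
    diffSum P n G s = diffSum P n G (s.natAbs : ℕ) := by
  rcases Int.natAbs_eq s with h | h
  · rw [← h]
  · conv_lhs => rw [h]
    rw [diffSum_neg hG]

lemma kern_even (P : ℕ) (θ : ℝ) (s : ℤ) : kern P (θ * ((-s : ℤ) : ℝ)) = kern P (θ * (s : ℝ)) := by
  simp only [Int.cast_neg, mul_neg, kern_neg]

/-- Sums over `m` of exponential sums in an unweighted variable. -/
lemma exists_typeI_le (n : ℕ) (hn : 1 ≤ n) : ∃ c : ℝ, 0 < c ∧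
    ∀ (D : ℝ) (L H M X : ℕ) (θ : ℝ) (a : ℤ) (q : ℕ) (f : ℤ → ℝ) (u v : ℕ → ℕ → ℤ),
    DivBound D L → IsApprox θ a q → q ≤ L → 1 ≤ H → 1 ≤ M → 1 ≤ X →
    (n + 1).factorial * (H * (2 * M) ^ (n + 1)) * X ^ n ≤ L → IsPhase (n + 1) θ f →
    (∀ h m, M ≤ m → v h m - u h m ≤ X) →
    (∑ h ∈ Icc 1 H, ∑ m ∈ Icc M (2 * M),
      ‖∑ x ∈ Ioc (u h m) (v h m), ex (h * f (m * x))‖) ^ (2 ^ n) ≤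
    c * D ^ (n + 2) * (H * M * X : ℝ) ^ (2 ^ n) *
      (M ^ n * (1 / X + 1 / q + q / (M * X : ℝ) ^ (n + 1))) := by
  obtain ⟨c, hc, hS⟩ := exists_sum_diffSum_kern_le n hn
  refine ⟨2 ^ 2 ^ n * 3 ^ 2 ^ n * c * 2 ^ (n + 1), by positivity, ?_⟩
  intro D L H M X θ a q f u v hD hθ hqL hH hM hX hL hf hX'
  have hH' : (1 : ℝ) ≤ H := by exact_mod_cast hH
  have hM' : (1 : ℝ) ≤ M := by exact_mod_cast hM
  have hX1 : (1 : ℝ) ≤ X := by exact_mod_cast hX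
  have hq : (0 : ℝ) < q := by exact_mod_cast hθ.one_le
  have hD1 := hD.one_le
  have h1 := weyl_family (Icc 1 H ×ˢ Icc M (2 * M)) θ hX n
    (fun i => (i.1 : ℤ) * (i.2 : ℤ) ^ (n + 1)) (fun i x => i.1 * f (i.2 * x))
    (by
      rintro ⟨h, m⟩ _
      have := (hf.comp_mul (m : ℤ)).const_mul (h : ℝ)
      convert this using 1
      push_cast; ring)
    (fun i => u i.1 i.2) (fun i => v i.1 i.2)
    (by rintro ⟨h, m⟩ hi; exact hX' h m (mem_Icc.mp (mem_product.mp hi).2).1)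
    (M := 2 * (H * M : ℝ))
    (by
      rw [card_product, Nat.card_Icc, Nat.card_Icc]
      have : (H + 1 - 1) * (2 * M + 1 - M) ≤ 2 * (H * M) := by
        have : 2 * M + 1 - M ≤ 2 * M := by omega
        calc _ ≤ H * (2 * M) := by gcongr; omega
          _ = _ := by ring
      exact_mod_cast this)
  rw [sum_product] at h1
  refine h1.trans ?_
  -- Since m divides w = h m^(n+1) and then determines h, each w has at most D representations.
  -- Passing from about HM pairs to all w ≤ H(2M)^(n+1) costs the factor M^n of the final bound.
  have h2 : ∑ i ∈ Icc 1 H ×ˢ Icc M (2 * M), diffSum X n (fun u => kern X (θ * u))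
      ((i.1 : ℤ) * (i.2 : ℤ) ^ (n + 1)) ≤ D * ∑ w ∈ Icc 1 (H * (2 * M) ^ (n + 1)),
        diffSum X n (fun u => kern X (θ * u)) (w : ℕ) := by
    have h3 := sum_comp_le_of_fibers (Icc 1 H ×ˢ Icc M (2 * M)) (fun i => i.1 * i.2 ^ (n + 1))
      (fun i => i.2) Nat.divisors (W := H * (2 * M) ^ (n + 1)) (M := D)
      (G := fun w => diffSum X n (fun u => kern X (θ * u)) (w : ℕ))
      (fun _ => diffSum_nonneg (fun _ => kern_nonneg _ _) _ _) ?_ ?_ ?_ ?_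
    · push_cast at h3; exact h3
    · rintro ⟨h, m⟩ hi
      simp only [mem_product, mem_Icc] at hi ⊢
      have : 1 ≤ m := hM.trans hi.2.1
      exact ⟨Nat.mul_pos hi.1.1 (by positivity), by gcongr; exacts [hi.1.2, hi.2.2]⟩
    · rintro ⟨h, m⟩ hi
      simp only [mem_product, mem_Icc] at hi
      have h1 : 1 ≤ m := hM.trans hi.2.1
      simp only [Nat.mem_divisors]
      exact ⟨Dvd.dvd.mul_left (dvd_pow_self _ (by omega)) _,
        (Nat.mul_pos hi.1.1 (by positivity)).ne'⟩
    · rintro ⟨h, m⟩ hi ⟨h', m'⟩ hi' h1 h2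
      simp only [mem_product, mem_Icc] at hi hi' h1 h2
      subst h2
      have hm : 1 ≤ m := hM.trans hi.2.1
      rw [Nat.eq_of_mul_eq_mul_right (by positivity) h1]
    · intro w hw
      have hw := mem_Icc.mp hw
      refine hD.card_le w hw.1 (hw.2.trans (le_trans ?_ hL))
      have e1 : 1 ≤ (n + 1).factorial := Nat.factorial_pos _
      have e2 : 1 ≤ X ^ n := Nat.one_le_pow _ _ hX
      calc _ = 1 * (H * (2 * M) ^ (n + 1)) * 1 := by ring
        _ ≤ _ := by gcongr
  have h4 := hS D L X (H * (2 * M) ^ (n + 1)) θ a q hD hθ hqL hX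
    (Nat.mul_pos hH (by positivity)) hL
  set Q : ℝ := 1 / X + 1 / q + q / (M * X : ℝ) ^ (n + 1) with hQ
  have hQ0 : 0 ≤ Q := by positivity
  have h5 : ∑ s ∈ Icc 1 (H * (2 * M) ^ (n + 1)), diffSum X n (fun u => kern X (θ * u)) (s : ℕ) ≤
      c * D ^ (n + 1) * (2 ^ (n + 1) * (H * M ^ (n + 1) * X ^ (n + 1))) * Q := by
    refine h4.trans ?_
    push_cast
    have e1 : (H : ℝ) * (2 * M) ^ (n + 1) * X ^ (n + 1) =
        2 ^ (n + 1) * (H * M ^ (n + 1) * X ^ (n + 1)) := by rw [mul_pow]; ring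
    rw [e1]
    gcongr
    rw [hQ]
    gcongr
    rw [mul_pow]
    have : 1 ≤ (2 : ℝ) ^ (n + 1) * H := by
      calc (1 : ℝ) = 1 * 1 := by ring
        _ ≤ _ := by gcongr; exact one_le_pow₀ (by norm_num)
    have e3 : 0 ≤ (M : ℝ) ^ (n + 1) * X ^ (n + 1) := by positivity
    nlinarith
  calc _ ≤ (2 * (H * M : ℝ)) ^ (2 ^ n - 1) * ((3 * X : ℝ) ^ (2 ^ n - (n + 1)) *
        (D * (c * D ^ (n + 1) * (2 ^ (n + 1) * (H * M ^ (n + 1) * X ^ (n + 1))) * Q))) := by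
        gcongr
        exact h2.trans (by gcongr)
    _ = 2 ^ (2 ^ n - 1) * 3 ^ (2 ^ n - (n + 1)) * c * 2 ^ (n + 1) * D ^ (n + 2) *
        ((((H * M : ℝ)) ^ (2 ^ n - 1) * (H * M)) *
        ((X : ℝ) ^ (2 ^ n - (n + 1)) * X ^ (n + 1))) * (M ^ n * Q) := by
        simp only [mul_pow]; ring
    _ = 2 ^ (2 ^ n - 1) * 3 ^ (2 ^ n - (n + 1)) * c * 2 ^ (n + 1) * D ^ (n + 2) *
        (H * M * X : ℝ) ^ 2 ^ n * (M ^ n * Q) := by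
        rw [pow_split, pow_split_one, ← mul_pow]
    _ ≤ _ := by
        gcongr
        · norm_num
        · exact Nat.sub_le _ _
        · norm_num
        · exact Nat.sub_le _ _

/-! ### Bilinear sums: differencing -/

/-- The inner sum after Cauchy's inequality. -/
noncomputable def corrSum (f : ℤ → ℝ) (N P h r₁ r₂ : ℕ) : ℂ :=
  ∑ x ∈ Ioc (P : ℤ) (min (2 * P : ℕ) (min (N / r₁ : ℕ) (N / r₂ : ℕ)) : ℤ),
    ex (h * (f (x * r₁) - f (x * r₂)))

/-- A bilinear exponential sum over a dyadic box. -/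
noncomputable def bilin (f : ℤ → ℝ) (N P R : ℕ) (a b : ℕ → ℂ) (h : ℕ) : ℂ :=
  ∑ p ∈ Ioc P (2 * P), ∑ r ∈ Ioc R (2 * R),
    if p * r ≤ N then a p * b r * ex (h * f (p * r)) else 0

/-- After squaring out, the sum over p is innermost. For fixed r₁, r₂ the conditions p rᵢ ≤ N only
shorten its range, so `corrSum` is free of coefficients and open to differencing. -/
lemma sum_norm_sq_le (f : ℤ → ℝ) (N P R h : ℕ) {b : ℕ → ℂ} {D : ℝ}
    (hb : ∀ r ∈ Ioc R (2 * R), ‖b r‖ ≤ D) :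
    ∑ p ∈ Ioc P (2 * P), ‖∑ r ∈ Ioc R (2 * R), if p * r ≤ N then b r * ex (h * f (p * r)) else 0‖ ^ 2
      ≤ D ^ 2 * ∑ r₁ ∈ Ioc R (2 * R), ∑ r₂ ∈ Ioc R (2 * R), ‖corrSum f N P h r₁ r₂‖ := by
  set t : ℕ → ℕ → ℂ := fun p r => if p * r ≤ N then b r * ex (h * f (p * r)) else 0 with ht
  have h1 : ((∑ p ∈ Ioc P (2 * P), ‖∑ r ∈ Ioc R (2 * R), t p r‖ ^ 2 : ℝ) : ℂ) =
      ∑ r₁ ∈ Ioc R (2 * R), ∑ r₂ ∈ Ioc R (2 * R),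
        (b r₁ * (starRingEnd ℂ) (b r₂)) * corrSum f N P h r₁ r₂ := by
    have e1 : ∀ p, ((‖∑ r ∈ Ioc R (2 * R), t p r‖ ^ 2 : ℝ) : ℂ) =
        ∑ r₁ ∈ Ioc R (2 * R), ∑ r₂ ∈ Ioc R (2 * R), t p r₁ * (starRingEnd ℂ) (t p r₂) := by
      intro p
      rw [← sum_mul_sum, ← map_sum, Complex.mul_conj, Complex.normSq_eq_norm_sq]
    push_cast at e1 ⊢
    simp only [e1]
    rw [sum_comm]
    refine sum_congr rfl fun r₁ hr₁ => ?_
    rw [sum_comm]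
    refine sum_congr rfl fun r₂ hr₂ => ?_
    have hr₁ : 0 < r₁ := by have := mem_Ioc.mp hr₁; omega
    have hr₂ : 0 < r₂ := by have := mem_Ioc.mp hr₂; omega
    have e2 : ∀ p : ℕ, t p r₁ * (starRingEnd ℂ) (t p r₂) =
        if p ≤ N / r₁ ∧ p ≤ N / r₂ then (b r₁ * (starRingEnd ℂ) (b r₂)) *
          ex (h * (f (p * r₁) - f (p * r₂))) else 0 := by
      intro p
      simp only [ht, Nat.le_div_iff_mul_le hr₁, Nat.le_div_iff_mul_le hr₂]
      by_cases c1 : p * r₁ ≤ N <;> by_cases c2 : p * r₂ ≤ N <;> simp only [c1, c2, if_true, if_false,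
        and_true, and_false, map_zero, mul_zero, zero_mul]
      rw [mul_sub, ex_sub, map_mul]; ring
    simp only [e2]
    rw [← sum_filter, ← mul_sum, corrSum]
    congr 1
    refine sum_bij (fun p _ => (p : ℤ)) ?_ ?_ ?_ ?_
    · intro p hp
      simp only [mem_filter, mem_Ioc] at hp ⊢
      omega
    · intro p _ p' _ hpp; exact_mod_cast hpp
    · intro x hx
      simp only [mem_Ioc] at hx
      refine ⟨x.toNat, ?_, by omega⟩
      simp only [mem_filter, mem_Ioc]
      omega
    · intro p _; rfl
  have h2 : ∑ p ∈ Ioc P (2 * P), ‖∑ r ∈ Ioc R (2 * R), t p r‖ ^ 2 =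
      ‖((∑ p ∈ Ioc P (2 * P), ‖∑ r ∈ Ioc R (2 * R), t p r‖ ^ 2 : ℝ) : ℂ)‖ := by
    rw [Complex.norm_real, Real.norm_of_nonneg (by positivity)]
  rw [h2, h1, mul_sum]
  refine (norm_sum_le _ _).trans (sum_le_sum fun r₁ hr₁ => ?_)
  rw [mul_sum]
  refine (norm_sum_le _ _).trans (sum_le_sum fun r₂ hr₂ => ?_)
  rw [norm_mul, norm_mul, RCLike.norm_conj, sq]
  have := norm_nonneg (b r₁)
  gcongr
  · exact (norm_nonneg _).trans (hb _ hr₁)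
  · exact hb _ hr₁
  · exact hb _ hr₂

/-- Cauchy's inequality is applied over h and p jointly, so the average over h survives as part of
the frequency. -/
lemma bilin_cauchy (f : ℤ → ℝ) (N P R H : ℕ) {a b : ℕ → ℂ} {D : ℝ}
    (ha : ∀ p ∈ Ioc P (2 * P), ‖a p‖ ≤ D) (hb : ∀ r ∈ Ioc R (2 * R), ‖b r‖ ≤ D) :
    (∑ h ∈ Icc 1 H, ‖bilin f N P R a b h‖) ^ 2 ≤ H * P * D ^ 4 * ∑ h ∈ Icc 1 H,
      ∑ r₁ ∈ Ioc R (2 * R), ∑ r₂ ∈ Ioc R (2 * R), ‖corrSum f N P h r₁ r₂‖ := by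
  set w : ℕ → ℕ → ℝ := fun h p =>
    ‖∑ r ∈ Ioc R (2 * R), if p * r ≤ N then b r * ex (h * f (p * r)) else 0‖ with hw
  have h1 : ∀ h, ‖bilin f N P R a b h‖ ≤ D * ∑ p ∈ Ioc P (2 * P), w h p := by
    intro h
    rw [bilin, mul_sum]
    refine (norm_sum_le _ _).trans (sum_le_sum fun p hp => ?_)
    have : ∑ r ∈ Ioc R (2 * R), (if p * r ≤ N then a p * b r * ex (h * f (p * r)) else 0) =
        a p * ∑ r ∈ Ioc R (2 * R), if p * r ≤ N then b r * ex (h * f (p * r)) else 0 := by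
      rw [mul_sum]
      refine sum_congr rfl fun r _ => ?_
      split_ifs
      · ring
      · ring
    rw [this, norm_mul]
    gcongr
    exact ha p hp
  have h2 : (∑ h ∈ Icc 1 H, ∑ p ∈ Ioc P (2 * P), w h p) ^ 2 ≤
      H * P * ∑ h ∈ Icc 1 H, ∑ p ∈ Ioc P (2 * P), w h p ^ 2 := by
    have := pow_sum_le (Icc 1 H ×ˢ Ioc P (2 * P)) (fun i => w i.1 i.2)
      (fun _ _ => norm_nonneg _) (n := 2) (by norm_num) (M := H * P)
      (by rw [card_product, Nat.card_Icc, Nat.card_Ioc]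
          have : (H + 1 - 1) * (2 * P - P) ≤ H * P := by gcongr <;> omega
          exact_mod_cast this)
    rw [sum_product, sum_product] at this
    simpa using this
  calc _ ≤ (∑ h ∈ Icc 1 H, D * ∑ p ∈ Ioc P (2 * P), w h p) ^ 2 := by
        gcongr with h _; exact h1 h
    _ = D ^ 2 * (∑ h ∈ Icc 1 H, ∑ p ∈ Ioc P (2 * P), w h p) ^ 2 := by
        rw [← mul_sum, mul_pow]
    _ ≤ D ^ 2 * (H * P * ∑ h ∈ Icc 1 H, (D ^ 2 * ∑ r₁ ∈ Ioc R (2 * R), ∑ r₂ ∈ Ioc R (2 * R),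
        ‖corrSum f N P h r₁ r₂‖)) := by
        gcongr
        refine h2.trans ?_
        gcongr with h _
        exact sum_norm_sq_le f N P R h hb
    _ = _ := by rw [← mul_sum]; ring

lemma norm_corrSum_le (f : ℤ → ℝ) (N P h r₁ r₂ : ℕ) : ‖corrSum f N P h r₁ r₂‖ ≤ P :=
  norm_sum_le_length _ (by omega)

lemma weyl_corrSum {f : ℤ → ℝ} {θ : ℝ} {n : ℕ} (hf : IsPhase (n + 1) θ f) (N : ℕ) {P : ℕ}
    (hP : 1 ≤ P) (T : Finset (ℕ × ℕ × ℕ)) {M : ℝ} (hM : (T.card : ℝ) ≤ M) :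
    (∑ i ∈ T, ‖corrSum f N P i.1 i.2.1 i.2.2‖) ^ (2 ^ n) ≤
      M ^ (2 ^ n - 1) * ((3 * P : ℝ) ^ (2 ^ n - (n + 1)) *
        ∑ i ∈ T, diffSum P n (fun u => kern P (θ * u))
          ((i.1 : ℤ) * ((i.2.1 : ℤ) ^ (n + 1) - (i.2.2 : ℤ) ^ (n + 1)))) := by
  refine weyl_family T θ hP n _ (fun i x => i.1 * (f (x * i.2.1) - f (x * i.2.2))) ?_ _ _ ?_ hM
  · rintro ⟨h, r₁, r₂⟩ _
    have := ((hf.comp_mul (r₁ : ℤ)).sub (hf.comp_mul (r₂ : ℤ))).const_mul (h : ℝ)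
    convert this using 1
    · push_cast; ring
    · ext x; simp only [mul_comm x]
  · intro i _; omega

/-- The induction uses (z+d)^(k+1) - z^(k+1) = (z+d)((z+d)^k - z^k) + d z^k. Monotonicity makes a
pair recoverable from its difference and the difference of its k-th powers. -/
lemma pow_add_sub_pow_strictMono {d : ℤ} (hd : 0 < d) {k : ℕ} (hk : 2 ≤ k) {x y : ℤ} (hx : 0 ≤ x)
    (hxy : x < y) : (x + d) ^ k - x ^ k < (y + d) ^ k - y ^ k := by
  have pos : ∀ k : ℕ, 1 ≤ k → 0 < (x + d) ^ k - x ^ k := fun k hk => by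
    have : x ^ k < (x + d) ^ k := pow_lt_pow_left₀ (by omega) hx (by omega)
    omega
  have step : ∀ k : ℕ, 1 ≤ k → (x + d) ^ k - x ^ k ≤ (y + d) ^ k - y ^ k →
      (x + d) ^ (k + 1) - x ^ (k + 1) < (y + d) ^ (k + 1) - y ^ (k + 1) := by
    intro k hk h
    have e : ∀ z : ℤ, (z + d) ^ (k + 1) - z ^ (k + 1) =
        (z + d) * ((z + d) ^ k - z ^ k) + d * z ^ k := fun z => by ring
    rw [e, e]
    have h1 := pos k hk
    have h2 : x ^ k ≤ y ^ k := pow_le_pow_left₀ hx hxy.le _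
    nlinarith [mul_nonneg (by omega : 0 ≤ y + d) (sub_nonneg.mpr h), mul_le_mul_of_nonneg_left h2 hd.le]
  induction k, hk using Nat.le_induction with
  | base => exact step 1 le_rfl (by simp)
  | succ k hk ih => exact step k (by omega) ih.le

lemma eq_of_pow_sub_pow_eq {k : ℕ} (hk : 2 ≤ k) {r₁ r₂ s₁ s₂ : ℕ} (hr : r₁ ≠ r₂)
    (hd : (r₁ : ℤ) - r₂ = s₁ - s₂)
    (h : (r₁ : ℤ) ^ k - (r₂ : ℤ) ^ k = (s₁ : ℤ) ^ k - (s₂ : ℤ) ^ k) : r₁ = s₁ ∧ r₂ = s₂ := by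
  have main : ∀ {x y d : ℤ}, 0 < d → 0 ≤ x → 0 ≤ y →
      (x + d) ^ k - x ^ k = (y + d) ^ k - y ^ k → x = y := by
    intro x y d hd hx hy he
    rcases lt_trichotomy x y with h | h | h
    · exact absurd he (pow_add_sub_pow_strictMono hd hk hx h).ne
    · exact h
    · exact absurd he (pow_add_sub_pow_strictMono hd hk hy h).ne'
  rcases lt_or_gt_of_ne hr with hlt | hlt
  · have := main (x := r₁) (y := s₁) (d := r₂ - r₁) (by omega) (by omega) (by omega)
      (by rw [show (s₁ : ℤ) + (r₂ - r₁) = s₂ by omega, show (r₁ : ℤ) + (r₂ - r₁) = r₂ by omega]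
          linarith)
    omega
  · have := main (x := r₂) (y := s₂) (d := r₁ - r₂) (by omega) (by omega) (by omega)
      (by rw [show (s₂ : ℤ) + (r₁ - r₂) = s₁ by omega, show (r₂ : ℤ) + (r₁ - r₂) = r₁ by omega]
          linarith)
    omega

lemma card_box_le (H R : ℕ) :
    ((Icc 1 H ×ˢ (Ioc R (2 * R) ×ˢ Ioc R (2 * R))).card : ℝ) ≤ H * R ^ 2 := by
  rw [card_product, card_product, Nat.card_Icc, Nat.card_Ioc]
  have : (H + 1 - 1) * ((2 * R - R) * (2 * R - R)) = H * R ^ 2 := by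
    rw [show 2 * R - R = R by omega, Nat.add_sub_cancel]; ring
  exact_mod_cast this.le

/-- The contribution of `r₁ ≠ r₂`, when the pair variable is short. -/
lemma exists_offdiag_le (n : ℕ) (hn : 1 ≤ n) : ∃ c : ℝ, 0 < c ∧
    ∀ (D : ℝ) (L H N P R : ℕ) (θ : ℝ) (a : ℤ) (q : ℕ) (f : ℤ → ℝ),
    DivBound D L → IsApprox θ a q → q ≤ L → 1 ≤ H → 1 ≤ P → 1 ≤ R →
    (n + 1).factorial * (H * (2 * R) ^ (n + 1)) * P ^ n ≤ L → IsPhase (n + 1) θ f →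
    (∑ i ∈ (Icc 1 H ×ˢ (Ioc R (2 * R) ×ˢ Ioc R (2 * R))).filter (fun i => i.2.1 ≠ i.2.2),
      ‖corrSum f N P i.1 i.2.1 i.2.2‖) ^ (2 ^ n) ≤
    c * D ^ (n + 3) * (H * R ^ 2 * P : ℝ) ^ (2 ^ n) *
      (R ^ (n - 1) * (1 / P + 1 / q + q / (P * R : ℝ) ^ (n + 1))) := by
  obtain ⟨c, hc, hS⟩ := exists_sum_diffSum_kern_le n hn
  refine ⟨2 * 3 ^ 2 ^ n * c * 2 ^ (n + 1), by positivity, ?_⟩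
  intro D L H N P R θ a q f hD hθ hqL hH hP hR hL hf
  have hH' : (1 : ℝ) ≤ H := by exact_mod_cast hH
  have hR' : (1 : ℝ) ≤ R := by exact_mod_cast hR
  have hP' : (1 : ℝ) ≤ P := by exact_mod_cast hP
  have hq : (0 : ℝ) < q := by exact_mod_cast hθ.one_le
  have hD1 := hD.one_le
  set T := (Icc 1 H ×ˢ (Ioc R (2 * R) ×ˢ Ioc R (2 * R))).filter (fun i => i.2.1 ≠ i.2.2) with hT
  have hcard : (T.card : ℝ) ≤ H * R ^ 2 :=
    le_trans (by exact_mod_cast card_filter_le _ _) (card_box_le H R)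
  refine (weyl_corrSum hf N hP T hcard).trans ?_
  have memT : ∀ {i : ℕ × ℕ × ℕ}, i ∈ T → (1 ≤ i.1 ∧ i.1 ≤ H) ∧ (R < i.2.1 ∧ i.2.1 ≤ 2 * R) ∧
      (R < i.2.2 ∧ i.2.2 ≤ 2 * R) ∧ i.2.1 ≠ i.2.2 := by
    rintro ⟨h, r₁, r₂⟩ hi
    simp only [hT, mem_filter, mem_product, mem_Icc, mem_Ioc] at hi
    tauto
  have hne : ∀ {i : ℕ × ℕ × ℕ}, i ∈ T →
      (i.1 : ℤ) * ((i.2.1 : ℤ) ^ (n + 1) - (i.2.2 : ℤ) ^ (n + 1)) ≠ 0 := by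
    intro i hi
    obtain ⟨h1, h2, h3, h4⟩ := memT hi
    refine mul_ne_zero (by omega) (sub_ne_zero.mpr fun he => h4 ?_)
    exact_mod_cast (pow_left_inj₀ (by positivity) (by positivity) (by omega)).mp he
  -- Off the diagonal w = |h(r₁^(n+1) - r₂^(n+1))| is nonzero, and both h and |r₁ - r₂| divide it.
  -- With the order of r₁, r₂ they determine the triple, so at most 2D² triples share a value.
  have h2 : ∑ i ∈ T, diffSum P n (fun u => kern P (θ * u))
      ((i.1 : ℤ) * ((i.2.1 : ℤ) ^ (n + 1) - (i.2.2 : ℤ) ^ (n + 1))) ≤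
      2 * D ^ 2 * ∑ w ∈ Icc 1 (H * (2 * R) ^ (n + 1)),
        diffSum P n (fun u => kern P (θ * u)) (w : ℕ) := by
    rw [sum_congr rfl fun i _ =>
      diffSum_natAbs (G := fun u : ℤ => kern P (θ * u)) (kern_even P θ) n _]
    refine sum_comp_le_of_fibers T
      (fun i => ((i.1 : ℤ) * ((i.2.1 : ℤ) ^ (n + 1) - (i.2.2 : ℤ) ^ (n + 1))).natAbs)
      (fun i => (i.1, ((i.2.1 : ℤ) - i.2.2).natAbs, decide (i.2.1 < i.2.2)))
      (fun w => w.divisors ×ˢ (w.divisors ×ˢ univ))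
      (G := fun w => diffSum P n (fun u => kern P (θ * u)) (w : ℕ))
      (fun _ => diffSum_nonneg (fun _ => kern_nonneg _ _) _ _) ?_ ?_ ?_ ?_
    · intro i hi
      have h0 := hne hi
      obtain ⟨h1, h2, h3, h4⟩ := memT hi
      refine mem_Icc.mpr ⟨by omega, ?_⟩
      rw [Int.natAbs_mul, Int.natAbs_natCast]
      refine Nat.mul_le_mul h1.2 ?_
      have e1 : (i.2.1 : ℤ) ^ (n + 1) ≤ ((2 * R) ^ (n + 1) : ℕ) := by
        exact_mod_cast Nat.pow_le_pow_left h2.2 _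
      have e2 : (i.2.2 : ℤ) ^ (n + 1) ≤ ((2 * R) ^ (n + 1) : ℕ) := by
        exact_mod_cast Nat.pow_le_pow_left h3.2 _
      have e3 : 0 ≤ (i.2.1 : ℤ) ^ (n + 1) := by positivity
      have e4 : 0 ≤ (i.2.2 : ℤ) ^ (n + 1) := by positivity
      omega
    · intro i hi
      have h0 := hne hi
      simp only [mem_product, mem_univ, and_true, Nat.mem_divisors]
      refine ⟨⟨?_, by omega⟩, ?_, by omega⟩
      · rw [Int.natAbs_mul, Int.natAbs_natCast]; exact Dvd.intro _ rfl
      · rw [Int.natAbs_dvd_natAbs]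
        exact Dvd.dvd.mul_left (sub_dvd_pow_sub_pow _ _ _) _
    · rintro ⟨h, r₁, r₂⟩ hi ⟨h', s₁, s₂⟩ hi' e1 e2
      obtain ⟨g1, g2, g3, g4⟩ := memT hi
      obtain ⟨g1', g2', g3', g4'⟩ := memT hi'
      simp only at g1 g2 g3 g4 g1' g2' g3' g4' e1 e2
      simp only [Prod.mk.injEq] at e2
      obtain ⟨rfl, e3, e4⟩ := e2
      rw [Int.natAbs_mul, Int.natAbs_mul] at e1
      have e5 := Nat.eq_of_mul_eq_mul_left (by omega) e1
      have e4 : (r₁ < r₂ ↔ s₁ < s₂) := by simpa using e4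
      have hpow : ∀ x y : ℕ, x < y → (x : ℤ) ^ (n + 1) < (y : ℤ) ^ (n + 1) := fun x y hxy =>
        pow_lt_pow_left₀ (by exact_mod_cast hxy) (by omega) (by omega)
      have key : r₁ = s₁ ∧ r₂ = s₂ := by
        refine eq_of_pow_sub_pow_eq (k := n + 1) (by omega) g4 (by omega) ?_
        rcases lt_or_gt_of_ne g4 with hlt | hlt
        · have := hpow _ _ hlt
          have := hpow _ _ (e4.mp hlt)
          omega
        · have hs : s₂ < s₁ := by omega
          have := hpow _ _ hlt
          have := hpow _ _ hs
          omega
      simp [key.1, key.2]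
    · intro w hw
      have hw := mem_Icc.mp hw
      have e1 : 1 ≤ (n + 1).factorial := Nat.factorial_pos _
      have e2 : 1 ≤ P ^ n := Nat.one_le_pow _ _ hP
      have hwL : w ≤ L := hw.2.trans (le_trans (by
        calc _ = 1 * (H * (2 * R) ^ (n + 1)) * 1 := by ring
          _ ≤ (n + 1).factorial * (H * (2 * R) ^ (n + 1)) * P ^ n := by gcongr) hL)
      have e3 := hD.card_le w hw.1 hwL
      rw [card_product, card_product, card_univ, Fintype.card_bool]
      push_cast
      have e4 : (0 : ℝ) ≤ w.divisors.card := by positivity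
      nlinarith
  have h4 := hS D L P (H * (2 * R) ^ (n + 1)) θ a q hD hθ hqL hP
    (Nat.mul_pos hH (by positivity)) hL
  set Q : ℝ := 1 / P + 1 / q + q / (P * R : ℝ) ^ (n + 1) with hQ
  have hQ0 : 0 ≤ Q := by positivity
  have h5 : ∑ s ∈ Icc 1 (H * (2 * R) ^ (n + 1)), diffSum P n (fun u => kern P (θ * u)) (s : ℕ) ≤
      c * D ^ (n + 1) * (2 ^ (n + 1) * (H * R ^ (n + 1) * P ^ (n + 1))) * Q := by
    refine h4.trans ?_
    push_cast
    have e1 : (H : ℝ) * (2 * R) ^ (n + 1) * P ^ (n + 1) =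
        2 ^ (n + 1) * (H * R ^ (n + 1) * P ^ (n + 1)) := by rw [mul_pow]; ring
    rw [e1]
    gcongr
    rw [hQ]
    gcongr
    rw [mul_pow]
    have : 1 ≤ (2 : ℝ) ^ (n + 1) * H := by
      calc (1 : ℝ) = 1 * 1 := by ring
        _ ≤ _ := by gcongr; exact one_le_pow₀ (by norm_num)
    have e3 : 0 ≤ (R : ℝ) ^ (n + 1) * P ^ (n + 1) := by positivity
    nlinarith
  -- The w fill a range of order H R^(n+1) while there are at most H R² triples; the ratio R^(n-1)
  -- is the loss.
  have hRn : (R : ℝ) ^ (n + 1) = R ^ 2 * R ^ (n - 1) := by rw [← pow_add]; congr 1; omega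
  calc _ ≤ (H * R ^ 2 : ℝ) ^ (2 ^ n - 1) * ((3 * P : ℝ) ^ (2 ^ n - (n + 1)) *
        (2 * D ^ 2 * (c * D ^ (n + 1) * (2 ^ (n + 1) * (H * R ^ (n + 1) * P ^ (n + 1))) * Q))) := by
        gcongr
        exact h2.trans (by gcongr)
    _ = 2 * 3 ^ (2 ^ n - (n + 1)) * c * 2 ^ (n + 1) * D ^ (n + 3) *
        (((H * R ^ 2 : ℝ) ^ (2 ^ n - 1) * (H * R ^ 2)) *
        ((P : ℝ) ^ (2 ^ n - (n + 1)) * P ^ (n + 1))) * (R ^ (n - 1) * Q) := by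
        rw [hRn, mul_pow 3]; ring
    _ = 2 * 3 ^ (2 ^ n - (n + 1)) * c * 2 ^ (n + 1) * D ^ (n + 3) *
        (H * R ^ 2 * P : ℝ) ^ 2 ^ n * (R ^ (n - 1) * Q) := by
        rw [pow_split, pow_split_one, ← mul_pow]
    _ ≤ _ := by
        gcongr
        · norm_num
        · exact Nat.sub_le _ _

/-! ### A second differencing: long pair variable -/

/-- Every l·y lies within 1/8 of an integer, and cos u ≥ 1 - u²/2 with |u| ≤ 2π/8 ≤ 1 gives each
term real part at least 1/2. -/
lemma half_le_norm_sum_ex {y : ℝ} {m : ℕ} (h : m * distInt y ≤ 1 / 8) :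
    (m : ℝ) / 2 ≤ ‖∑ l ∈ range m, ex (l * y)‖ := by
  have h1 : ∀ l ∈ range m, 1 / 2 ≤ (ex (l * y)).re := by
    intro l hl
    have hlm : (l : ℝ) ≤ m := by exact_mod_cast (mem_range.mp hl).le
    set z := y - round y with hz
    have hzd : distInt y = |z| := rfl
    have e1 : ex (l * y) = ex (l * z) := by
      have : (l : ℝ) * y = l * z + ((l * round y : ℤ) : ℝ) := by rw [hz]; push_cast; ring
      rw [this, ex_add, ex_int, mul_one]
    rw [e1, ex, Complex.exp_ofReal_mul_I_re]
    have e2 := Real.one_sub_sq_div_two_le_cos (x := 2 * Real.pi * (l * z))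
    have e3 : |(l : ℝ) * z| ≤ 1 / 8 := by
      rw [abs_mul, Nat.abs_cast, ← hzd]
      exact le_trans (by gcongr; exact distInt_nonneg y) h
    have e4 : |2 * Real.pi * (l * z)| ≤ 1 := by
      rw [abs_mul, abs_of_pos (by positivity : (0 : ℝ) < 2 * Real.pi)]
      nlinarith [Real.pi_lt_four, Real.pi_pos, abs_nonneg ((l : ℝ) * z)]
    have e5 : (2 * Real.pi * (l * z)) ^ 2 ≤ 1 := by
      rw [← sq_abs]; exact pow_le_one₀ (abs_nonneg _) e4
    linarith
  refine le_trans ?_ (Complex.re_le_norm _)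
  rw [Complex.re_sum]
  calc (m : ℝ) / 2 = ∑ l ∈ range m, (1 / 2 : ℝ) := by simp; ring
    _ ≤ _ := sum_le_sum h1

/-- For ‖y‖ ≤ 1/8 take the largest j ≤ log₂ P with 2^j‖y‖ ≤ 1/8: the Fejér kernel of length 2^j is
at least 2^j/4, while `kern` is at most 32·2^j. For larger ‖y‖ the length 1 suffices. Unlike `kern`,
Fejér kernels are squares and expand into exponentials. -/
lemma kern_le_fejer (P : ℕ) (y : ℝ) :
    kern P y ≤ 128 * ∑ i ∈ range (Nat.log 2 P + 1),
      1 / (2 : ℝ) ^ i * ‖∑ l ∈ range (2 ^ i), ex (l * y)‖ ^ 2 := by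
  set t : ℕ → ℝ := fun i => 1 / (2 : ℝ) ^ i * ‖∑ l ∈ range (2 ^ i), ex (l * y)‖ ^ 2 with ht
  have hd := distInt_nonneg y
  have ht0 : ∀ i, 0 ≤ t i := fun i => by positivity
  suffices h : ∃ i ∈ range (Nat.log 2 P + 1), kern P y ≤ 128 * t i by
    obtain ⟨i, hi, h⟩ := h
    exact h.trans (by gcongr; exact single_le_sum (fun i _ => ht0 i) hi)
  by_cases h0 : 1 / 8 < distInt y
  · refine ⟨0, by simp, ?_⟩
    have h1 := kern_le_div (P := P) (x := y) (by norm_num) h0.le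
    have h2 : t 0 = 1 := by simp [ht]
    rw [h2]; linarith
  push Not at h0
  set j := Nat.findGreatest (fun i => (2 : ℝ) ^ i * distInt y ≤ 1 / 8) (Nat.log 2 P) with hj
  have hj1 : (2 : ℝ) ^ j * distInt y ≤ 1 / 8 := by
    have := Nat.findGreatest_spec (P := fun i => (2 : ℝ) ^ i * distInt y ≤ 1 / 8)
      (Nat.zero_le (Nat.log 2 P)) (by simpa using h0)
    exact this
  have hjle : j ≤ Nat.log 2 P := Nat.findGreatest_le _
  refine ⟨j, by simp; omega, ?_⟩
  have h1 := half_le_norm_sum_ex (y := y) (m := 2 ^ j) (by push_cast; exact hj1)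
  push_cast at h1
  have hp : (0 : ℝ) < 2 ^ j := by positivity
  have h2 : (2 : ℝ) ^ j / 4 ≤ t j := by
    have : ((2 : ℝ) ^ j / 2) ^ 2 ≤ ‖∑ l ∈ range (2 ^ j), ex (l * y)‖ ^ 2 := by gcongr
    calc (2 : ℝ) ^ j / 4 = 1 / 2 ^ j * ((2 : ℝ) ^ j / 2) ^ 2 := by field_simp; norm_num
      _ ≤ _ := by simp only [ht]; gcongr
  rcases hjle.eq_or_lt with he | hlt
  · have h3 : P < 2 ^ (Nat.log 2 P + 1) := Nat.lt_pow_succ_log_self (by norm_num) P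
    have h4 : (P : ℝ) ≤ 2 * 2 ^ j := by
      rw [he]
      have : (P : ℝ) < 2 ^ (Nat.log 2 P + 1) := by exact_mod_cast h3
      rw [pow_succ] at this; linarith
    have := kern_le P y
    linarith
  · have h3 : ¬ ((2 : ℝ) ^ (j + 1) * distInt y ≤ 1 / 8) :=
      Nat.findGreatest_is_greatest (Nat.lt_succ_self j) hlt
    push Not at h3
    have h4 : 1 / (16 * 2 ^ j) ≤ distInt y := by
      rw [div_le_iff₀ (by positivity)]
      rw [pow_succ] at h3; nlinarith
    have h5 := kern_le_div (P := P) (by positivity) h4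
    have : 2 / (1 / (16 * (2 : ℝ) ^ j)) = 32 * 2 ^ j := by field_simp; norm_num
    linarith

/-- The square of a monomial Weyl sum over a dyadic interval. -/
noncomputable def monoSq (k R : ℕ) (x : ℝ) : ℝ := ‖∑ r ∈ Ioc R (2 * R), ex (x * (r : ℝ) ^ k)‖ ^ 2

lemma monoSq_nonneg (k R : ℕ) (x : ℝ) : 0 ≤ monoSq k R x := by unfold monoSq; positivity

lemma monoSq_zero (k R : ℕ) : monoSq k R 0 = R ^ 2 := by
  simp [monoSq, two_mul]

lemma monoSq_neg (k R : ℕ) (x : ℝ) : monoSq k R (-x) = monoSq k R x := by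
  simp only [monoSq, neg_mul, ex_neg]
  rw [← map_sum, RCLike.norm_conj]

lemma monoSq_eq (k R : ℕ) (x : ℝ) : ((monoSq k R x : ℝ) : ℂ) =
    ∑ r₁ ∈ Ioc R (2 * R), ∑ r₂ ∈ Ioc R (2 * R), ex (x * ((r₁ : ℝ) ^ k - (r₂ : ℝ) ^ k)) := by
  rw [monoSq, ← Complex.normSq_eq_norm_sq, ← Complex.mul_conj, map_sum, sum_mul_sum]
  refine sum_congr rfl fun r₁ _ => sum_congr rfl fun r₂ _ => ?_
  rw [mul_sub, ex_sub]

/-- Duality: both sides expand to the same fourfold exponential sum. Regrouping it by r rather than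
by l turns Fejér kernels at r₁^k - r₂^k into squared monomial sums at l₁ - l₂. -/
lemma sum_fejer_eq (k R m : ℕ) (x : ℝ) :
    ∑ r₁ ∈ Ioc R (2 * R), ∑ r₂ ∈ Ioc R (2 * R),
      ‖∑ l ∈ range m, ex (l * (x * ((r₁ : ℝ) ^ k - (r₂ : ℝ) ^ k)))‖ ^ 2 =
    ∑ l₁ ∈ range m, ∑ l₂ ∈ range m, monoSq k R (x * ((l₁ - l₂ : ℤ) : ℝ)) := by
  have h : ∀ y : ℝ, ((‖∑ l ∈ range m, ex (l * y)‖ ^ 2 : ℝ) : ℂ) =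
      ∑ l₁ ∈ range m, ∑ l₂ ∈ range m, ex (((l₁ - l₂ : ℤ) : ℝ) * y) := by
    intro y
    rw [← Complex.normSq_eq_norm_sq, ← Complex.mul_conj, map_sum, sum_mul_sum]
    refine sum_congr rfl fun r₁ _ => sum_congr rfl fun r₂ _ => ?_
    rw [← ex_sub]; congr 1; push_cast; ring
  rw [← Complex.ofReal_inj]
  simp only [Complex.ofReal_sum, h, monoSq_eq]
  have e : ∀ (F : ℕ → ℕ → ℕ → ℕ → ℂ),
      ∑ r₁ ∈ Ioc R (2 * R), ∑ r₂ ∈ Ioc R (2 * R), ∑ l₁ ∈ range m, ∑ l₂ ∈ range m, F r₁ r₂ l₁ l₂ =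
      ∑ l₁ ∈ range m, ∑ l₂ ∈ range m, ∑ r₁ ∈ Ioc R (2 * R), ∑ r₂ ∈ Ioc R (2 * R), F r₁ r₂ l₁ l₂ := by
    intro F
    have e1 : ∀ (S T : Finset ℕ) (F : ℕ → ℕ → ℕ → ℕ → ℂ),
        ∑ r₁ ∈ S, ∑ r₂ ∈ S, ∑ l₁ ∈ T, ∑ l₂ ∈ T, F r₁ r₂ l₁ l₂ =
        ∑ i ∈ S ×ˢ S, ∑ j ∈ T ×ˢ T, F i.1 i.2 j.1 j.2 := by
      intro S T F
      rw [sum_product]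
      exact sum_congr rfl fun _ _ => sum_congr rfl fun _ _ => by rw [sum_product]
    rw [e1, e1 _ _ fun l₁ l₂ r₁ r₂ => F r₁ r₂ l₁ l₂, sum_comm]
  rw [e]
  refine sum_congr rfl fun _ _ => sum_congr rfl fun _ _ => sum_congr rfl fun _ _ =>
    sum_congr rfl fun _ _ => ?_
  congr 1; ring

lemma sum_monoSq_sub_le (k R m : ℕ) (x : ℝ) :
    ∑ l₁ ∈ range m, ∑ l₂ ∈ range m, monoSq k R (x * ((l₁ - l₂ : ℤ) : ℝ)) ≤
      m * (R ^ 2 + 2 * ∑ j ∈ Icc 1 m, monoSq k R (x * ((j : ℤ) : ℝ))) := by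
  have h1 : ∀ l₁ ∈ range m, ∑ l₂ ∈ range m, monoSq k R (x * ((l₁ - l₂ : ℤ) : ℝ)) ≤
      R ^ 2 + 2 * ∑ j ∈ Icc 1 m, monoSq k R (x * ((j : ℤ) : ℝ)) := by
    intro l₁ hl₁
    have e := sum_Icc_neg_eq m (f := fun j : ℤ => monoSq k R (x * (j : ℝ)))
      (fun j => by simp only [Int.cast_neg, mul_neg, monoSq_neg])
    simp only [Int.cast_zero, mul_zero, monoSq_zero] at e
    rw [← e]
    have hinj : Set.InjOn (fun l₂ : ℕ => (l₁ - l₂ : ℤ)) (range m) := by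
      intro a _ b _ hab; simp only at hab; omega
    rw [← sum_image (f := fun j : ℤ => monoSq k R (x * (j : ℝ))) hinj]
    refine sum_le_sum_of_subset_of_nonneg ?_ fun _ _ _ => monoSq_nonneg _ _ _
    intro j hj
    obtain ⟨l₂, hl₂, rfl⟩ := mem_image.mp hj
    simp only [mem_range, mem_Icc] at *
    omega
  refine (sum_le_sum h1).trans ?_
  rw [sum_const, card_range, nsmul_eq_mul]

lemma natLog_add_one_le {D : ℝ} {L m : ℕ} (hD : DivBound D L) (hm : m ≤ L) :
    ((Nat.log 2 m + 1 : ℕ) : ℝ) ≤ 2 * D := by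
  rcases Nat.eq_zero_or_pos m with rfl | hm0
  · have := hD.one_le
    simp; linarith
  have e1 : (Nat.log 2 m : ℝ) ≤ Real.logb 2 m := by
    have := Real.natLog_le_logb m 2
    simpa using this
  have e2 : Real.logb 2 m ≤ 2 * Real.log m := by
    rw [Real.logb, div_le_iff₀ (Real.log_pos (by norm_num))]
    have := Real.log_two_gt_d9
    have h3 := Real.log_natCast_nonneg m
    nlinarith
  have e3 : Real.log m ≤ Real.log L := by gcongr
  have := hD.log_le
  push_cast; linarith

/-- The average over all pairs, diagonal included, becomes a mean square of Weyl sums in r, without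
counting representations by r₁^k - r₂^k. At most 2D dyadic lengths occur, whence 256 = 128·2. -/
lemma sum_kern_pair_le {D : ℝ} {L : ℕ} (hD : DivBound D L) (k R : ℕ) {P : ℕ} (hP : 1 ≤ P)
    (hPL : P ≤ L) (x : ℝ) :
    ∑ r₁ ∈ Ioc R (2 * R), ∑ r₂ ∈ Ioc R (2 * R), kern P (x * ((r₁ : ℝ) ^ k - (r₂ : ℝ) ^ k)) ≤
      256 * D * (R ^ 2 + 2 * ∑ j ∈ Icc 1 P, monoSq k R (x * ((j : ℤ) : ℝ))) := by
  set Y : ℝ := R ^ 2 + 2 * ∑ j ∈ Icc 1 P, monoSq k R (x * ((j : ℤ) : ℝ)) with hY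
  have hY0 : 0 ≤ Y := by
    have := sum_nonneg fun j (_ : j ∈ Icc 1 P) => monoSq_nonneg k R (x * ((j : ℤ) : ℝ))
    positivity
  have h1 : ∀ i ∈ range (Nat.log 2 P + 1), 1 / (2 : ℝ) ^ i *
      ∑ r₁ ∈ Ioc R (2 * R), ∑ r₂ ∈ Ioc R (2 * R),
      ‖∑ l ∈ range (2 ^ i), ex (l * (x * ((r₁ : ℝ) ^ k - (r₂ : ℝ) ^ k)))‖ ^ 2 ≤ Y := by
    intro i hi
    have hiP : 2 ^ i ≤ P := Nat.pow_le_of_le_log (by omega) (by simp at hi; omega)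
    rw [sum_fejer_eq, one_div, inv_mul_le_iff₀ (by positivity)]
    refine (sum_monoSq_sub_le k R (2 ^ i) x).trans ?_
    rw [hY]
    push_cast
    gcongr
    exact fun _ _ _ => monoSq_nonneg _ _ _
  have hlog := natLog_add_one_le hD hPL
  calc _ ≤ ∑ r₁ ∈ Ioc R (2 * R), ∑ r₂ ∈ Ioc R (2 * R), 128 * ∑ i ∈ range (Nat.log 2 P + 1),
        1 / (2 : ℝ) ^ i *
          ‖∑ l ∈ range (2 ^ i), ex (l * (x * ((r₁ : ℝ) ^ k - (r₂ : ℝ) ^ k)))‖ ^ 2 := by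
        gcongr; exact kern_le_fejer P _
    _ = 128 * ∑ i ∈ range (Nat.log 2 P + 1), 1 / (2 : ℝ) ^ i *
      ∑ r₁ ∈ Ioc R (2 * R), ∑ r₂ ∈ Ioc R (2 * R),
      ‖∑ l ∈ range (2 ^ i), ex (l * (x * ((r₁ : ℝ) ^ k - (r₂ : ℝ) ^ k)))‖ ^ 2 := by
        simp only [← mul_sum]
        congr 1
        rw [sum_congr rfl fun r₁ _ => sum_comm, sum_comm]
        simp only [mul_sum]
    _ ≤ 128 * ∑ i ∈ range (Nat.log 2 P + 1), Y := by gcongr with i hi; exact h1 i hi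
    _ = 128 * ((Nat.log 2 P + 1 : ℕ) : ℝ) * Y := by simp; ring
    _ ≤ 128 * (2 * D) * Y := by gcongr
    _ = _ := by ring

lemma diffSum_mul {P : ℕ} (G : ℤ → ℝ) (n : ℕ) (s w : ℤ) :
    diffSum P n G (s * w) = diffSum P n (fun u => G (u * w)) s := by
  induction n generalizing s with
  | zero => rfl
  | succ n ih =>
    simp only [diffSum]
    refine sum_congr rfl fun j _ => ?_
    rw [← ih]; congr 1; ring

lemma diffSum_sum {ι : Type*} (T : Finset ι) {P : ℕ} (G : ι → ℤ → ℝ) (n : ℕ) (s : ℤ) :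
    ∑ i ∈ T, diffSum P n (G i) s = diffSum P n (fun u => ∑ i ∈ T, G i u) s := by
  induction n generalizing s with
  | zero => rfl
  | succ n ih =>
    simp only [diffSum]
    rw [sum_comm]
    exact sum_congr rfl fun j _ => ih _

/-- The second use of Weyl's inequality, now in the variable r. As `monoSq` is already a square,
only a 2^(n-1)-th root is taken. -/
lemma exists_sum_monoSq_le (n : ℕ) (hn : 1 ≤ n) : ∃ c : ℝ, 0 < c ∧
    ∀ (D : ℝ) (L R V : ℕ) (θ : ℝ) (a : ℤ) (q : ℕ),
    DivBound D L → IsApprox θ a q → q ≤ L → 1 ≤ R → 1 ≤ V → (n + 1).factorial * V * R ^ n ≤ L →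
    ∑ v ∈ Icc 1 V, monoSq (n + 1) R (θ * ((v : ℤ) : ℝ)) ≤
      c * D ^ (n + 1) * (V * R ^ 2) *
        (1 / R + 1 / q + q / (V * R ^ (n + 1))) ^ (1 / 2 ^ (n - 1) : ℝ) := by
  obtain ⟨c, hc, hS⟩ := exists_sum_diffSum_kern_le n hn
  refine ⟨(3 ^ 2 ^ n * c) ^ (1 / 2 ^ (n - 1) : ℝ), by positivity, ?_⟩
  intro D L R V θ a q hD hθ hqL hR hV hL
  have hR' : (1 : ℝ) ≤ R := by exact_mod_cast hR
  have hV' : (1 : ℝ) ≤ V := by exact_mod_cast hV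
  have hq : (0 : ℝ) < q := by exact_mod_cast hθ.one_le
  have hD1 := hD.one_le
  set Q : ℝ := 1 / R + 1 / q + q / (V * R ^ (n + 1)) with hQ
  have hQ0 : 0 ≤ Q := by positivity
  have hK : 2 ^ n = 2 * 2 ^ (n - 1) := by rw [← pow_succ']; congr 1; omega
  set T := ∑ v ∈ Icc 1 V, monoSq (n + 1) R (θ * ((v : ℤ) : ℝ)) with hT
  have hT0 : 0 ≤ T := sum_nonneg fun _ _ => monoSq_nonneg _ _ _
  have h1 : T ^ 2 ^ (n - 1) ≤ (V : ℝ) ^ (2 ^ (n - 1) - 1) * ∑ v ∈ Icc 1 V,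
      monoSq (n + 1) R (θ * ((v : ℤ) : ℝ)) ^ 2 ^ (n - 1) :=
    pow_sum_le _ _ (fun _ _ => monoSq_nonneg _ _ _) Nat.one_le_two_pow (by simp)
  have h2 : ∀ v ∈ Icc 1 V, monoSq (n + 1) R (θ * ((v : ℤ) : ℝ)) ^ 2 ^ (n - 1) ≤
      (3 * R : ℝ) ^ (2 ^ n - (n + 1)) * diffSum R n (fun u => kern R (θ * u)) (v : ℕ) := by
    intro v _
    have e1 := sum_Ioc_natCast (fun x : ℤ => ex (θ * ((v : ℤ) : ℝ) * (x : ℝ) ^ (n + 1))) R (2 * R)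
    simp only [Int.cast_natCast] at e1
    rw [monoSq, ← pow_mul, ← hK, Int.cast_natCast, e1]
    refine weyl_inequality θ hR n (v : ℕ) (fun x => θ * (v : ℝ) * (x : ℝ) ^ (n + 1)) ?_ _ _
      (by omega)
    have := (isPhase_pow (n + 1)).const_mul (θ * ((v : ℤ) : ℝ))
    simp only [Int.cast_natCast] at this ⊢
    rwa [mul_one] at this
  have h3 := hS D L R V θ a q hD hθ hqL hR hV hL
  rw [← hQ] at h3
  have h4 : T ^ 2 ^ (n - 1) ≤ 3 ^ 2 ^ n * c * D ^ (n + 1) * (V * R ^ 2) ^ 2 ^ (n - 1) * Q := by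
    calc _ ≤ (V : ℝ) ^ (2 ^ (n - 1) - 1) * ((3 * R : ℝ) ^ (2 ^ n - (n + 1)) *
          (c * D ^ (n + 1) * (V * R ^ (n + 1)) * Q)) := by
          refine h1.trans ?_
          gcongr
          refine (sum_le_sum h2).trans ?_
          rw [← mul_sum]
          gcongr
      _ = 3 ^ (2 ^ n - (n + 1)) * c * D ^ (n + 1) * (((V : ℝ) ^ (2 ^ (n - 1) - 1) * V) *
          ((R : ℝ) ^ (2 ^ n - (n + 1)) * R ^ (n + 1))) * Q := by rw [mul_pow]; ring
      _ = 3 ^ (2 ^ n - (n + 1)) * c * D ^ (n + 1) * (V * R ^ 2) ^ 2 ^ (n - 1) * Q := by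
          rw [pow_split, pow_split_one, mul_pow, ← pow_mul, hK]
      _ ≤ _ := by
          gcongr
          · norm_num
          · exact Nat.sub_le _ _
  have hδ : (0 : ℝ) < 1 / 2 ^ (n - 1) := by positivity
  have hδ1 : (1 / 2 ^ (n - 1) : ℝ) ≤ 1 := by
    rw [div_le_one (by positivity)]; exact one_le_pow₀ (by norm_num)
  have hcast : (1 / 2 ^ (n - 1) : ℝ) = (((2 ^ (n - 1) : ℕ)) : ℝ)⁻¹ := by push_cast; rw [one_div]
  have root : ∀ z : ℝ, 0 ≤ z → (z ^ 2 ^ (n - 1)) ^ (1 / 2 ^ (n - 1) : ℝ) = z := by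
    intro z hz
    rw [hcast, Real.pow_rpow_inv_natCast hz (by positivity)]
  calc T = (T ^ 2 ^ (n - 1)) ^ (1 / 2 ^ (n - 1) : ℝ) := (root T hT0).symm
    _ ≤ (3 ^ 2 ^ n * c * D ^ (n + 1) * (V * R ^ 2) ^ 2 ^ (n - 1) * Q) ^ (1 / 2 ^ (n - 1) : ℝ) :=
        Real.rpow_le_rpow (by positivity) h4 hδ.le
    _ = (3 ^ 2 ^ n * c) ^ (1 / 2 ^ (n - 1) : ℝ) * (D ^ (n + 1)) ^ (1 / 2 ^ (n - 1) : ℝ) *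
        (V * R ^ 2) * Q ^ (1 / 2 ^ (n - 1) : ℝ) := by
        rw [Real.mul_rpow (by positivity) hQ0, Real.mul_rpow (by positivity) (by positivity),
          Real.mul_rpow (by positivity) (by positivity), root _ (by positivity)]
    _ ≤ _ := by
        gcongr
        calc (D ^ (n + 1)) ^ (1 / 2 ^ (n - 1) : ℝ) ≤ (D ^ (n + 1)) ^ (1 : ℝ) :=
              Real.rpow_le_rpow_of_exponent_le (one_le_pow₀ hD1) hδ1
          _ = _ := Real.rpow_one _

/-- All pairs `r₁, r₂`, when the pair variable is long. -/
lemma exists_allpairs_le (n : ℕ) (hn : 1 ≤ n) : ∃ c : ℝ, 0 < c ∧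
    ∀ (D : ℝ) (L H N P R : ℕ) (θ : ℝ) (a : ℤ) (q : ℕ) (f : ℤ → ℝ),
    DivBound D L → IsApprox θ a q → q ≤ L → 1 ≤ H → 1 ≤ P → 1 ≤ R →
    (n + 1).factorial * ((n + 1).factorial * H * P ^ (n + 1)) * R ^ n ≤ L →
    IsPhase (n + 1) θ f →
    (∑ i ∈ Icc 1 H ×ˢ (Ioc R (2 * R) ×ˢ Ioc R (2 * R)),
      ‖corrSum f N P i.1 i.2.1 i.2.2‖) ^ (2 ^ n) ≤
    c * D ^ (2 * n + 3) * (H * R ^ 2 * P : ℝ) ^ (2 ^ n) *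
      (1 / P + (1 / R + 1 / q + q / (P * R : ℝ) ^ (n + 1)) ^ (1 / 2 ^ (n - 1) : ℝ)) := by
  obtain ⟨c₁, hc₁, h₁⟩ := exists_sum_diffSum_le n
  obtain ⟨c₂, hc₂, h₂⟩ := exists_sum_monoSq_le n hn
  set F : ℝ := ((n + 1).factorial : ℝ) with hF
  have hF1 : 1 ≤ F := by rw [hF]; exact_mod_cast Nat.factorial_pos _
  refine ⟨3 ^ 2 ^ n * (c₁ * (2 + 256 * F + 512 * c₂ * F)), by positivity, ?_⟩
  intro D L H N P R θ a q f hD hθ hqL hH hP hR hL hf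
  have hH' : (1 : ℝ) ≤ H := by exact_mod_cast hH
  have hR' : (1 : ℝ) ≤ R := by exact_mod_cast hR
  have hP' : (1 : ℝ) ≤ P := by exact_mod_cast hP
  have hq : (0 : ℝ) < q := by exact_mod_cast hθ.one_le
  have hD1 := hD.one_le
  set Q : ℝ := 1 / R + 1 / q + q / (P * R : ℝ) ^ (n + 1) with hQ
  have hQ0 : 0 ≤ Q := by positivity
  set δ : ℝ := 1 / 2 ^ (n - 1) with hδ
  have hδ0 : 0 < δ := by positivity
  refine (weyl_corrSum hf N hP _ (card_box_le H R)).trans ?_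
  -- Frequencies after differencing in p range up to W; the Fejér step multiplies them by j ≤ P, so
  -- the second Weyl step averages over v ≤ WP.
  set W := (n + 1).factorial * H * P ^ n with hW
  have hWP : W * P = (n + 1).factorial * H * P ^ (n + 1) := by rw [hW]; ring
  have hW1 : 1 ≤ W := by
    have := Nat.factorial_pos (n + 1)
    have : 0 < P ^ n := by positivity
    exact Nat.mul_pos (Nat.mul_pos (by assumption) hH) this
  have hVL : W * P ≤ L := by
    rw [hWP]
    refine le_trans ?_ hL
    have e1 : 1 ≤ (n + 1).factorial := Nat.factorial_pos _
    have e2 : 1 ≤ R ^ n := Nat.one_le_pow _ _ hR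
    calc _ = 1 * ((n + 1).factorial * H * P ^ (n + 1)) * 1 := by ring
      _ ≤ _ := by gcongr
  have hWL : W ≤ L := le_trans (Nat.le_mul_of_pos_right _ hP) hVL
  have hPL : P ≤ L := le_trans (Nat.le_mul_of_pos_left _ hW1) hVL
  -- Summation over pairs commutes with `diffSum`, so the averaging lemma applies to one even
  -- function with G(0) = 2PR².
  set G : ℤ → ℝ := fun u => ∑ r ∈ Ioc R (2 * R) ×ˢ Ioc R (2 * R),
    kern P (θ * ((u * ((r.1 : ℤ) ^ (n + 1) - (r.2 : ℤ) ^ (n + 1)) : ℤ) : ℝ)) with hG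
  have hZ : ∑ i ∈ Icc 1 H ×ˢ (Ioc R (2 * R) ×ˢ Ioc R (2 * R)),
      diffSum P n (fun u => kern P (θ * u))
          ((i.1 : ℤ) * ((i.2.1 : ℤ) ^ (n + 1) - (i.2.2 : ℤ) ^ (n + 1))) =
      ∑ h ∈ Icc 1 H, diffSum P n G (h : ℕ) := by
    rw [sum_product]
    refine sum_congr rfl fun h _ => ?_
    simp only [diffSum_mul]
    rw [diffSum_sum]
  have hGle : ∀ w : ℕ, G w ≤ 256 * D * (R ^ 2 + 2 * ∑ j ∈ Icc 1 P,
      monoSq (n + 1) R (θ * ((1 * w * j : ℕ) : ℤ))) := by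
    intro w
    have e := sum_kern_pair_le hD (n + 1) R hP hPL (θ * w)
    rw [← sum_product'] at e
    convert e using 1
    · rw [hG]
      refine sum_congr rfl fun r _ => ?_
      congr 1; push_cast; ring
    · congr 3
      refine sum_congr rfl fun j _ => ?_
      congr 1; push_cast; ring
  have h3 := h₁ D L P H G (2 * R ^ 2) hD hP hWL (fun _ => sum_nonneg fun _ _ => kern_nonneg _ _)
    (fun s => by
      simp only [hG]
      refine sum_congr rfl fun r _ => ?_
      rw [neg_mul, kern_even])
    (by
      simp only [hG, zero_mul, Int.cast_zero, mul_zero, kern_zero, sum_const, nsmul_eq_mul,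
        card_product, Nat.card_Ioc]
      rw [show 2 * R - R = R by omega]
      push_cast
      exact le_of_eq (by ring))
  rw [← hW] at h3
  have hV1 : 1 ≤ W * P := Nat.mul_pos hW1 hP
  have h4 := h₂ D L R (W * P) θ a q hD hθ hqL hR hV1 (by rw [hWP]; exact hL)
  have h5 := sum_sum_mul_le hD (c := 1) (S := W) (P := P) le_rfl (by simpa using hVL)
    (G := fun m : ℕ => monoSq (n + 1) R (θ * ((m : ℤ) : ℝ))) (fun _ => monoSq_nonneg _ _ _)
  rw [one_mul] at h5
  have hWr : (W : ℝ) = F * H * P ^ n := by rw [hW, hF]; push_cast; ring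
  have h6 : (1 / R + 1 / q + q / (((W * P : ℕ) : ℝ) * R ^ (n + 1)) : ℝ) ^ δ ≤ Q ^ δ := by
    refine Real.rpow_le_rpow (by positivity) ?_ hδ0.le
    rw [hQ]
    gcongr
    rw [mul_pow]
    push_cast
    gcongr
    rw [hWr]
    calc (P : ℝ) ^ (n + 1) = 1 * 1 * P ^ n * P := by ring
      _ ≤ F * H * P ^ n * P := by gcongr
  have h7 : ∑ w ∈ Icc 1 W, G (w : ℕ) ≤ 256 * D * (W * R ^ 2 + 2 * (D *
      (c₂ * D ^ (n + 1) * ((W * P : ℕ) * R ^ 2) * Q ^ δ))) := by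
    calc _ ≤ ∑ w ∈ Icc 1 W, 256 * D * (R ^ 2 + 2 * ∑ j ∈ Icc 1 P,
          monoSq (n + 1) R (θ * ((1 * w * j : ℕ) : ℤ))) := sum_le_sum fun w _ => hGle w
      _ = 256 * D * (W * R ^ 2 + 2 * ∑ w ∈ Icc 1 W, ∑ j ∈ Icc 1 P,
          monoSq (n + 1) R (θ * ((1 * w * j : ℕ) : ℤ))) := by
          rw [← mul_sum, sum_add_distrib, ← mul_sum]; simp
      _ ≤ _ := by
          gcongr
          refine h5.trans ?_
          gcongr
          refine h4.trans ?_
          gcongr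
  set Z := ∑ h ∈ Icc 1 H, diffSum P n G (h : ℕ) with hZd
  have h8 : Z ≤ c₁ * (2 + 256 * F + 512 * c₂ * F) * D ^ (2 * n + 3) *
      (H * R ^ 2 * P ^ (n + 1) * (1 / P + Q ^ δ)) := by
    have hQδ : 0 ≤ Q ^ δ := by positivity
    set X : ℝ := H * R ^ 2 * P ^ n with hX
    have hX0 : 0 ≤ X := by positivity
    have e1 : H * R ^ 2 * (P : ℝ) ^ (n + 1) * (1 / P + Q ^ δ) = X + X * P * Q ^ δ := by
      rw [hX]; field_simp; ring
    rw [e1]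
    have e2 : (1 : ℝ) ≤ D ^ (n + 3) := one_le_pow₀ hD1
    have e3 : D ≤ D ^ (n + 3) := le_self_pow₀ hD1 (by omega)
    calc Z ≤ c₁ * D ^ n * (H * P ^ n * (2 * R ^ 2) + 256 * D * (W * R ^ 2 + 2 * (D *
          (c₂ * D ^ (n + 1) * ((W * P : ℕ) * R ^ 2) * Q ^ δ)))) := by
          refine h3.trans ?_
          gcongr
      _ = c₁ * D ^ n * (2 * X * 1 + 256 * F * X * D + 512 * c₂ * F * D ^ (n + 3) *
          (X * P * Q ^ δ)) := by
          push_cast; rw [hWr, hX]; ring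
      _ ≤ c₁ * D ^ n * (2 * X * D ^ (n + 3) + 256 * F * X * D ^ (n + 3) +
          512 * c₂ * F * D ^ (n + 3) * (X * P * Q ^ δ)) := by gcongr
      _ = c₁ * D ^ (2 * n + 3) * (2 * X + 256 * F * X + 512 * c₂ * F * (X * P * Q ^ δ)) := by
          rw [show 2 * n + 3 = n + (n + 3) by ring, pow_add D n]; ring
      _ ≤ c₁ * D ^ (2 * n + 3) * ((2 + 256 * F + 512 * c₂ * F) * (X + X * P * Q ^ δ)) := by
          have : 0 ≤ X * P * Q ^ δ := by positivity
          gcongr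
          have : 0 ≤ c₂ * F * X := by positivity
          have : 0 ≤ F * (X * P * Q ^ δ) := by positivity
          nlinarith
      _ = _ := by ring
  rw [hZ]
  calc _ ≤ (H * R ^ 2 : ℝ) ^ (2 ^ n - 1) * ((3 * P : ℝ) ^ (2 ^ n - (n + 1)) *
        (c₁ * (2 + 256 * F + 512 * c₂ * F) * D ^ (2 * n + 3) *
      (H * R ^ 2 * P ^ (n + 1) * (1 / P + Q ^ δ)))) := by gcongr
    _ = 3 ^ (2 ^ n - (n + 1)) * (c₁ * (2 + 256 * F + 512 * c₂ * F)) * D ^ (2 * n + 3) *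
        (((H * R ^ 2 : ℝ) ^ (2 ^ n - 1) * (H * R ^ 2)) *
        ((P : ℝ) ^ (2 ^ n - (n + 1)) * P ^ (n + 1))) * (1 / P + Q ^ δ) := by
        rw [mul_pow 3]; ring
    _ = 3 ^ (2 ^ n - (n + 1)) * (c₁ * (2 + 256 * F + 512 * c₂ * F)) * D ^ (2 * n + 3) *
        (H * R ^ 2 * P : ℝ) ^ 2 ^ n * (1 / P + Q ^ δ) := by
        rw [pow_split, pow_split_one, ← mul_pow]
    _ ≤ _ := by
        gcongr
        · norm_num
        · exact Nat.sub_le _ _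

/-! ### The bilinear estimate -/

/-- The saving `1 / q + x ^ (-1/2) + q / x ^ (n + 1)`. -/
noncomputable def sav (n q : ℕ) (x : ℝ) : ℝ := 1 / q + 1 / √x + q / x ^ (n + 1)

/-- The range in which divisor functions have to be controlled. -/
def lvl (n N : ℕ) : ℕ := (n + 1).factorial ^ 2 * 2 ^ (n + 1) * N ^ (2 * n + 2)

lemma sav_pos {n q : ℕ} (hq : 1 ≤ q) {x : ℝ} (hx : 0 < x) : 0 < sav n q x := by
  have : (0 : ℝ) < q := by exact_mod_cast hq
  unfold sav; positivity

lemma sav_anti {n q : ℕ} {x y : ℝ} (hx : 0 < x) (hxy : x ≤ y) : sav n q y ≤ sav n q x := by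
  unfold sav
  gcongr

lemma le_of_pow_le {T c D Y X : ℝ} {m e : ℕ} (hm : 1 ≤ m) (hT : 0 ≤ T) (hc : 0 ≤ c) (hD : 1 ≤ D)
    (hY : 0 ≤ Y) (hX : 0 ≤ X) (h : T ^ m ≤ c * D ^ e * Y ^ m * X) :
    T ≤ c ^ (1 / m : ℝ) * D ^ e * Y * X ^ (1 / m : ℝ) := by
  have hm0 : m ≠ 0 := by omega
  have hm1 : (1 : ℝ) ≤ m := by exact_mod_cast hm
  have root : ∀ z : ℝ, 0 ≤ z → (z ^ m) ^ (1 / m : ℝ) = z := fun z hz => by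
    rw [one_div, Real.pow_rpow_inv_natCast hz hm0]
  have hD0 : 0 ≤ D := by linarith
  calc T = (T ^ m) ^ (1 / m : ℝ) := (root T hT).symm
    _ ≤ (c * D ^ e * Y ^ m * X) ^ (1 / m : ℝ) := by gcongr
    _ = c ^ (1 / m : ℝ) * (D ^ e) ^ (1 / m : ℝ) * Y * X ^ (1 / m : ℝ) := by
        rw [Real.mul_rpow (by positivity) hX, Real.mul_rpow (by positivity) (by positivity),
          Real.mul_rpow hc (by positivity), root _ hY]
    _ ≤ _ := by
        gcongr
        calc (D ^ e) ^ (1 / m : ℝ) ≤ (D ^ e) ^ (1 : ℝ) := by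
              apply Real.rpow_le_rpow_of_exponent_le (one_le_pow₀ hD)
              rw [div_le_one (by linarith)]; exact hm1
          _ = _ := Real.rpow_one _

lemma le_of_sq_le {B c D H P R s g : ℝ} {e : ℕ} (hB : 0 ≤ B) (hc : 0 ≤ c) (hD : 1 ≤ D) (hH : 0 ≤ H)
    (hP : 0 ≤ P) (hR : 0 ≤ R) (hs : 0 ≤ s)
    (h : B ^ 2 ≤ H * P * D ^ 4 * (c * D ^ e * (H * R ^ 2 * P) * s ^ (2 * g))) :
    B ≤ c ^ (1 / 2 : ℝ) * D ^ (e + 4) * (H * P * R) * s ^ g := by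
  have h1 : B ^ 2 ≤ c * D ^ (e + 4) * (H * P * R) ^ 2 * s ^ (2 * g) := by
    refine h.trans (le_of_eq ?_); ring
  have h2 := le_of_pow_le (m := 2) (by norm_num) hB hc hD (by positivity)
    (Real.rpow_nonneg hs _) h1
  refine h2.trans (le_of_eq ?_)
  rw [← Real.rpow_mul hs]
  push_cast
  congr 2
  ring

/-- The longer of two variables is at least the square root of their product. This produces the term
x^(-1/2) of `sav`, and with it N^(1-γ/2). -/
lemma inv_le_inv_sqrt_mul {x y : ℝ} (hx : 0 < x) (hxy : x ≤ y) : 1 / y ≤ 1 / √(x * y) := by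
  have hy : 0 < y := by linarith
  have : √(x * y) ≤ y := by
    rw [Real.sqrt_le_left hy.le]; nlinarith
  have h0 : 0 < √(x * y) := Real.sqrt_pos.mpr (by positivity)
  gcongr

lemma lvl_bound₁ {n N H M X : ℕ} (hH : H ≤ N) (hM : M ≤ N) (hX : X ≤ N) :
    (n + 1).factorial * (H * (2 * M) ^ (n + 1)) * X ^ n ≤ lvl n N := by
  have h1 : 1 ≤ (n + 1).factorial := Nat.factorial_pos _
  calc _ ≤ (n + 1).factorial * (N * (2 * N) ^ (n + 1)) * N ^ n := by gcongr
    _ = (n + 1).factorial * 1 * 2 ^ (n + 1) * N ^ (2 * n + 2) := by ring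
    _ ≤ (n + 1).factorial * (n + 1).factorial * 2 ^ (n + 1) * N ^ (2 * n + 2) := by gcongr
    _ = _ := by rw [lvl]; ring

lemma lvl_bound₂ {n N H P R : ℕ} (hH : H ≤ N) (hP : P ≤ N) (hR : R ≤ N) :
    (n + 1).factorial * ((n + 1).factorial * H * P ^ (n + 1)) * R ^ n ≤ lvl n N := by
  have h1 : 1 ≤ 2 ^ (n + 1) := Nat.one_le_two_pow
  calc _ ≤ (n + 1).factorial * ((n + 1).factorial * N * N ^ (n + 1)) * N ^ n := by gcongr
    _ = (n + 1).factorial ^ 2 * 1 * N ^ (2 * n + 2) := by ring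
    _ ≤ (n + 1).factorial ^ 2 * 2 ^ (n + 1) * N ^ (2 * n + 2) := by gcongr
    _ = _ := by rw [lvl]

lemma two_pow_rpow (n : ℕ) {s : ℝ} (hs : 0 ≤ s) :
    (s ^ (2 / 2 ^ n : ℝ)) ^ (1 / ((2 ^ n : ℕ) : ℝ)) = s ^ (2 * (1 / 4 ^ n) : ℝ) := by
  rw [← Real.rpow_mul hs]
  congr 1
  have : (4 : ℝ) ^ n = 2 ^ n * 2 ^ n := by rw [← mul_pow]; norm_num
  rw [this]
  push_cast
  field_simp

lemma sum_box_eq (H R : ℕ) (F : ℕ → ℕ → ℕ → ℝ) :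
    ∑ h ∈ Icc 1 H, ∑ r₁ ∈ Ioc R (2 * R), ∑ r₂ ∈ Ioc R (2 * R), F h r₁ r₂ =
      ∑ i ∈ Icc 1 H ×ˢ (Ioc R (2 * R) ×ˢ Ioc R (2 * R)), F i.1 i.2.1 i.2.2 := by
  rw [sum_product]
  exact sum_congr rfl fun _ _ => by rw [sum_product]

/-- Here the shorter variable P is long enough for the saving 1/P of the first differencing to
suffice; the pairs come from the longer variable. -/
lemma exists_bilin_long_le (n : ℕ) (hn : 1 ≤ n) : ∃ c : ℝ, 0 < c ∧
    ∀ (D : ℝ) (H N P R : ℕ) (θ : ℝ) (a : ℤ) (q : ℕ) (f : ℤ → ℝ) (u v : ℕ → ℂ),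
    DivBound D (lvl n N) → IsApprox θ a q → q ≤ lvl n N → 1 ≤ H → H ≤ N → 1 ≤ P → P ≤ R → R ≤ N →
    IsPhase (n + 1) θ f → (∀ m, ‖u m‖ ≤ D) → (∀ m, ‖v m‖ ≤ D) →
    1 / (P : ℝ) ≤ sav n q (P * R) ^ (2 / 2 ^ n : ℝ) →
    ∑ h ∈ Icc 1 H, ‖bilin f N P R u v h‖ ≤
      c * D ^ (2 * n + 7) * (H * P * R) * sav n q (P * R) ^ (1 / 4 ^ n : ℝ) := by
  obtain ⟨c, hc, h⟩ := exists_allpairs_le n hn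
  refine ⟨((c * 2) ^ (1 / ((2 ^ n : ℕ) : ℝ))) ^ (1 / 2 : ℝ), by positivity, ?_⟩
  intro D H N P R θ a q f u v hD hθ hq hH hHN hP hPR hRN hf hu hv hs
  have hP' : (1 : ℝ) ≤ P := by exact_mod_cast hP
  have hPR' : (P : ℝ) ≤ R := by exact_mod_cast hPR
  set s := sav n q (P * R) with hsd
  have hs0 : 0 < s := sav_pos hθ.one_le (mul_pos (by linarith) (by linarith))
  have hD1 := hD.one_le
  have h1 := h D _ H N P R θ a q f hD hθ hq hH hP (hP.trans hPR)
    (lvl_bound₂ hHN (hPR.trans hRN) hRN) hf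
  have h2 : (1 / P + (1 / R + 1 / q + q / (P * R : ℝ) ^ (n + 1)) ^ (1 / 2 ^ (n - 1) : ℝ)) ≤
      2 * s ^ (2 / 2 ^ n : ℝ) := by
    have e : (1 / 2 ^ (n - 1) : ℝ) = 2 / 2 ^ n := by
      obtain ⟨m, rfl⟩ : ∃ m, n = m + 1 := ⟨n - 1, by omega⟩
      rw [Nat.add_sub_cancel, pow_succ]; field_simp
    rw [e, two_mul]
    refine add_le_add hs ?_
    refine Real.rpow_le_rpow (by positivity) ?_ (by positivity)
    rw [hsd, sav]
    have := inv_le_inv_sqrt_mul (by linarith : (0 : ℝ) < P) hPR'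
    linarith
  set T := ∑ i ∈ Icc 1 H ×ˢ (Ioc R (2 * R) ×ˢ Ioc R (2 * R)), ‖corrSum f N P i.1 i.2.1 i.2.2‖ with hT
  have hT0 : 0 ≤ T := sum_nonneg fun _ _ => norm_nonneg _
  have h3 : T ^ 2 ^ n ≤ (c * 2) * D ^ (2 * n + 3) * (H * R ^ 2 * P : ℝ) ^ (2 ^ n) *
      s ^ (2 / 2 ^ n : ℝ) := by
    refine h1.trans ?_
    calc _ ≤ c * D ^ (2 * n + 3) * (H * R ^ 2 * P : ℝ) ^ (2 ^ n) * (2 * s ^ (2 / 2 ^ n : ℝ)) := by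
          gcongr
      _ = _ := by ring
  have h4 := le_of_pow_le Nat.one_le_two_pow hT0 (by positivity) hD1 (by positivity)
    (by positivity) h3
  rw [two_pow_rpow n hs0.le] at h4
  have h5 := bilin_cauchy f N P R H (fun p _ => hu p) (fun r _ => hv r)
  rw [sum_box_eq H R fun h r₁ r₂ => ‖corrSum f N P h r₁ r₂‖] at h5
  refine le_of_sq_le (sum_nonneg fun _ _ => norm_nonneg _) (by positivity) hD1 (by positivity)
    (by positivity) (by positivity) hs0.le (h5.trans ?_)
  gcongr

/-- Here the pair variable R is short. The diagonal saves only 1/R, enough by the first bound on R;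
off it the loss R^(n-1) is at most s^(-2(n-1)/2^n), and against the saving s this leaves s^(2/2^n)
because 2n ≤ 2^n. -/
lemma exists_bilin_short_le (n : ℕ) (hn : 1 ≤ n) : ∃ c : ℝ, 0 < c ∧
    ∀ (D : ℝ) (H N P R : ℕ) (θ : ℝ) (a : ℤ) (q : ℕ) (f : ℤ → ℝ) (u v : ℕ → ℂ),
    DivBound D (lvl n N) → IsApprox θ a q → q ≤ lvl n N → 1 ≤ H → H ≤ N → 1 ≤ R → R ≤ P → P ≤ N →
    IsPhase (n + 1) θ f → (∀ m, ‖u m‖ ≤ D) → (∀ m, ‖v m‖ ≤ D) →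
    1 / (R : ℝ) ≤ sav n q (P * R) ^ (2 * (1 / 4 ^ n) : ℝ) →
    sav n q (P * R) ^ (2 / 2 ^ n : ℝ) ≤ 1 / (R : ℝ) → sav n q (P * R) ≤ 1 →
    ∑ h ∈ Icc 1 H, ‖bilin f N P R u v h‖ ≤
      c * D ^ (2 * n + 7) * (H * P * R) * sav n q (P * R) ^ (1 / 4 ^ n : ℝ) := by
  obtain ⟨c, hc, h⟩ := exists_offdiag_le n hn
  refine ⟨(1 + c ^ (1 / ((2 ^ n : ℕ) : ℝ))) ^ (1 / 2 : ℝ), by positivity, ?_⟩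
  intro D H N P R θ a q f u v hD hθ hq hH hHN hR hRP hPN hf hu hv hs hs2 hs1
  have hR' : (1 : ℝ) ≤ R := by exact_mod_cast hR
  have hRP' : (R : ℝ) ≤ P := by exact_mod_cast hRP
  have hq0 : (0 : ℝ) < q := by exact_mod_cast hθ.one_le
  set s := sav n q (P * R) with hsd
  have hs0 : 0 < s := sav_pos hθ.one_le (mul_pos (by linarith) (by linarith))
  have hD1 := hD.one_le
  have h1 := h D _ H N P R θ a q f hD hθ hq hH (hR.trans hRP) hR
    (lvl_bound₁ hHN (hRP.trans hPN) hPN) hf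
  set T₁ := ∑ i ∈ (Icc 1 H ×ˢ (Ioc R (2 * R) ×ˢ Ioc R (2 * R))).filter (fun i => i.2.1 ≠ i.2.2),
    ‖corrSum f N P i.1 i.2.1 i.2.2‖ with hT₁
  have hT0 : 0 ≤ T₁ := sum_nonneg fun _ _ => norm_nonneg _
  have h2 : R ^ (n - 1) * (1 / P + 1 / q + q / (P * R : ℝ) ^ (n + 1)) ≤ s ^ (2 / 2 ^ n : ℝ) := by
    have e1 : (1 / P + 1 / q + q / (P * R : ℝ) ^ (n + 1)) ≤ s := by
      rw [hsd, sav]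
      have := inv_le_inv_sqrt_mul (by linarith : (0 : ℝ) < R) hRP'
      rw [mul_comm (R : ℝ)] at this
      linarith
    have e2 : (R : ℝ) ≤ s ^ (-(2 / 2 ^ n) : ℝ) := by
      rw [Real.rpow_neg hs0.le]
      rw [le_inv_comm₀ (by positivity) (by positivity)]
      simpa using hs2
    have e3 : (n : ℝ) ≤ 2 ^ n / 2 := by
      have : n ≤ 2 ^ (n - 1) := by
        have := Nat.lt_two_pow_self (n := n - 1); omega
      have e : (2 : ℝ) ^ n = 2 * 2 ^ (n - 1) := by rw [← pow_succ']; congr 1; omega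
      rw [e]
      have : (n : ℝ) ≤ 2 ^ (n - 1) := by exact_mod_cast this
      linarith
    calc _ ≤ (s ^ (-(2 / 2 ^ n) : ℝ)) ^ (n - 1) * s := by gcongr
      _ = s ^ (-(2 / 2 ^ n) * ((n - 1 : ℕ) : ℝ) + 1 : ℝ) := by
          rw [Real.rpow_add hs0, Real.rpow_one, Real.rpow_mul hs0.le, Real.rpow_natCast]
      _ ≤ _ := by
          apply Real.rpow_le_rpow_of_exponent_ge hs0 hs1
          push_cast [hn]
          have hp : (0 : ℝ) < 2 ^ n := by positivity
          have : (2 : ℝ) / 2 ^ n * n ≤ 1 := by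
            rw [div_mul_eq_mul_div, div_le_one hp]; linarith
          nlinarith
  have h3 : T₁ ^ 2 ^ n ≤ c * D ^ (n + 3) * (H * R ^ 2 * P : ℝ) ^ (2 ^ n) *
      s ^ (2 / 2 ^ n : ℝ) := h1.trans (by gcongr)
  have h4 := le_of_pow_le Nat.one_le_two_pow hT0 hc.le hD1 (by positivity)
    (by positivity) h3
  rw [two_pow_rpow n hs0.le] at h4
  set T₂ := ∑ i ∈ (Icc 1 H ×ˢ (Ioc R (2 * R) ×ˢ Ioc R (2 * R))).filter (fun i => ¬ i.2.1 ≠ i.2.2),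
    ‖corrSum f N P i.1 i.2.1 i.2.2‖ with hT₂
  have h6 : T₂ ≤ (H * R ^ 2 * P) * s ^ (2 * (1 / 4 ^ n) : ℝ) := by
    have hcard : ((Icc 1 H ×ˢ (Ioc R (2 * R) ×ˢ Ioc R (2 * R))).filter
        (fun i => ¬ i.2.1 ≠ i.2.2)).card ≤ (Icc 1 H ×ˢ Ioc R (2 * R)).card := by
      refine card_le_card_of_injOn (fun i => (i.1, i.2.1)) ?_ ?_
      · rintro ⟨h, r₁, r₂⟩ hi
        simp only [coe_filter, Set.mem_ofPred_eq, mem_product, mem_coe] at hi ⊢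
        exact ⟨hi.1.1, hi.1.2.1⟩
      · rintro ⟨h, r₁, r₂⟩ hi ⟨h', s₁, s₂⟩ hi' he
        simp only [coe_filter, Set.mem_ofPred_eq, mem_product, not_not] at hi hi'
        simp only [Prod.mk.injEq] at he ⊢
        exact ⟨he.1, he.2, by rw [← hi.2, ← hi'.2, he.2]⟩
    have hcard2 : ((Icc 1 H ×ˢ Ioc R (2 * R)).card : ℝ) = H * R := by
      rw [card_product, Nat.card_Icc, Nat.card_Ioc, show 2 * R - R = R by omega]; push_cast; simp
    calc T₂ ≤ ∑ i ∈ (Icc 1 H ×ˢ (Ioc R (2 * R) ×ˢ Ioc R (2 * R))).filter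
          (fun i => ¬ i.2.1 ≠ i.2.2), (P : ℝ) := sum_le_sum fun i _ => norm_corrSum_le _ _ _ _ _ _
      _ ≤ H * R * P := by
          rw [sum_const, nsmul_eq_mul, ← hcard2]
          gcongr
      _ = (H * R ^ 2 * P) * (1 / R) := by field_simp
      _ ≤ _ := by gcongr
  have h5 := bilin_cauchy f N P R H (fun p _ => hu p) (fun r _ => hv r)
  rw [sum_box_eq H R fun h r₁ r₂ => ‖corrSum f N P h r₁ r₂‖,
    ← sum_filter_add_sum_filter_not _ (fun i : ℕ × ℕ × ℕ => i.2.1 ≠ i.2.2), ← hT₁, ← hT₂] at h5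
  refine le_of_sq_le (sum_nonneg fun _ _ => norm_nonneg _) (by positivity) hD1 (by positivity)
    (by positivity) (by positivity) hs0.le (h5.trans ?_)
  set Z : ℝ := (H * R ^ 2 * P) * s ^ (2 * (1 / 4 ^ n) : ℝ) with hZ
  have hZ0 : 0 ≤ Z := by positivity
  have e1 : D ^ (n + 3) ≤ D ^ (2 * n + 3) := pow_le_pow_right₀ hD1 (by omega)
  have e2 : 1 ≤ D ^ (2 * n + 3) := one_le_pow₀ hD1
  refine mul_le_mul_of_nonneg_left ?_ (by positivity)
  calc T₁ + T₂ ≤ c ^ (1 / ((2 ^ n : ℕ) : ℝ)) * D ^ (n + 3) * Z + 1 * Z := by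
        rw [hZ]; linarith
    _ ≤ c ^ (1 / ((2 ^ n : ℕ) : ℝ)) * D ^ (2 * n + 3) * Z + D ^ (2 * n + 3) * Z := by gcongr
    _ = _ := by rw [hZ]; ring

lemma bilin_swap (f : ℤ → ℝ) (N P R : ℕ) (u v : ℕ → ℂ) (h : ℕ) :
    bilin f N P R u v h = bilin f N R P v u h := by
  rw [bilin, bilin, sum_comm]
  refine sum_congr rfl fun r _ => sum_congr rfl fun p _ => ?_
  rw [mul_comm p r, mul_comm (u p), mul_comm (p : ℤ)]

lemma norm_bilin_le (f : ℤ → ℝ) (N P R : ℕ) {u v : ℕ → ℂ} {D : ℝ} (hu : ∀ m, ‖u m‖ ≤ D)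
    (hv : ∀ m, ‖v m‖ ≤ D) (h : ℕ) : ‖bilin f N P R u v h‖ ≤ P * R * D ^ 2 := by
  have hD : 0 ≤ D := (norm_nonneg _).trans (hu 0)
  calc _ ≤ ∑ p ∈ Ioc P (2 * P), ∑ r ∈ Ioc R (2 * R), D ^ 2 := by
        refine (norm_sum_le _ _).trans (sum_le_sum fun p _ => ?_)
        refine (norm_sum_le _ _).trans (sum_le_sum fun r _ => ?_)
        split_ifs
        · rw [norm_mul, norm_mul, norm_ex, mul_one, sq]
          gcongr
          · exact hu p
          · exact hv r
        · rw [norm_zero]; positivity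
    _ = _ := by simp [two_mul]; ring

lemma bilin_eq_zero (f : ℤ → ℝ) {N P R : ℕ} (u v : ℕ → ℂ) (h : ℕ) (hN : N < P * R) :
    bilin f N P R u v h = 0 := by
  refine sum_eq_zero fun p hp => sum_eq_zero fun r hr => if_neg ?_
  have h1 := mem_Ioc.mp hp
  have h2 := mem_Ioc.mp hr
  have := Nat.mul_le_mul h1.1.le h2.1.le
  omega

/-- x^(4^n) times `sav` is a combination of powers of x with nonnegative exponents, as n+1 ≤ 4^n.
Hence the bound for a box with PR ≤ N is at most the bound for N. -/
lemma mul_sav_rpow_mono {n q : ℕ} (hq : 1 ≤ q) {x y : ℝ} (hx : 0 < x) (hxy : x ≤ y) :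
    x * sav n q x ^ (1 / 4 ^ n : ℝ) ≤ y * sav n q y ^ (1 / 4 ^ n : ℝ) := by
  have hq' : (0 : ℝ) < q := by exact_mod_cast hq
  have hn : n + 1 ≤ 4 ^ n := by
    calc n + 1 ≤ 2 ^ n := Nat.lt_two_pow_self
      _ ≤ 4 ^ n := Nat.pow_le_pow_left (by norm_num) n
  have key : ∀ z : ℝ, 0 < z → z * sav n q z ^ (1 / 4 ^ n : ℝ) =
      (z ^ (4 ^ n) / q + z ^ (4 ^ n - 1) * √z + q * z ^ (4 ^ n - (n + 1))) ^ (1 / 4 ^ n : ℝ) := by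
    intro z hz
    have e1 : z = (z ^ (4 ^ n)) ^ (1 / 4 ^ n : ℝ) := by
      have : (1 / 4 ^ n : ℝ) = (((4 ^ n : ℕ)) : ℝ)⁻¹ := by push_cast; rw [one_div]
      rw [this, Real.pow_rpow_inv_natCast hz.le (by positivity)]
    conv_lhs => rw [e1]
    rw [← Real.mul_rpow (by positivity) (sav_pos hq (by rw [← e1]; exact hz)).le]
    rw [← e1]
    congr 1
    have e2 : z ^ 4 ^ n = z ^ (4 ^ n - 1) * z := by rw [← pow_succ]; congr 1; omega
    have e3 : z ^ 4 ^ n = z ^ (4 ^ n - (n + 1)) * z ^ (n + 1) := by rw [← pow_add]; congr 1; omega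
    have e4 : z ^ 4 ^ n * (1 / √z) = z ^ (4 ^ n - 1) * √z := by
      rw [e2, mul_assoc, mul_one_div, Real.div_sqrt]
    have e5 : z ^ 4 ^ n * (q / z ^ (n + 1)) = q * z ^ (4 ^ n - (n + 1)) := by
      rw [e3]; field_simp
    rw [sav, mul_add, mul_add, e4, e5, mul_one_div]
  rw [key x hx, key y (by linarith)]
  have : 0 < y := by linarith
  gcongr

lemma exists_bilin_le (n : ℕ) (hn : 1 ≤ n) : ∃ c : ℝ, 0 < c ∧
    ∀ (D : ℝ) (H N P R : ℕ) (θ : ℝ) (a : ℤ) (q : ℕ) (f : ℤ → ℝ) (u v : ℕ → ℂ),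
    DivBound D (lvl n N) → IsApprox θ a q → q ≤ lvl n N → 1 ≤ H → H ≤ N → 1 ≤ P → 1 ≤ R →
    IsPhase (n + 1) θ f → (∀ m, ‖u m‖ ≤ D) → (∀ m, ‖v m‖ ≤ D) →
    1 / (P : ℝ) ≤ sav n q N ^ (2 * (1 / 4 ^ n) : ℝ) →
    1 / (R : ℝ) ≤ sav n q N ^ (2 * (1 / 4 ^ n) : ℝ) →
    ∑ h ∈ Icc 1 H, ‖bilin f N P R u v h‖ ≤
      c * D ^ (2 * n + 7) * (H * N) * sav n q N ^ (1 / 4 ^ n : ℝ) := by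
  obtain ⟨c₁, hc₁, h₁⟩ := exists_bilin_long_le n hn
  obtain ⟨c₂, hc₂, h₂⟩ := exists_bilin_short_le n hn
  refine ⟨c₁ + c₂ + 1, by positivity, ?_⟩
  intro D H N P R θ a q f u v hD hθ hq hH hHN hP hR hf hu hv hsP hsR
  have hq1 := hθ.one_le
  have hP' : (1 : ℝ) ≤ P := by exact_mod_cast hP
  have hR' : (1 : ℝ) ≤ R := by exact_mod_cast hR
  have hN' : (0 : ℝ) < N := by exact_mod_cast (by omega : 0 < N)
  have hD1 := hD.one_le
  have hsN0 := sav_pos (n := n) hq1 hN'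
  rcases lt_or_ge N (P * R) with hlt | hle
  · rw [sum_eq_zero fun h _ => by rw [bilin_eq_zero f u v h hlt, norm_zero]]
    positivity
  have hPN : P ≤ N := le_trans (Nat.le_mul_of_pos_right _ hR) hle
  have hRN : R ≤ N := le_trans (Nat.le_mul_of_pos_left _ hP) hle
  have hle' : (P : ℝ) * R ≤ N := by exact_mod_cast hle
  have hPR0 : (0 : ℝ) < P * R := by positivity
  set s := sav n q (P * R) with hs
  have hs0 : 0 < s := sav_pos hq1 hPR0
  have hsle : sav n q N ≤ s := sav_anti hPR0 hle'
  have hsle2 : sav n q N ^ (2 * (1 / 4 ^ n) : ℝ) ≤ s ^ (2 * (1 / 4 ^ n) : ℝ) := by gcongr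
  suffices hmain : ∑ h ∈ Icc 1 H, ‖bilin f N P R u v h‖ ≤
      (c₁ + c₂ + 1) * D ^ (2 * n + 7) * (H * P * R) * s ^ (1 / 4 ^ n : ℝ) by
    refine hmain.trans ?_
    have e := mul_sav_rpow_mono (n := n) hq1 hPR0 hle'
    calc _ = (c₁ + c₂ + 1) * D ^ (2 * n + 7) * H * (P * R * s ^ (1 / 4 ^ n : ℝ)) := by ring
      _ ≤ (c₁ + c₂ + 1) * D ^ (2 * n + 7) * H * (N * sav n q N ^ (1 / 4 ^ n : ℝ)) := by gcongr
      _ = _ := by ring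
  have hX : 0 ≤ D ^ (2 * n + 7) * (H * P * R) * s ^ (1 / 4 ^ n : ℝ) := by positivity
  rcases le_or_gt 1 s with hs1 | hs1
  · have e1 : (1 : ℝ) ≤ s ^ (1 / 4 ^ n : ℝ) := Real.one_le_rpow hs1 (by positivity)
    have e2 : D ^ 2 ≤ D ^ (2 * n + 7) := pow_le_pow_right₀ hD1 (by omega)
    calc _ ≤ ∑ h ∈ Icc 1 H, P * R * D ^ 2 := sum_le_sum fun h _ => norm_bilin_le f N P R hu hv h
      _ = 1 * D ^ 2 * (H * P * R) * 1 := by simp; ring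
      _ ≤ _ := by gcongr; linarith
  · have main : ∀ (Y Z : ℕ) (u v : ℕ → ℂ), 1 ≤ Y → Y ≤ Z → Z ≤ N → (∀ m, ‖u m‖ ≤ D) →
        (∀ m, ‖v m‖ ≤ D) → sav n q (Y * Z) = s → 1 / (Y : ℝ) ≤ s ^ (2 * (1 / 4 ^ n) : ℝ) →
        ∑ h ∈ Icc 1 H, ‖bilin f N Y Z u v h‖ ≤
        (c₁ + c₂ + 1) * (D ^ (2 * n + 7) * (H * Y * Z) * s ^ (1 / 4 ^ n : ℝ)) := by
      intro Y Z u v hY hYZ hZN hu hv hsYZ hYs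
      have hX : 0 ≤ D ^ (2 * n + 7) * (H * Y * Z) * s ^ (1 / 4 ^ n : ℝ) := by positivity
      -- The threshold is Y = s^(-2/2^n): above it the shorter variable Y is differenced, below it Y
      -- supplies the pairs.
      rcases le_total (1 / (Y : ℝ)) (s ^ (2 / 2 ^ n : ℝ)) with hcase | hcase
      · have := h₁ D H N Y Z θ a q f u v hD hθ hq hH hHN hY hYZ hZN hf hu hv
          (by rw [hsYZ]; exact hcase)
        rw [hsYZ] at this
        nlinarith
      · have e : sav n q (Z * Y) = s := by rw [mul_comm]; exact hsYZ
        have := h₂ D H N Z Y θ a q f v u hD hθ hq hH hHN hY hYZ hZN hf hv hu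
          (by rw [e]; exact hYs) (by rw [e]; exact hcase) (by rw [e]; exact hs1.le)
        rw [e] at this
        simp only [bilin_swap f N Y Z]
        nlinarith
    rcases le_total P R with hPR | hPR
    · refine (main P R u v hP hPR hRN hu hv rfl (hsP.trans hsle2)).trans (le_of_eq ?_)
      ring
    · simp only [bilin_swap f N P R]
      refine (main R P v u hR hPR hPN hv hu (by rw [mul_comm]) (hsR.trans hsle2)).trans
        (le_of_eq ?_)
      ring

lemma sum_Ioc_two_pow {E : Type*} [AddCommMonoid E] (F : ℕ → E) {i j : ℕ} (hij : i ≤ j) :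
    ∑ m ∈ Ioc (2 ^ i) (2 ^ j), F m = ∑ l ∈ Ico i j, ∑ m ∈ Ioc (2 ^ l) (2 * 2 ^ l), F m := by
  induction j, hij using Nat.le_induction with
  | base => simp
  | succ j hij ih =>
    rw [sum_Ico_succ_top hij, ← ih, ← pow_succ']
    exact (sum_Ioc_consecutive F (Nat.pow_le_pow_right (by norm_num) hij)
      (Nat.pow_le_pow_right (by norm_num) (by omega))).symm

lemma le_lvl (n N : ℕ) : N ≤ lvl n N := by
  have h1 : 1 ≤ (n + 1).factorial ^ 2 * 2 ^ (n + 1) := by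
    have := Nat.factorial_pos (n + 1)
    exact Nat.mul_pos (by positivity) (by positivity)
  calc N ≤ N ^ (2 * n + 2) := Nat.le_self_pow (by omega) _
    _ ≤ _ := Nat.le_mul_of_pos_left _ h1

/-- Bilinear sums with both variables exceeding `2 ^ i₀`. -/
lemma exists_bilinear_le (n : ℕ) (hn : 1 ≤ n) : ∃ c : ℝ, 0 < c ∧
    ∀ (D : ℝ) (H N i₀ : ℕ) (θ : ℝ) (a : ℤ) (q : ℕ) (f : ℤ → ℝ) (u v : ℕ → ℂ),
    DivBound D (lvl n N) → IsApprox θ a q → q ≤ lvl n N → 1 ≤ H → H ≤ N →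
    IsPhase (n + 1) θ f → (∀ m, ‖u m‖ ≤ D) → (∀ m, ‖v m‖ ≤ D) →
    1 / (2 : ℝ) ^ i₀ ≤ sav n q N ^ (2 * (1 / 4 ^ n) : ℝ) →
    ∑ h ∈ Icc 1 H, ‖∑ p ∈ Ioc (2 ^ i₀) N, ∑ r ∈ Ioc (2 ^ i₀) N,
      if p * r ≤ N then u p * v r * ex (h * f (p * r)) else 0‖ ≤
      c * D ^ (2 * n + 9) * (H * N) * sav n q N ^ (1 / 4 ^ n : ℝ) := by
  obtain ⟨c, hc, h₁⟩ := exists_bilin_le n hn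
  refine ⟨4 * c, by positivity, ?_⟩
  intro D H N i₀ θ a q f u v hD hθ hq hH hHN hf hu hv hs
  have hD1 := hD.one_le
  have hN' : (0 : ℝ) < N := by exact_mod_cast (by omega : 0 < N)
  have hsN0 := sav_pos (n := n) hθ.one_le hN'
  -- Dyadic ranges beyond N contribute nothing. At most 2D exponents remain for each variable, which
  -- accounts for the factor 4D² over the single-box bound.
  set J := Nat.log 2 N + 1 with hJ
  have hNJ : N < 2 ^ J := Nat.lt_pow_succ_log_self (by norm_num) N
  set t : ℕ → ℕ → ℕ → ℂ := fun h p r => if p * r ≤ N then u p * v r * ex (h * f (p * r)) else 0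
    with ht
  rcases lt_or_ge J i₀ with hlt | hle
  · have : Ioc (2 ^ i₀) N = ∅ := by
      apply Ioc_eq_empty
      have : 2 ^ J < 2 ^ i₀ := Nat.pow_lt_pow_right (by norm_num) hlt
      omega
    simp only [this, sum_empty, norm_zero, sum_const_zero]
    positivity
  have ext : ∀ h : ℕ, ∑ p ∈ Ioc (2 ^ i₀) N, ∑ r ∈ Ioc (2 ^ i₀) N, t h p r =
      ∑ i ∈ Ico i₀ J, ∑ j ∈ Ico i₀ J, bilin f N (2 ^ i) (2 ^ j) u v h := by
    intro h
    have e1 : ∀ F : ℕ → ℂ, (∀ m, N < m → F m = 0) →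
        ∑ m ∈ Ioc (2 ^ i₀) N, F m = ∑ l ∈ Ico i₀ J, ∑ m ∈ Ioc (2 ^ l) (2 * 2 ^ l), F m := by
      intro F hF
      rw [← sum_Ioc_two_pow F hle]
      refine sum_subset (Ioc_subset_Ioc_right hNJ.le) fun m hm hm' => hF m ?_
      simp only [mem_Ioc] at hm hm'
      omega
    rw [e1]
    · refine sum_congr rfl fun i _ => ?_
      simp only [bilin]
      rw [sum_comm (s := Ico i₀ J)]
      refine sum_congr rfl fun p hp => ?_
      have hp : 1 ≤ p := (Nat.zero_le _).trans_lt (mem_Ioc.mp hp).1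
      rw [e1]
      intro m hm
      refine if_neg ?_
      have := Nat.le_mul_of_pos_left m hp
      omega
    · intro m hm
      refine sum_eq_zero fun r hr => if_neg ?_
      have hr : 1 ≤ r := (Nat.zero_le _).trans_lt (mem_Ioc.mp hr).1
      have := Nat.le_mul_of_pos_right m hr
      omega
  have hJD : ((Ico i₀ J).card : ℝ) ≤ 2 * D := by
    refine le_trans ?_ (natLog_add_one_le hD (le_lvl n N))
    rw [Nat.card_Ico]; exact_mod_cast Nat.sub_le _ _
  set B := c * D ^ (2 * n + 7) * (H * N) * sav n q N ^ (1 / 4 ^ n : ℝ) with hB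
  have hB0 : 0 ≤ B := by positivity
  have hpow : ∀ i ∈ Ico i₀ J, 1 / ((2 ^ i : ℕ) : ℝ) ≤ sav n q N ^ (2 * (1 / 4 ^ n) : ℝ) := by
    intro i hi
    refine le_trans ?_ hs
    push_cast
    gcongr
    · norm_num
    · exact (mem_Ico.mp hi).1
  calc _ ≤ ∑ h ∈ Icc 1 H, ∑ i ∈ Ico i₀ J, ∑ j ∈ Ico i₀ J, ‖bilin f N (2 ^ i) (2 ^ j) u v h‖ := by
        refine sum_le_sum fun h _ => ?_
        rw [ext]
        exact (norm_sum_le _ _).trans (sum_le_sum fun i _ => norm_sum_le _ _)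
    _ = ∑ i ∈ Ico i₀ J, ∑ j ∈ Ico i₀ J, ∑ h ∈ Icc 1 H, ‖bilin f N (2 ^ i) (2 ^ j) u v h‖ := by
        rw [sum_comm]
        exact sum_congr rfl fun i _ => sum_comm
    _ ≤ ∑ i ∈ Ico i₀ J, ∑ j ∈ Ico i₀ J, B := by
        refine sum_le_sum fun i hi => sum_le_sum fun j hj => ?_
        exact h₁ D H N (2 ^ i) (2 ^ j) θ a q f u v hD hθ hq hH hHN Nat.one_le_two_pow
          Nat.one_le_two_pow hf hu hv (hpow i hi) (hpow j hj)
    _ = (Ico i₀ J).card * ((Ico i₀ J).card * B) := by simp only [sum_const, nsmul_eq_mul]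
    _ ≤ 2 * D * (2 * D * B) := by gcongr
    _ = _ := by rw [hB]; ring

/-! ### Sums over `m ≤ z` of unweighted exponential sums -/

/-- The outer variable is so short that the loss M^n is affordable: M^n s is O(s^(1/2^n)), and a
2^n-th root gives s^(1/4^n). The lower endpoints u are arbitrary because partial summation will
dictate them. -/
lemma exists_linear_dyadic_le (n : ℕ) (hn : 1 ≤ n) : ∃ c : ℝ, 0 < c ∧
    ∀ (D : ℝ) (H N M : ℕ) (θ : ℝ) (a : ℤ) (q : ℕ) (f : ℤ → ℝ) (u : ℕ → ℕ → ℕ),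
    DivBound D (lvl n N) → IsApprox θ a q → q ≤ lvl n N → 1 ≤ H → H ≤ N → 1 ≤ M →
    IsPhase (n + 1) θ f → sav n q N ≤ 1 →
    (M : ℝ) ≤ 2 * sav n q N ^ (-(2 * (1 / 4 ^ n)) : ℝ) →
    ∑ h ∈ Icc 1 H, ∑ m ∈ Icc M (2 * M),
      ‖∑ x ∈ Ioc (u h m : ℤ) (N / m : ℕ), ex (h * f (m * x))‖ ≤
      c * D ^ (n + 2) * (H * N) * sav n q N ^ (1 / 4 ^ n : ℝ) := by
  obtain ⟨c, hc, h₁⟩ := exists_typeI_le n hn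
  refine ⟨(c * (2 ^ n * (6 + 2 ^ (n + 1)))) ^ (1 / ((2 ^ n : ℕ) : ℝ)), by positivity, ?_⟩
  intro D H N M θ a q f u hD hθ hq hH hHN hM hf hs1 hMs
  have hq1 : (0 : ℝ) < q := by exact_mod_cast hθ.one_le
  have hD1 := hD.one_le
  have hN1 : 1 ≤ N := hH.trans hHN
  have hN' : (1 : ℝ) ≤ N := by exact_mod_cast hN1
  have hM' : (1 : ℝ) ≤ M := by exact_mod_cast hM
  set s := sav n q N with hs
  have hs0 : 0 < s := sav_pos hθ.one_le (by linarith)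
  set T := ∑ h ∈ Icc 1 H, ∑ m ∈ Icc M (2 * M),
      ‖∑ x ∈ Ioc (u h m : ℤ) (N / m : ℕ), ex (h * f (m * x))‖ with hT
  have hT0 : 0 ≤ T := sum_nonneg fun _ _ => sum_nonneg fun _ _ => norm_nonneg _
  rcases lt_or_ge N M with hNM | hMN
  · have : T = 0 := by
      refine sum_eq_zero fun h _ => sum_eq_zero fun m hm => ?_
      have : N / m = 0 := Nat.div_eq_of_lt (by have := mem_Icc.mp hm; omega)
      rw [this, Ioc_eq_empty (by omega), sum_empty, norm_zero]
    rw [this]; positivity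
  set X := N / M with hX
  have hX1 : 1 ≤ X := Nat.div_pos hMN hM
  have hXN : X ≤ N := Nat.div_le_self _ _
  have hX' : (1 : ℝ) ≤ X := by exact_mod_cast hX1
  have hMX : (M : ℝ) * X ≤ N := by exact_mod_cast Nat.mul_div_le N M
  have hMX2 : (N : ℝ) ≤ 2 * (M * X) := by
    have : N < M * X + M := by
      have := Nat.lt_mul_div_succ N hM; rw [Nat.mul_add] at this; simpa using this
    have h2 : M ≤ M * X := Nat.le_mul_of_pos_right _ hX1
    exact_mod_cast (by omega : N ≤ 2 * (M * X))
  have h2 := h₁ D _ H M X θ a q f (fun h m => (u h m : ℤ)) (fun _ m => ((N / m : ℕ) : ℤ)) hD hθ hq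
    hH hM hX1 (lvl_bound₁ hHN hMN hXN) hf (by
      intro h m hm
      have : N / m ≤ N / M := Nat.div_le_div_left hm hM
      omega)
  rw [← hT] at h2
  set κ : ℝ := 1 / 4 ^ n with hκ
  have h2n : (2 : ℝ) ≤ 2 ^ n := by
    calc (2 : ℝ) = 2 ^ 1 := by norm_num
      _ ≤ 2 ^ n := pow_le_pow_right₀ (by norm_num) hn
  have h44 : (4 : ℝ) ^ n = 2 ^ n * 2 ^ n := by rw [← mul_pow]; norm_num
  have hκ4 : κ ≤ 1 / 4 := by
    rw [hκ]
    have : (4 : ℝ) ≤ 4 ^ n := by rw [h44]; nlinarith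
    gcongr
  have hκ0 : 0 < κ := by positivity
  have hsN : 1 / (N : ℝ) ≤ s ^ (2 : ℝ) := by
    have e1 : 1 / √(N : ℝ) ≤ s := by
      rw [hs, sav]
      have : 0 ≤ 1 / (q : ℝ) := by positivity
      have : 0 ≤ q / (N : ℝ) ^ (n + 1) := by positivity
      linarith
    calc 1 / (N : ℝ) = (1 / √(N : ℝ)) ^ 2 := by
          rw [div_pow, Real.sq_sqrt (by linarith)]; norm_num
      _ ≤ s ^ 2 := by gcongr
      _ = s ^ (2 : ℝ) := by norm_cast
  -- X is about N/M, while 1/N ≤ s² and M ≤ 2s^(-2κ) with κ ≤ 1/4.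
  have hXs : 1 / (X : ℝ) ≤ 4 * s := by
    have e1 : 1 / (X : ℝ) ≤ 2 * M * (1 / N) := by
      rw [mul_one_div, div_le_div_iff₀ (by linarith) (by linarith)]; linarith
    calc 1 / (X : ℝ) ≤ 2 * M * (1 / N) := e1
      _ ≤ 2 * (2 * s ^ (-(2 * κ))) * s ^ (2 : ℝ) := by gcongr
      _ = 4 * s ^ (-(2 * κ) + 2) := by rw [Real.rpow_add hs0]; ring
      _ ≤ 4 * s ^ (1 : ℝ) := by
          gcongr 4 * ?_
          exact Real.rpow_le_rpow_of_exponent_ge hs0 hs1 (by linarith)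
      _ = 4 * s := by rw [Real.rpow_one]
  have hQ : 1 / X + 1 / q + q / (M * X : ℝ) ^ (n + 1) ≤ (6 + 2 ^ (n + 1)) * s := by
    have e1 : q / (M * X : ℝ) ^ (n + 1) ≤ 2 ^ (n + 1) * (q / (N : ℝ) ^ (n + 1)) := by
      rw [← mul_div_assoc, div_le_div_iff₀ (by positivity) (by positivity)]
      calc q * (N : ℝ) ^ (n + 1) ≤ q * (2 * (M * X)) ^ (n + 1) := by gcongr
        _ = _ := by rw [mul_pow 2]; ring
    have e2 : 1 / (q : ℝ) ≤ s := by
      rw [hs, sav]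
      have : 0 ≤ 1 / √(N : ℝ) := by positivity
      have : 0 ≤ q / (N : ℝ) ^ (n + 1) := by positivity
      linarith
    have e3 : q / (N : ℝ) ^ (n + 1) ≤ s := by
      rw [hs, sav]
      have : 0 ≤ 1 / √(N : ℝ) := by positivity
      have : 0 ≤ 1 / (q : ℝ) := by positivity
      linarith
    have e4 : 2 ^ (n + 1) * (q / (N : ℝ) ^ (n + 1)) ≤ 2 ^ (n + 1) * s := by gcongr
    linarith
  have hMQ : M ^ n * (1 / X + 1 / q + q / (M * X : ℝ) ^ (n + 1)) ≤
      (2 ^ n * (6 + 2 ^ (n + 1))) * s ^ (1 / 2 ^ n : ℝ) := by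
    calc _ ≤ (2 * s ^ (-(2 * κ))) ^ n * ((6 + 2 ^ (n + 1)) * s) := by gcongr
      _ = (2 ^ n * (6 + 2 ^ (n + 1))) * s ^ (-(2 * κ) * n + 1) := by
          rw [Real.rpow_add hs0, Real.rpow_mul hs0.le, Real.rpow_natCast, Real.rpow_one]; ring
      _ ≤ _ := by
          gcongr (2 ^ n * (6 + 2 ^ (n + 1))) * ?_
          apply Real.rpow_le_rpow_of_exponent_ge hs0 hs1
          have e3 : (2 : ℝ) * n ≤ 2 ^ n := by
            have : n ≤ 2 ^ (n - 1) := by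
              have := Nat.lt_two_pow_self (n := n - 1); omega
            have e : (2 : ℝ) ^ n = 2 * 2 ^ (n - 1) := by rw [← pow_succ']; congr 1; omega
            rw [e]
            have : (n : ℝ) ≤ 2 ^ (n - 1) := by exact_mod_cast this
            linarith
          have e4 : 2 * κ * n ≤ 1 / 2 ^ n := by
            rw [hκ, h44, show 2 * (1 / ((2 : ℝ) ^ n * 2 ^ n)) * n = 2 * n / (2 ^ n * 2 ^ n) by ring,
              div_le_div_iff₀ (by positivity) (by positivity)]
            nlinarith
          have e5 : (1 : ℝ) / 2 ^ n ≤ 1 / 2 := by gcongr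
          linarith
  have h3 : T ^ 2 ^ n ≤ (c * (2 ^ n * (6 + 2 ^ (n + 1)))) * D ^ (n + 2) * (H * N : ℝ) ^ 2 ^ n *
      s ^ (1 / 2 ^ n : ℝ) := by
    calc _ ≤ c * D ^ (n + 2) * (H * M * X : ℝ) ^ (2 ^ n) *
          (M ^ n * (1 / X + 1 / q + q / (M * X : ℝ) ^ (n + 1))) := h2
      _ ≤ c * D ^ (n + 2) * (H * N : ℝ) ^ (2 ^ n) *
          ((2 ^ n * (6 + 2 ^ (n + 1))) * s ^ (1 / 2 ^ n : ℝ)) := by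
          gcongr ?_ * ?_ ^ _ * ?_
          rw [mul_assoc]; gcongr
      _ = _ := by ring
  have h4 := le_of_pow_le Nat.one_le_two_pow hT0 (by positivity) hD1 (by positivity)
    (by positivity) h3
  refine h4.trans (le_of_eq ?_)
  rw [← Real.rpow_mul hs0.le]
  congr 2
  rw [hκ, h44]; push_cast; field_simp

lemma exists_linear_le (n : ℕ) (hn : 1 ≤ n) : ∃ c : ℝ, 0 < c ∧
    ∀ (D : ℝ) (H N i₀ : ℕ) (θ : ℝ) (a : ℤ) (q : ℕ) (f : ℤ → ℝ) (u : ℕ → ℕ → ℕ),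
    DivBound D (lvl n N) → IsApprox θ a q → q ≤ lvl n N → 1 ≤ H → H ≤ N → 2 ^ i₀ ≤ N →
    IsPhase (n + 1) θ f → sav n q N ≤ 1 →
    (2 : ℝ) ^ i₀ ≤ 2 * sav n q N ^ (-(2 * (1 / 4 ^ n)) : ℝ) →
    ∑ h ∈ Icc 1 H, ∑ m ∈ Ioc 0 (2 ^ i₀),
      ‖∑ x ∈ Ioc (u h m : ℤ) (N / m : ℕ), ex (h * f (m * x))‖ ≤
      c * D ^ (n + 3) * (H * N) * sav n q N ^ (1 / 4 ^ n : ℝ) := by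
  obtain ⟨c, hc, h₁⟩ := exists_linear_dyadic_le n hn
  refine ⟨2 * c, by positivity, ?_⟩
  intro D H N i₀ θ a q f u hD hθ hq hH hHN hiN hf hs1 his
  have hD1 := hD.one_le
  have hN' : (0 : ℝ) < N := by exact_mod_cast (by omega : 0 < N)
  have hs0 := sav_pos (n := n) hθ.one_le hN'
  set w : ℕ → ℕ → ℝ := fun h m => ‖∑ x ∈ Ioc (u h m : ℤ) (N / m : ℕ), ex (h * f (m * x))‖ with hw
  set S : ℕ → ℕ → ℝ := fun h l => ∑ m ∈ Icc (2 ^ l) (2 * 2 ^ l), w h m with hS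
  -- The extra `S h 0` accounts for m = 1, which the ranges (2^l, 2^(l+1)] miss.
  have hcover : ∀ i : ℕ, ∀ h, ∑ m ∈ Ioc 0 (2 ^ i), w h m ≤ S h 0 + ∑ l ∈ range i, S h l := by
    intro i h
    induction i with
    | zero =>
      simp only [pow_zero, range_zero, sum_empty, add_zero, hS, mul_one]
      exact sum_le_sum_of_subset_of_nonneg (by intro m; simp; omega) fun _ _ _ => norm_nonneg _
    | succ i ih =>
      rw [sum_range_succ]
      have e : ∑ m ∈ Ioc 0 (2 ^ (i + 1)), w h m =
          ∑ m ∈ Ioc 0 (2 ^ i), w h m + ∑ m ∈ Ioc (2 ^ i) (2 * 2 ^ i), w h m := by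
        rw [pow_succ']
        exact (sum_Ioc_consecutive _ (Nat.zero_le _) (by omega)).symm
      rw [e, ← add_assoc]
      refine add_le_add ih ?_
      exact sum_le_sum_of_subset_of_nonneg Ioc_subset_Icc_self fun _ _ _ => norm_nonneg _
  set B := c * D ^ (n + 2) * (H * N) * sav n q N ^ (1 / 4 ^ n : ℝ) with hB
  have hB0 : 0 ≤ B := by positivity
  have hcard : ((i₀ + 1 : ℕ) : ℝ) ≤ 2 * D := by
    refine le_trans ?_ (natLog_add_one_le hD (le_lvl n N))
    have := Nat.le_log_of_pow_le (by norm_num) hiN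
    exact_mod_cast Nat.succ_le_succ this
  have hSB : ∀ l ≤ i₀, ∑ h ∈ Icc 1 H, S h l ≤ B := by
    intro l hl
    refine h₁ D H N (2 ^ l) θ a q f u hD hθ hq hH hHN Nat.one_le_two_pow hf hs1 ?_
    refine le_trans ?_ his
    push_cast
    exact pow_le_pow_right₀ (by norm_num) hl
  calc _ ≤ ∑ h ∈ Icc 1 H, (S h 0 + ∑ l ∈ range i₀, S h l) := sum_le_sum fun h _ => hcover i₀ h
    _ = ∑ h ∈ Icc 1 H, S h 0 + ∑ l ∈ range i₀, ∑ h ∈ Icc 1 H, S h l := by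
        rw [sum_add_distrib]; congr 1; exact sum_comm
    _ ≤ B + ∑ l ∈ range i₀, B := by
        gcongr with l hl
        · exact hSB 0 (Nat.zero_le _)
        · exact hSB l (mem_range.mp hl).le
    _ = ((i₀ + 1 : ℕ) : ℝ) * B := by rw [sum_const, card_range, nsmul_eq_mul]; push_cast; ring
    _ ≤ 2 * D * B := by gcongr
    _ = _ := by rw [hB]; ring

/-! ### Vaughan's identity -/

/-- The restriction of an arithmetic function to `n ≤ z`. -/
noncomputable def head (F : ArithmeticFunction ℝ) (z : ℕ) : ArithmeticFunction ℝ :=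
  ⟨fun n => if n ≤ z then F n else 0, by simp⟩

/-- The restriction of an arithmetic function to `n > z`. -/
noncomputable def tail (F : ArithmeticFunction ℝ) (z : ℕ) : ArithmeticFunction ℝ :=
  ⟨fun n => if n ≤ z then 0 else F n, by simp⟩

lemma head_apply (F : ArithmeticFunction ℝ) (z n : ℕ) : head F z n = if n ≤ z then F n else 0 := rfl

lemma tail_apply (F : ArithmeticFunction ℝ) (z n : ℕ) : tail F z n = if n ≤ z then 0 else F n := rfl

lemma head_add_tail (F : ArithmeticFunction ℝ) (z : ℕ) : head F z + tail F z = F := by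
  ext n
  rw [ArithmeticFunction.add_apply, head_apply, tail_apply]
  split_ifs <;> simp

/-- In the last term both factors are supported beyond z; in the second and third the coefficients
are supported up to z and z², against a smooth factor log or 1. -/
lemma vaughan_identity (z : ℕ) :
    (ArithmeticFunction.vonMangoldt : ArithmeticFunction ℝ) =
      head ArithmeticFunction.vonMangoldt z +
      head (ArithmeticFunction.moebius : ArithmeticFunction ℝ) z * ArithmeticFunction.log -
      head (ArithmeticFunction.moebius : ArithmeticFunction ℝ) z *
        head ArithmeticFunction.vonMangoldt z * (ArithmeticFunction.zeta : ArithmeticFunction ℝ) +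
      tail (ArithmeticFunction.moebius : ArithmeticFunction ℝ) z *
        (tail ArithmeticFunction.vonMangoldt z *
          (ArithmeticFunction.zeta : ArithmeticFunction ℝ)) := by
  have h1 : (ArithmeticFunction.vonMangoldt : ArithmeticFunction ℝ) *
      (ArithmeticFunction.zeta : ArithmeticFunction ℝ) = ArithmeticFunction.log :=
    ArithmeticFunction.vonMangoldt_mul_zeta
  have h2 : (ArithmeticFunction.moebius : ArithmeticFunction ℝ) *
      (ArithmeticFunction.zeta : ArithmeticFunction ℝ) = 1 :=
    ArithmeticFunction.coe_moebius_mul_coe_zeta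
  have h3 := head_add_tail (ArithmeticFunction.vonMangoldt : ArithmeticFunction ℝ) z
  have h4 := head_add_tail (ArithmeticFunction.moebius : ArithmeticFunction ℝ) z
  rw [← h1]
  set a := head (ArithmeticFunction.vonMangoldt : ArithmeticFunction ℝ) z
  set b := tail (ArithmeticFunction.vonMangoldt : ArithmeticFunction ℝ) z
  set c := head (ArithmeticFunction.moebius : ArithmeticFunction ℝ) z
  set d := tail (ArithmeticFunction.moebius : ArithmeticFunction ℝ) z
  rw [← h3]
  rw [← h4] at h2
  -- With log = Λ * 1 inserted, all that is left is the relation μ * 1 = 1 multiplied by the tail of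
  -- Λ.
  linear_combination -b * h2

/-- A sum over the points `m n ≤ N` below a hyperbola. -/
noncomputable def hypSum (N : ℕ) (F G : ℕ → ℝ) (E : ℕ → ℂ) (S T : Finset ℕ) : ℂ :=
  ∑ m ∈ S, ∑ n ∈ T, if m * n ≤ N then (F m : ℂ) * (G n : ℂ) * E (m * n) else 0

lemma sum_mul_eq_hypSum (N : ℕ) (F G : ArithmeticFunction ℝ) (E : ℕ → ℂ) :
    ∑ n ∈ Ioc 0 N, (((F * G) n : ℝ) : ℂ) * E n = hypSum N F G E (Ioc 0 N) (Ioc 0 N) := by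
  simp only [ArithmeticFunction.mul_apply]
  trans ∑ n ∈ Ioc 0 N, ∑ x ∈ (Ioc 0 N ×ˢ Ioc 0 N).filter (fun x => x.1 * x.2 = n),
      (F x.1 : ℂ) * (G x.2 : ℂ) * E (x.1 * x.2)
  · refine sum_congr rfl fun n hn => ?_
    simp only [mem_Ioc] at hn
    rw [Nat.divisorsAntidiagonal_eq_prod_filter_of_le hn.1.ne' hn.2, Complex.ofReal_sum, sum_mul]
    refine sum_congr rfl fun x hx => ?_
    rw [(mem_filter.mp hx).2]; push_cast; ring
  · rw [hypSum, ← sum_product']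
    simp_rw [sum_filter]
    rw [sum_comm]
    exact sum_congr rfl fun _ _ => (by simp_all)

lemma inner_hyp_sum {N m : ℕ} (hm : 1 ≤ m) (F : ℕ → ℂ) :
    ∑ n ∈ Ioc 0 N, (if m * n ≤ N then F n else 0) = ∑ n ∈ Ioc 0 (N / m), F n := by
  rw [← sum_filter]
  refine sum_congr ?_ fun _ _ => rfl
  ext n
  have h := Nat.le_div_iff_mul_le (x := n) (y := N) hm
  rw [mul_comm] at h
  simp only [mem_filter, mem_Ioc, h]
  constructor
  · rintro ⟨⟨h1, _⟩, h2⟩; exact ⟨h1, h2⟩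
  · rintro ⟨h1, h2⟩
    exact ⟨⟨h1, le_trans (Nat.le_mul_of_pos_left _ hm) h2⟩, h2⟩

/-- Partial summation: log n is the sum of log(i+1) - log i over 1 ≤ i < n, so the left side is a
nonnegative combination, of total weight log X, of tails of the unweighted sum. The index of the
largest tail serves as j. -/
lemma log_sum_abel (E : ℕ → ℂ) (X : ℕ) : ∃ j : ℕ,
    ‖∑ n ∈ Ioc 0 X, (Real.log n : ℂ) * E n‖ ≤ Real.log X * ‖∑ n ∈ Ioc j X, E n‖ := by
  obtain ⟨j, _, hj⟩ := exists_max_image (range (X + 1)) (fun j => ‖∑ n ∈ Ioc j X, E n‖) ⟨0, by simp⟩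
  refine ⟨j, ?_⟩
  set B := ‖∑ n ∈ Ioc j X, E n‖ with hB
  have hlog : ∀ n : ℕ, 1 ≤ n → ∑ i ∈ Ico 1 n, (Real.log ((i + 1 : ℕ) : ℝ) - Real.log i) = Real.log n := by
    intro n hn
    rw [sum_Ico_sub (fun i : ℕ => Real.log (i : ℝ)) hn]
    simp
  have h1 : ∑ n ∈ Ioc 0 X, (Real.log n : ℂ) * E n =
      ∑ i ∈ Ico 1 X, ((Real.log ((i + 1 : ℕ) : ℝ) - Real.log i : ℝ) : ℂ) * ∑ n ∈ Ioc i X, E n := by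
    simp only [mul_sum]
    rw [sum_comm' (t' := Ioc 0 X) (s' := fun n => Ico 1 n)]
    · refine sum_congr rfl fun n hn => ?_
      rw [← sum_mul, ← Complex.ofReal_sum, hlog n (mem_Ioc.mp hn).1]
    · intro i n
      simp only [mem_Ico, mem_Ioc]; omega
  rw [h1]
  rcases Nat.eq_zero_or_pos X with rfl | hX
  · simp
  rw [← hlog X hX, sum_mul]
  refine (norm_sum_le _ _).trans (sum_le_sum fun i hi => ?_)
  have hi := mem_Ico.mp hi
  rw [norm_mul, Complex.norm_real, Real.norm_of_nonneg]
  · have : 0 ≤ Real.log ((i + 1 : ℕ) : ℝ) - Real.log i := by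
      rw [sub_nonneg]
      apply Real.log_le_log (by exact_mod_cast hi.1)
      push_cast; linarith
    gcongr
    exact hj i (mem_range.mpr (by omega))
  · rw [sub_nonneg]
    apply Real.log_le_log (by exact_mod_cast hi.1)
    push_cast; linarith

/-! ### Exponential sums over primes -/

lemma abs_moebius_cast_le (n : ℕ) : |((ArithmeticFunction.moebius : ArithmeticFunction ℝ)) n| ≤ 1 := by
  rw [ArithmeticFunction.intCoe_apply]
  exact_mod_cast ArithmeticFunction.abs_moebius_le_one (n := n)

lemma abs_head_le (F : ArithmeticFunction ℝ) (z n : ℕ) : |head F z n| ≤ |F n| := by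
  rw [head_apply]; split_ifs <;> simp

lemma abs_tail_le (F : ArithmeticFunction ℝ) (z n : ℕ) : |tail F z n| ≤ |F n| := by
  rw [tail_apply]; split_ifs <;> simp

/-- Comparison with 1 * Λ = log bounds the Vaughan coefficients by a logarithm. -/
lemma abs_mul_le_log {F G : ArithmeticFunction ℝ} (hF : ∀ n, |F n| ≤ 1)
    (hG : ∀ n, |G n| ≤ ArithmeticFunction.vonMangoldt n) (n : ℕ) : |(F * G) n| ≤ Real.log n := by
  rw [ArithmeticFunction.mul_apply, ← ArithmeticFunction.vonMangoldt_sum]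
  refine (abs_sum_le_sum_abs _ _).trans ?_
  rw [← Nat.sum_divisorsAntidiagonal' fun _ j => (ArithmeticFunction.vonMangoldt j : ℝ)]
  refine sum_le_sum fun x _ => ?_
  rw [abs_mul]
  calc _ ≤ 1 * ArithmeticFunction.vonMangoldt x.2 :=
        mul_le_mul (hF _) (hG _) (abs_nonneg _) zero_le_one
    _ = _ := by simp

lemma zeta_cast_le (n : ℕ) : |((ArithmeticFunction.zeta : ArithmeticFunction ℝ)) n| ≤ 1 := by
  rw [ArithmeticFunction.natCoe_apply, ArithmeticFunction.zeta_apply]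
  split_ifs <;> simp

lemma zeta_cast_of_pos {n : ℕ} (hn : 1 ≤ n) :
    ((ArithmeticFunction.zeta : ArithmeticFunction ℝ)) n = 1 := by
  rw [ArithmeticFunction.natCoe_apply, ArithmeticFunction.zeta_apply_ne (by omega), Nat.cast_one]

lemma abs_vonMangoldt (n : ℕ) :
    |ArithmeticFunction.vonMangoldt n| = ArithmeticFunction.vonMangoldt n :=
  abs_of_nonneg ArithmeticFunction.vonMangoldt_nonneg

lemma tail_mul_eq_zero {F G : ArithmeticFunction ℝ} {z n : ℕ} (hn : n ≤ z) : (tail F z * G) n = 0 := by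
  rw [ArithmeticFunction.mul_apply]
  refine sum_eq_zero fun x hx => ?_
  have h := Nat.mem_divisorsAntidiagonal.mp hx
  have : x.1 ≤ z := (Nat.le_of_dvd (Nat.pos_of_ne_zero h.2) (Dvd.intro _ h.1)).trans hn
  rw [tail_apply, if_pos this, zero_mul]

lemma head_mul_head_eq_zero {F G : ArithmeticFunction ℝ} {z n : ℕ} (hn : z * z < n) :
    (head F z * head G z) n = 0 := by
  rw [ArithmeticFunction.mul_apply]
  refine sum_eq_zero fun x hx => ?_
  have h := Nat.mem_divisorsAntidiagonal.mp hx
  rw [head_apply, head_apply]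
  split_ifs with h1 h2
  · have := Nat.mul_le_mul h1 h2; omega
  all_goals simp

lemma norm_hypSum_small_le (f : ℤ → ℝ) (h N z : ℕ) {F : ℕ → ℝ} {B : ℝ} (hF : ∀ m ≤ z, |F m| ≤ B)
    (G : ℕ → ℝ) (w : ℕ → ℝ)
    (hG : ∀ m, 1 ≤ m → m ≤ z → ‖∑ n ∈ Ioc 0 (N / m), (G n : ℂ) * ex (h * f ((m * n : ℕ) : ℤ))‖ ≤ w m) :
    ‖hypSum N F G (fun n => ex (h * f (n : ℤ))) (Ioc 0 z) (Ioc 0 N)‖ ≤ B * ∑ m ∈ Ioc 0 z, w m := by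
  rw [hypSum, mul_sum]
  refine (norm_sum_le _ _).trans (sum_le_sum fun m hm => ?_)
  have hm := mem_Ioc.mp hm
  rw [inner_hyp_sum hm.1 (fun n => (F m : ℂ) * (G n : ℂ) * ex (h * f ((m * n : ℕ) : ℤ)))]
  simp only [mul_assoc]
  rw [← mul_sum, norm_mul, Complex.norm_real, Real.norm_eq_abs]
  exact mul_le_mul (hF m hm.2) (hG m hm.1 hm.2) (norm_nonneg _)
    ((abs_nonneg _).trans (hF m hm.2))

lemma hypSum_union (N : ℕ) (F G : ℕ → ℝ) (E : ℕ → ℂ) {z : ℕ} (hz : z ≤ N) (T : Finset ℕ) :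
    hypSum N F G E (Ioc 0 N) T = hypSum N F G E (Ioc 0 z) T + hypSum N F G E (Ioc z N) T :=
  (sum_Ioc_consecutive _ (Nat.zero_le _) hz).symm

lemma hypSum_union_right (N : ℕ) (F G : ℕ → ℝ) (E : ℕ → ℂ) {z : ℕ} (hz : z ≤ N) (S : Finset ℕ) :
    hypSum N F G E S (Ioc 0 N) = hypSum N F G E S (Ioc 0 z) + hypSum N F G E S (Ioc z N) := by
  simp only [hypSum]
  rw [← sum_add_distrib]
  exact sum_congr rfl fun m _ => (sum_Ioc_consecutive _ (Nat.zero_le _) hz).symm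

lemma exists_hypSum_large_le (n : ℕ) (hn : 1 ≤ n) : ∃ c : ℝ, 0 < c ∧
    ∀ (D : ℝ) (H N i₀ : ℕ) (θ : ℝ) (a : ℤ) (q : ℕ) (f : ℤ → ℝ) (F G : ℕ → ℝ),
    DivBound D (lvl n N) → IsApprox θ a q → q ≤ lvl n N → 1 ≤ H → H ≤ N →
    IsPhase (n + 1) θ f → (∀ m ≤ N, |F m| ≤ D) → (∀ m ≤ N, |G m| ≤ D) →
    1 / (2 : ℝ) ^ i₀ ≤ sav n q N ^ (2 * (1 / 4 ^ n) : ℝ) →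
    ∑ h ∈ Icc 1 H, ‖hypSum N F G (fun n => ex (h * f (n : ℤ))) (Ioc (2 ^ i₀) N) (Ioc (2 ^ i₀) N)‖ ≤
      c * D ^ (2 * n + 9) * (H * N) * sav n q N ^ (1 / 4 ^ n : ℝ) := by
  obtain ⟨c, hc, h₁⟩ := exists_bilinear_le n hn
  refine ⟨c, hc, ?_⟩
  intro D H N i₀ θ a q f F G hD hθ hq hH hHN hf hF hG hs
  have hD1 := hD.one_le
  have hb : ∀ F : ℕ → ℝ, (∀ m ≤ N, |F m| ≤ D) →
      ∀ m, ‖(if m ≤ N then (F m : ℂ) else 0)‖ ≤ D := by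
    intro F hF m
    split_ifs with hm
    · rw [Complex.norm_real]; exact hF m hm
    · rw [norm_zero]; linarith
  refine le_trans (le_of_eq ?_) (h₁ D H N i₀ θ a q f (fun m => if m ≤ N then (F m : ℂ) else 0)
    (fun m => if m ≤ N then (G m : ℂ) else 0) hD hθ hq hH hHN hf (hb F hF) (hb G hG) hs)
  refine sum_congr rfl fun h _ => ?_
  congr 1
  rw [hypSum]
  refine sum_congr rfl fun m hm => sum_congr rfl fun r hr => ?_
  rw [if_pos (mem_Ioc.mp hm).2, if_pos (mem_Ioc.mp hr).2]
  push_cast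
  rfl

lemma sum_head_vonMangoldt_le {D : ℝ} {N z : ℕ} (hz : z ≤ N)
    (hlog : ∀ m ≤ N, Real.log m ≤ D) (E : ℕ → ℂ) (hE : ∀ n, ‖E n‖ = 1) :
    ‖∑ n ∈ Ioc 0 N, ((head ArithmeticFunction.vonMangoldt z n : ℝ) : ℂ) * E n‖ ≤ D * z := by
  have h1 : ∑ n ∈ Ioc 0 N, ((head ArithmeticFunction.vonMangoldt z n : ℝ) : ℂ) * E n =
      ∑ n ∈ Ioc 0 z, ((head ArithmeticFunction.vonMangoldt z n : ℝ) : ℂ) * E n := by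
    symm
    refine sum_subset (Ioc_subset_Ioc_right hz) fun n hn hn' => ?_
    simp only [mem_Ioc] at hn hn'
    rw [head_apply, if_neg (by omega)]; simp
  rw [h1]
  calc _ ≤ ∑ n ∈ Ioc 0 z, D := by
        refine (norm_sum_le _ _).trans (sum_le_sum fun n hn => ?_)
        have hn := mem_Ioc.mp hn
        rw [norm_mul, hE, mul_one, Complex.norm_real, Real.norm_eq_abs]
        refine (abs_head_le _ _ _).trans ?_
        rw [abs_vonMangoldt]
        exact ArithmeticFunction.vonMangoldt_le_log.trans (hlog n (hn.2.trans hz))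
    _ = _ := by simp [mul_comm]

/-- The coefficients vanish beyond z², so at most z³ points remain. Disposing of this corner
trivially lets z < m ≤ z² be treated as bilinear, and the linear sums stop at m ≤ z. -/
lemma norm_hypSum_corner_le {D : ℝ} {N z : ℕ} {F G : ℕ → ℝ} (hD0 : 0 ≤ D)
    (hF : ∀ m ≤ N, |F m| ≤ D) (hF0 : ∀ m, z * z < m → F m = 0) (hG : ∀ m, |G m| ≤ 1)
    (E : ℕ → ℂ) (hE : ∀ n, ‖E n‖ = 1) :
    ‖hypSum N F G E (Ioc z N) (Ioc 0 z)‖ ≤ D * z ^ 3 := by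
  rw [hypSum]
  calc _ ≤ ∑ m ∈ Ioc z N, ∑ n ∈ Ioc 0 z, if m ≤ z * z then D else 0 := by
        refine (norm_sum_le _ _).trans (sum_le_sum fun m hm => ?_)
        refine (norm_sum_le _ _).trans (sum_le_sum fun r _ => ?_)
        have hm := mem_Ioc.mp hm
        by_cases hz : m ≤ z * z
        · rw [if_pos hz]
          split_ifs
          · rw [norm_mul, norm_mul, hE, mul_one, Complex.norm_real, Complex.norm_real]
            calc _ ≤ D * 1 := mul_le_mul (hF m hm.2) (hG r) (abs_nonneg _) hD0
              _ = D := mul_one D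
          · rw [norm_zero]; exact hD0
        · rw [hF0 m (by omega)]; simp [hz]
    _ = z * ∑ m ∈ Ioc z N, if m ≤ z * z then D else 0 := by
        rw [mul_sum]
        refine sum_congr rfl fun m _ => ?_
        simp
    _ ≤ z * ((z * z : ℕ) * D) := by
        gcongr
        rw [← sum_filter, sum_const, nsmul_eq_mul]
        gcongr
        calc _ ≤ (Icc 1 (z * z)).card := card_le_card fun m hm => by
              simp only [mem_filter, mem_Ioc, mem_Icc] at *; omega
          _ = z * z := by simp
    _ = _ := by push_cast; ring

/-- The coefficients of the linear sums in Vaughan's identity. -/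
noncomputable def headConv (z : ℕ) : ArithmeticFunction ℝ :=
  head (ArithmeticFunction.moebius : ArithmeticFunction ℝ) z * head ArithmeticFunction.vonMangoldt z

/-- The coefficients of the bilinear sums in Vaughan's identity. -/
noncomputable def tailConv (z : ℕ) : ArithmeticFunction ℝ :=
  tail ArithmeticFunction.vonMangoldt z * (ArithmeticFunction.zeta : ArithmeticFunction ℝ)

lemma abs_headConv_le (z m : ℕ) : |headConv z m| ≤ Real.log m := abs_mul_le_log
    (fun m => (abs_head_le _ _ _).trans (abs_moebius_cast_le m))
    (fun m => (abs_head_le _ _ _).trans (abs_vonMangoldt m).le) m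

lemma abs_tailConv_le (z m : ℕ) : |tailConv z m| ≤ Real.log m := by
  rw [tailConv, mul_comm]
  exact abs_mul_le_log zeta_cast_le
    (fun m => (abs_tail_le _ _ _).trans (abs_vonMangoldt m).le) m

lemma vonMangoldt_sum_eq (N z : ℕ) (E : ℕ → ℂ) :
    ∑ m ∈ Ioc 0 N, (ArithmeticFunction.vonMangoldt m : ℂ) * E m =
      ∑ m ∈ Ioc 0 N, ((head ArithmeticFunction.vonMangoldt z m : ℝ) : ℂ) * E m +
      hypSum N (head (ArithmeticFunction.moebius : ArithmeticFunction ℝ) z)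
        ArithmeticFunction.log E (Ioc 0 N) (Ioc 0 N) -
      hypSum N (headConv z) (ArithmeticFunction.zeta : ArithmeticFunction ℝ) E (Ioc 0 N) (Ioc 0 N) +
      hypSum N (tail (ArithmeticFunction.moebius : ArithmeticFunction ℝ) z) (tailConv z) E
        (Ioc 0 N) (Ioc 0 N) := by
  rw [← sum_mul_eq_hypSum, ← sum_mul_eq_hypSum, ← sum_mul_eq_hypSum, ← sum_add_distrib,
    ← sum_sub_distrib, ← sum_add_distrib]
  refine sum_congr rfl fun m _ => ?_
  conv_lhs => rw [vaughan_identity z]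
  rw [ArithmeticFunction.add_apply, sub_eq_add_neg, ArithmeticFunction.add_apply,
    ArithmeticFunction.add_apply, ArithmeticFunction.neg_apply, headConv, tailConv]
  push_cast; ring

lemma norm_vonMangoldt_sum_le {D : ℝ} {N z : ℕ} (hz : z ≤ N) (hD1 : 1 ≤ D)
    (hlog : ∀ m ≤ N, Real.log m ≤ D) (f : ℤ → ℝ) (h : ℕ) : ∃ j : ℕ → ℕ,
    ‖∑ m ∈ Ioc 0 N, (ArithmeticFunction.vonMangoldt m : ℂ) * ex (h * f (m : ℤ))‖ ≤
      D * z + 1 * ∑ m ∈ Ioc 0 z, D * ‖∑ x ∈ Ioc (j m : ℤ) (N / m : ℕ), ex (h * f (m * x))‖ +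
      (D * ∑ m ∈ Ioc 0 z, ‖∑ x ∈ Ioc ((0 : ℕ) : ℤ) (N / m : ℕ), ex (h * f (m * x))‖ + (D * z ^ 3 +
        ‖hypSum N (headConv z) (ArithmeticFunction.zeta : ArithmeticFunction ℝ)
          (fun m => ex (h * f (m : ℤ))) (Ioc z N) (Ioc z N)‖)) +
      ‖hypSum N (tail (ArithmeticFunction.moebius : ArithmeticFunction ℝ) z) (tailConv z)
        (fun m => ex (h * f (m : ℤ))) (Ioc z N) (Ioc z N)‖ := by
  choose j hj using fun m : ℕ => log_sum_abel (fun r => ex (h * f ((m * r : ℕ) : ℤ))) (N / m)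
  refine ⟨j, ?_⟩
  have hE1 : ∀ m : ℕ, ‖ex (h * f (m : ℤ))‖ = 1 := fun _ => norm_ex _
  have hcast : ∀ m k : ℕ, ∑ r ∈ Ioc k (N / m), ex (h * f ((m * r : ℕ) : ℤ)) =
      ∑ x ∈ Ioc (k : ℤ) (N / m : ℕ), ex (h * f (m * x)) := by
    intro m k
    rw [← sum_Ioc_natCast (fun x : ℤ => ex (h * f (m * x)))]
    refine sum_congr rfl fun r _ => ?_
    push_cast; rfl
  set μ : ArithmeticFunction ℝ := (ArithmeticFunction.moebius : ArithmeticFunction ℝ)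
  set ζ : ArithmeticFunction ℝ := (ArithmeticFunction.zeta : ArithmeticFunction ℝ) with hζ
  set E : ℕ → ℂ := fun m => ex (h * f (m : ℤ)) with hE
  have e1 : hypSum N (head μ z) ArithmeticFunction.log E (Ioc 0 N) (Ioc 0 N) =
      hypSum N (head μ z) ArithmeticFunction.log E (Ioc 0 z) (Ioc 0 N) := by
    rw [hypSum_union _ _ _ _ hz, add_eq_left]
    refine sum_eq_zero fun m hm => sum_eq_zero fun r _ => ?_
    rw [head_apply, if_neg (not_le.mpr (mem_Ioc.mp hm).1)]; simp
  have e2 : hypSum N (tail μ z) (tailConv z) E (Ioc 0 N) (Ioc 0 N) =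
      hypSum N (tail μ z) (tailConv z) E (Ioc z N) (Ioc z N) := by
    rw [hypSum_union _ _ _ _ hz, hypSum_union_right _ _ _ _ hz (Ioc z N)]
    have e3 : hypSum N (tail μ z) (tailConv z) E (Ioc 0 z) (Ioc 0 N) = 0 := by
      refine sum_eq_zero fun m hm => sum_eq_zero fun r _ => ?_
      rw [tail_apply, if_pos (mem_Ioc.mp hm).2]; simp
    have e4 : hypSum N (tail μ z) (tailConv z) E (Ioc z N) (Ioc 0 z) = 0 := by
      refine sum_eq_zero fun m _ => sum_eq_zero fun r hr => ?_
      rw [tailConv, tail_mul_eq_zero (mem_Ioc.mp hr).2]; simp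
    rw [e3, e4, zero_add, zero_add]
  have e5 : hypSum N (headConv z) ζ E (Ioc 0 N) (Ioc 0 N) =
      hypSum N (headConv z) ζ E (Ioc 0 z) (Ioc 0 N) +
      (hypSum N (headConv z) ζ E (Ioc z N) (Ioc 0 z) +
      hypSum N (headConv z) ζ E (Ioc z N) (Ioc z N)) := by
    rw [hypSum_union _ _ _ _ hz, hypSum_union_right _ _ _ _ hz (Ioc z N)]
  have hc : ∀ m ≤ N, |headConv z m| ≤ D := fun m hm => (abs_headConv_le z m).trans (hlog m hm)
  rw [vonMangoldt_sum_eq N z, e1, e2, e5]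
  refine (norm_add_le _ _).trans (add_le_add ((norm_sub_le _ _).trans (add_le_add
    ((norm_add_le _ _).trans (add_le_add ?_ ?_)) ((norm_add_le _ _).trans (add_le_add ?_
    ((norm_add_le _ _).trans (add_le_add ?_ le_rfl)))))) le_rfl)
  · exact sum_head_vonMangoldt_le hz hlog _ hE1
  · refine norm_hypSum_small_le f h N z (fun m _ => (abs_head_le _ _ _).trans
      (abs_moebius_cast_le m)) _ _ fun m hm hmz => ?_
    refine (hj m).trans ?_
    rw [hcast]
    have : Real.log (N / m : ℕ) ≤ D := hlog _ (Nat.div_le_self _ _)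
    gcongr
  · refine norm_hypSum_small_le f h N z (fun m hm => hc m (hm.trans hz)) _ _ fun m hm hmz => ?_
    have : ∑ r ∈ Ioc 0 (N / m), (ζ r : ℂ) * ex (h * f ((m * r : ℕ) : ℤ)) =
        ∑ r ∈ Ioc 0 (N / m), ex (h * f ((m * r : ℕ) : ℤ)) := by
      refine sum_congr rfl fun r hr => ?_
      rw [hζ, zeta_cast_of_pos (mem_Ioc.mp hr).1, Complex.ofReal_one, one_mul]
    rw [this, hcast]
  · exact norm_hypSum_corner_le (by linarith) hc
      (fun m hm => head_mul_head_eq_zero hm) zeta_cast_le _ hE1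

/-- Weyl sums with the von Mangoldt weight, averaged over `h`. -/
lemma exists_vonMangoldt_sum_le (n : ℕ) (hn : 1 ≤ n) : ∃ c : ℝ, 0 < c ∧
    ∀ (D : ℝ) (H N : ℕ) (θ : ℝ) (a : ℤ) (q : ℕ) (f : ℤ → ℝ),
    DivBound D (lvl n N) → IsApprox θ a q → q ≤ lvl n N → 1 ≤ H → H ≤ N →
    IsPhase (n + 1) θ f → sav n q N ≤ 1 →
    ∑ h ∈ Icc 1 H, ‖∑ m ∈ Ioc 0 N, (ArithmeticFunction.vonMangoldt m : ℂ) * ex (h * f m)‖ ≤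
      c * D ^ (2 * n + 10) * (H * N) * sav n q N ^ (1 / 4 ^ n : ℝ) := by
  obtain ⟨c₁, hc₁, h₁⟩ := exists_hypSum_large_le n hn
  obtain ⟨c₂, hc₂, h₂⟩ := exists_linear_le n hn
  refine ⟨2 * c₁ + 2 * c₂ + 16, by positivity, ?_⟩
  intro D H N θ a q f hD hθ hq hH hHN hf hs1
  have hD1 := hD.one_le
  have hN1 : 1 ≤ N := hH.trans hHN
  have hN' : (1 : ℝ) ≤ N := by exact_mod_cast hN1
  have hq1 : (0 : ℝ) < q := by exact_mod_cast hθ.one_le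
  set s := sav n q N with hs
  have hs0 : 0 < s := sav_pos hθ.one_le (by linarith)
  set κ : ℝ := 1 / 4 ^ n with hκ
  have hκ0 : 0 < κ := by positivity
  have hκ4 : κ ≤ 1 / 4 := by
    rw [hκ]
    have : (4 : ℝ) ≤ 4 ^ n := by
      calc (4 : ℝ) = 4 ^ 1 := by norm_num
        _ ≤ 4 ^ n := pow_le_pow_right₀ (by norm_num) hn
    gcongr
  have hY : 1 ≤ s ^ (-(2 * κ)) := Real.one_le_rpow_of_pos_of_le_one_of_nonpos hs0 hs1 (by linarith)
  -- The cut z = 2^(i+1) lies in (s^(-2κ), 2s^(-2κ)]: large enough for the diagonal in the bilinear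
  -- sums, small enough for the linear sums.
  obtain ⟨i, hi1, hi2⟩ := exists_nat_pow_near hY (one_lt_two : (1 : ℝ) < 2)
  set i₀ := i + 1 with hi₀
  set z : ℕ := 2 ^ i₀ with hz
  have hzr : (z : ℝ) = 2 ^ i₀ := by rw [hz]; push_cast; rfl
  have hz1 : 1 ≤ z := Nat.one_le_two_pow
  have hz2 : (2 : ℝ) ^ i₀ ≤ 2 * s ^ (-(2 * κ)) := by rw [hi₀, pow_succ]; linarith
  have hz3 : 1 / (2 : ℝ) ^ i₀ ≤ s ^ (2 * κ) := by
    rw [Real.rpow_neg hs0.le] at hi2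
    rw [one_div]
    exact inv_le_of_inv_le₀ (by positivity) hi2.le
  -- From s ≥ N^(-1/2) one gets 1 ≤ N s², and then z³ ≤ 8s^(-6κ) ≤ 8s^(κ-2) ≤ 8N s^κ since 7κ ≤ 2.
  have hzN : (z : ℝ) ^ 3 ≤ 8 * (N * s ^ κ) := by
    have e1 : 1 / (N : ℝ) ≤ s ^ (2 : ℝ) := by
      have e1 : 1 / √(N : ℝ) ≤ s := by
        rw [hs, sav]
        have : 0 ≤ 1 / (q : ℝ) := by positivity
        have : 0 ≤ q / (N : ℝ) ^ (n + 1) := by positivity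
        linarith
      calc 1 / (N : ℝ) = (1 / √(N : ℝ)) ^ 2 := by
            rw [div_pow, Real.sq_sqrt (by linarith)]; norm_num
        _ ≤ s ^ 2 := by gcongr
        _ = s ^ (2 : ℝ) := by norm_cast
    have e2 : 1 ≤ N * s ^ (2 : ℝ) := by
      rw [div_le_iff₀ (by linarith)] at e1; linarith
    calc (z : ℝ) ^ 3 ≤ (2 * s ^ (-(2 * κ))) ^ 3 := by rw [hzr]; gcongr
      _ = 8 * s ^ (-(2 * κ) * 3) := by
          rw [mul_pow, Real.rpow_mul hs0.le]; norm_num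
      _ ≤ 8 * s ^ (κ - 2) := by
          gcongr 8 * ?_
          apply Real.rpow_le_rpow_of_exponent_ge hs0 hs1
          linarith
      _ = 8 * (1 * s ^ (κ - 2)) := by ring
      _ ≤ 8 * (N * s ^ (2 : ℝ) * s ^ (κ - 2)) := by gcongr
      _ = 8 * (N * s ^ κ) := by rw [mul_assoc, ← Real.rpow_add hs0]; congr 3; ring
  have hlog : ∀ m ≤ N, Real.log m ≤ D := by
    intro m hm
    rcases Nat.eq_zero_or_pos m with rfl | hm0
    · simp; linarith
    have : Real.log m ≤ Real.log (lvl n N) :=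
      Real.log_le_log (by exact_mod_cast hm0) (by exact_mod_cast hm.trans (le_lvl n N))
    linarith [hD.log_le]
  set E : ℕ → ℕ → ℂ := fun h m => ex (h * f (m : ℤ)) with hE
  set Z : ℝ := H * N * s ^ κ with hZ
  have hZ0 : 0 ≤ Z := by positivity
  have hpow : ∀ e ≤ 2 * n + 10, D ^ e ≤ D ^ (2 * n + 10) := fun e he => pow_le_pow_right₀ hD1 he
  suffices hmain : ∑ h ∈ Icc 1 H, ‖∑ m ∈ Ioc 0 N, (ArithmeticFunction.vonMangoldt m : ℂ) * E h m‖ ≤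
      (2 * c₁ + 2 * c₂ + 16) * D ^ (2 * n + 10) * Z by
    refine hmain.trans (le_of_eq ?_); rw [hZ]; ring
  rcases lt_or_ge N z with hNz | hzN'
  · have e1 : (N : ℝ) ≤ 8 * (N * s ^ κ) := by
      refine le_trans ?_ hzN
      calc (N : ℝ) ≤ z := by exact_mod_cast hNz.le
        _ ≤ (z : ℝ) ^ 3 := le_self_pow₀ (by exact_mod_cast hz1) (by norm_num)
    calc _ ≤ ∑ h ∈ Icc 1 H, ∑ m ∈ Ioc 0 N, D := by
          refine sum_le_sum fun h _ => (norm_sum_le _ _).trans (sum_le_sum fun m hm => ?_)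
          rw [norm_mul, norm_ex, mul_one, Complex.norm_real, Real.norm_eq_abs, abs_vonMangoldt]
          exact ArithmeticFunction.vonMangoldt_le_log.trans (hlog m (mem_Ioc.mp hm).2)
      _ = H * D ^ 1 * N := by simp; ring
      _ ≤ H * D ^ (2 * n + 10) * (8 * (N * s ^ κ)) := by
          gcongr
          omega
      _ = 8 * D ^ (2 * n + 10) * Z := by rw [hZ]; ring
      _ ≤ _ := by gcongr; linarith
  set μ : ArithmeticFunction ℝ := (ArithmeticFunction.moebius : ArithmeticFunction ℝ) with hμ
  set ζ : ArithmeticFunction ℝ := (ArithmeticFunction.zeta : ArithmeticFunction ℝ) with hζ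
  have hc : ∀ m ≤ N, |headConv z m| ≤ D := fun m hm => (abs_headConv_le z m).trans (hlog m hm)
  have hb : ∀ m ≤ N, |tailConv z m| ≤ D := fun m hm => (abs_tailConv_le z m).trans (hlog m hm)
  have hμ1 : ∀ m, |tail μ z m| ≤ 1 := fun m => (abs_tail_le _ _ _).trans (abs_moebius_cast_le m)
  choose j key using norm_vonMangoldt_sum_le hzN' hD1 hlog f
  set w₁ : ℕ → ℕ → ℝ := fun h m => ‖∑ x ∈ Ioc (j h m : ℤ) (N / m : ℕ), ex (h * f (m * x))‖ with hw₁
  set w₂ : ℕ → ℕ → ℝ := fun h m => ‖∑ x ∈ Ioc ((0 : ℕ) : ℤ) (N / m : ℕ), ex (h * f (m * x))‖ with hw₂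
  have t1 := h₂ D H N i₀ θ a q f j hD hθ hq hH hHN hzN' hf hs1 hz2
  have t2 := h₂ D H N i₀ θ a q f (fun _ _ => 0) hD hθ hq hH hHN hzN' hf hs1 hz2
  have t3 := h₁ D H N i₀ θ a q f (headConv z) ζ hD hθ hq hH hHN hf hc
    (fun m _ => (zeta_cast_le m).trans hD1) hz3
  have t4 := h₁ D H N i₀ θ a q f (tail μ z) (tailConv z) hD hθ hq hH hHN hf
    (fun m _ => (hμ1 m).trans hD1) hb hz3
  have e1 : (D * z : ℝ) ≤ 8 * D * (N * s ^ κ) := by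
    have : (z : ℝ) ≤ (z : ℝ) ^ 3 := le_self_pow₀ (by exact_mod_cast hz1) (by norm_num)
    calc D * (z : ℝ) ≤ D * (8 * (N * s ^ κ)) := by gcongr; linarith
      _ = _ := by ring
  have e2 : D * (z : ℝ) ^ 3 ≤ 8 * D * (N * s ^ κ) := by
    calc D * (z : ℝ) ^ 3 ≤ D * (8 * (N * s ^ κ)) := by gcongr
      _ = _ := by ring
  calc _ ≤ ∑ h ∈ Icc 1 H, (8 * D * (N * s ^ κ) + 1 * ∑ m ∈ Ioc 0 z, D * w₁ h m +
      (D * ∑ m ∈ Ioc 0 z, w₂ h m + (8 * D * (N * s ^ κ) +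
        ‖hypSum N (headConv z) ζ (E h) (Ioc z N) (Ioc z N)‖)) +
      ‖hypSum N (tail μ z) (tailConv z) (E h) (Ioc z N) (Ioc z N)‖) := by
        refine sum_le_sum fun h _ => (key h).trans ?_
        gcongr
    _ = 16 * D ^ 1 * Z + D * ∑ h ∈ Icc 1 H, ∑ m ∈ Ioc 0 z, w₁ h m +
        D * ∑ h ∈ Icc 1 H, ∑ m ∈ Ioc 0 z, w₂ h m +
        ∑ h ∈ Icc 1 H, ‖hypSum N (headConv z) ζ (E h) (Ioc z N) (Ioc z N)‖ +
        ∑ h ∈ Icc 1 H, ‖hypSum N (tail μ z) (tailConv z) (E h) (Ioc z N) (Ioc z N)‖ := by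
        simp only [sum_add_distrib, ← mul_sum, sum_const, Nat.card_Icc, nsmul_eq_mul, one_mul]
        rw [hZ]; push_cast; ring
    _ ≤ 16 * D ^ 1 * Z + D * (c₂ * D ^ (n + 3) * (H * N) * s ^ κ) +
        D * (c₂ * D ^ (n + 3) * (H * N) * s ^ κ) +
        c₁ * D ^ (2 * n + 9) * (H * N) * s ^ κ + c₁ * D ^ (2 * n + 9) * (H * N) * s ^ κ := by
        gcongr
    _ = 16 * D ^ 1 * Z + 2 * c₂ * D ^ (n + 4) * Z + 2 * c₁ * D ^ (2 * n + 9) * Z := by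
        rw [hZ]; ring
    _ ≤ 16 * D ^ (2 * n + 10) * Z + 2 * c₂ * D ^ (2 * n + 10) * Z +
        2 * c₁ * D ^ (2 * n + 10) * Z := by
        gcongr 16 * ?_ * _ + 2 * c₂ * ?_ * _ + 2 * c₁ * ?_ * _
        · exact hpow _ (by omega)
        · exact hpow _ (by omega)
        · exact hpow _ (by omega)
    _ = _ := by ring

/-- Weyl sums over primes, averaged over `h`. -/
lemma exists_prime_sum_le (n : ℕ) (hn : 1 ≤ n) : ∃ c : ℝ, 0 < c ∧
    ∀ (D : ℝ) (H N : ℕ) (θ : ℝ) (a : ℤ) (q : ℕ) (f : ℤ → ℝ),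
    DivBound D (lvl n N) → IsApprox θ a q → q ≤ lvl n N → 1 ≤ H → H ≤ N →
    IsPhase (n + 1) θ f → sav n q N ≤ 1 →
    ∑ h ∈ Icc 1 H, ‖∑ p ∈ primesUpTo N, (Real.log p : ℂ) * ex (h * f p)‖ ≤
      c * D ^ (2 * n + 10) * (H * N) * sav n q N ^ (1 / 4 ^ n : ℝ) := by
  obtain ⟨c, hc, h₁⟩ := exists_vonMangoldt_sum_le n hn
  refine ⟨c + 2, by positivity, ?_⟩
  intro D H N θ a q f hD hθ hq hH hHN hf hs1
  have hD1 := hD.one_le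
  have hN1 : 1 ≤ N := hH.trans hHN
  have hN' : (1 : ℝ) ≤ N := by exact_mod_cast hN1
  have hq1 : (0 : ℝ) < q := by exact_mod_cast hθ.one_le
  have h2 := h₁ D H N θ a q f hD hθ hq hH hHN hf hs1
  set s := sav n q N with hs
  have hs0 : 0 < s := sav_pos hθ.one_le (by linarith)
  have hlogN : Real.log N ≤ D := by
    have : Real.log N ≤ Real.log (lvl n N) := by
      gcongr; exact le_lvl n N
    linarith [hD.log_le]
  -- Proper prime powers contribute ψ(N) - θ(N), of size √N log N, which this absorbs because s ≥
  -- N^(-1/2).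
  have hsq : √(N : ℝ) ≤ N * s ^ (1 / 4 ^ n : ℝ) := by
    have e1 : 1 / √(N : ℝ) ≤ s := by
      rw [hs, sav]
      have : 0 ≤ 1 / (q : ℝ) := by positivity
      have : 0 ≤ q / (N : ℝ) ^ (n + 1) := by positivity
      linarith
    have e2 : s ≤ s ^ (1 / 4 ^ n : ℝ) := by
      conv_lhs => rw [← Real.rpow_one s]
      apply Real.rpow_le_rpow_of_exponent_ge hs0 hs1
      rw [div_le_one (by positivity)]; exact one_le_pow₀ (by norm_num)
    calc √(N : ℝ) = N * (1 / √(N : ℝ)) := by rw [mul_one_div, Real.div_sqrt]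
      _ ≤ _ := by gcongr; linarith
  have key : ∀ h : ℕ, ‖∑ p ∈ primesUpTo N, (Real.log p : ℂ) * ex (h * f p)‖ ≤
      ‖∑ m ∈ Ioc 0 N, (ArithmeticFunction.vonMangoldt m : ℂ) * ex (h * f m)‖ +
        2 * D * (N * s ^ (1 / 4 ^ n : ℝ)) := by
    intro h
    have e0 : primesUpTo N = (Ioc 0 N).filter Nat.Prime := by
      ext p
      simp only [primesUpTo, mem_filter, mem_range, mem_Ioc]
      constructor
      · rintro ⟨h1, h2⟩; exact ⟨⟨h2.pos, by omega⟩, h2⟩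
      · rintro ⟨h1, h2⟩; exact ⟨by omega, h2⟩
    have e1 : ∑ p ∈ primesUpTo N, (Real.log p : ℂ) * ex (h * f p) =
        ∑ p ∈ (Ioc 0 N).filter Nat.Prime, (ArithmeticFunction.vonMangoldt p : ℂ) * ex (h * f p) := by
      rw [e0]
      refine sum_congr rfl fun p hp => ?_
      rw [ArithmeticFunction.vonMangoldt_apply_prime (mem_filter.mp hp).2]
    have e2 := sum_filter_add_sum_filter_not (Ioc 0 N) Nat.Prime
      (fun m => (ArithmeticFunction.vonMangoldt m : ℂ) * ex (h * f m))
    have e3 : ‖∑ m ∈ (Ioc 0 N).filter (fun m => ¬ m.Prime),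
        (ArithmeticFunction.vonMangoldt m : ℂ) * ex (h * f m)‖ ≤ 2 * D * (N * s ^ (1 / 4 ^ n : ℝ)) := by
      calc _ ≤ ∑ m ∈ (Ioc 0 N).filter (fun m => ¬ m.Prime), ArithmeticFunction.vonMangoldt m := by
            refine (norm_sum_le _ _).trans (le_of_eq (sum_congr rfl fun m _ => ?_))
            rw [norm_mul, norm_ex, mul_one, Complex.norm_real, Real.norm_eq_abs, abs_vonMangoldt]
        _ = Chebyshev.psi N - Chebyshev.theta N := by
            rw [Chebyshev.psi_sub_theta_eq_sum_not_prime, Nat.floor_natCast]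
        _ ≤ 2 * √(N : ℝ) * Real.log N := Chebyshev.psi_sub_theta_le hN'
        _ ≤ 2 * (N * s ^ (1 / 4 ^ n : ℝ)) * D := by gcongr
        _ = _ := by ring
    rw [e1, ← e2]
    have := norm_sub_le (∑ m ∈ (Ioc 0 N).filter Nat.Prime,
      (ArithmeticFunction.vonMangoldt m : ℂ) * ex (h * f m) +
      ∑ m ∈ (Ioc 0 N).filter (fun m => ¬ m.Prime),
        (ArithmeticFunction.vonMangoldt m : ℂ) * ex (h * f m))
      (∑ m ∈ (Ioc 0 N).filter (fun m => ¬ m.Prime),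
        (ArithmeticFunction.vonMangoldt m : ℂ) * ex (h * f m))
    rw [add_sub_cancel_right] at this
    linarith
  have hX : 0 ≤ (H * N : ℝ) * s ^ (1 / 4 ^ n : ℝ) := by positivity
  have hDe : D ≤ D ^ (2 * n + 10) := le_self_pow₀ hD1 (by omega)
  calc _ ≤ ∑ h ∈ Icc 1 H, (‖∑ m ∈ Ioc 0 N, (ArithmeticFunction.vonMangoldt m : ℂ) * ex (h * f m)‖ +
        2 * D * (N * s ^ (1 / 4 ^ n : ℝ))) := sum_le_sum fun h _ => key h
    _ = ∑ h ∈ Icc 1 H, ‖∑ m ∈ Ioc 0 N, (ArithmeticFunction.vonMangoldt m : ℂ) * ex (h * f m)‖ +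
        2 * D * ((H * N) * s ^ (1 / 4 ^ n : ℝ)) := by
        rw [sum_add_distrib]; simp; ring
    _ ≤ c * D ^ (2 * n + 10) * (H * N) * s ^ (1 / 4 ^ n : ℝ) +
        2 * D ^ (2 * n + 10) * ((H * N) * s ^ (1 / 4 ^ n : ℝ)) := by gcongr
    _ = _ := by ring

/-! ### The divisor bound -/

/-- For p > 2^(1/ε) one has p^ε ≥ 2, and 2^a ≥ a+1. Each of the boundedly many smaller primes pays a
constant, which comes from exp u ≥ 1 + u. -/
lemma natCast_add_one_le_rpow {ε : ℝ} (hε : 0 < ε) {p : ℕ} (hp : 2 ≤ p) (a : ℕ) :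
    ((a + 1 : ℕ) : ℝ) ≤
      (if p ≤ ⌊(2 : ℝ) ^ (1 / ε)⌋₊ then 1 + 1 / (ε * Real.log 2) else 1) * ((p ^ a : ℕ) : ℝ) ^ ε := by
  have hp' : (2 : ℝ) ≤ p := by exact_mod_cast hp
  have h2 : 0 < Real.log 2 := Real.log_pos (by norm_num)
  have e : ((p ^ a : ℕ) : ℝ) ^ ε = ((p : ℝ) ^ ε) ^ a := by
    push_cast
    rw [← Real.rpow_natCast, ← Real.rpow_mul (by linarith), mul_comm, Real.rpow_mul (by linarith),
      Real.rpow_natCast]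
  rw [e]
  split_ifs with h
  · have h3 : 1 + a * (ε * Real.log 2) ≤ ((p : ℝ) ^ ε) ^ a := by
      calc 1 + a * (ε * Real.log 2) ≤ Real.exp (a * (ε * Real.log 2)) := by
            rw [add_comm]; exact Real.add_one_le_exp _
        _ = ((2 : ℝ) ^ ε) ^ a := by
            rw [Real.rpow_def_of_pos (by norm_num), ← Real.exp_nat_mul]; ring_nf
        _ ≤ _ := by gcongr
    set u := ε * Real.log 2 with hu
    have hu0 : 0 < u := by positivity
    calc ((a + 1 : ℕ) : ℝ) ≤ (1 + 1 / u) * (1 + a * u) := by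
          have : (1 + 1 / u) * (1 + a * u) = (a + 1 : ℕ) + a * u + 1 / u := by
            push_cast; field_simp; ring
          rw [this]
          have : 0 ≤ a * u + 1 / u := by positivity
          linarith
      _ ≤ _ := by gcongr
  · rw [not_le] at h
    have h4 : (2 : ℝ) ≤ (p : ℝ) ^ ε := by
      have h5 : (2 : ℝ) ^ (1 / ε) ≤ p := (Nat.lt_of_floor_lt h).le
      calc (2 : ℝ) = ((2 : ℝ) ^ (1 / ε)) ^ ε := by
            rw [← Real.rpow_mul (by norm_num), one_div_mul_cancel hε.ne', Real.rpow_one]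
        _ ≤ _ := by gcongr
    rw [one_mul]
    calc ((a + 1 : ℕ) : ℝ) ≤ (2 : ℝ) ^ a := by exact_mod_cast Nat.lt_two_pow_self
      _ ≤ _ := by gcongr

lemma exists_card_divisors_le {ε : ℝ} (hε : 0 < ε) : ∃ C : ℝ, 1 ≤ C ∧
    ∀ n : ℕ, 1 ≤ n → (n.divisors.card : ℝ) ≤ C * (n : ℝ) ^ ε := by
  set P := ⌊(2 : ℝ) ^ (1 / ε)⌋₊ with hP
  set B := 1 + 1 / (ε * Real.log 2) with hB
  have h2 : 0 < Real.log 2 := Real.log_pos (by norm_num)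
  have hB1 : 1 ≤ B := by
    have : 0 < 1 / (ε * Real.log 2) := by positivity
    linarith
  refine ⟨B ^ P, one_le_pow₀ hB1, fun n hn => ?_⟩
  have hn0 : n ≠ 0 := by omega
  rw [Nat.card_divisors hn0]
  push_cast
  calc ∏ p ∈ n.primeFactors, ((n.factorization p : ℝ) + 1)
      ≤ ∏ p ∈ n.primeFactors, ((if p ≤ P then B else 1) * ((p ^ n.factorization p : ℕ) : ℝ) ^ ε) := by
        refine prod_le_prod (fun _ _ => by positivity) fun p hp => ?_
        have := natCast_add_one_le_rpow hε (Nat.prime_of_mem_primeFactors hp).two_le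
          (n.factorization p)
        push_cast at this ⊢
        exact this
    _ = (∏ p ∈ n.primeFactors, if p ≤ P then B else 1) * (n : ℝ) ^ ε := by
        rw [prod_mul_distrib, Real.finsetProd_rpow _ _ fun _ _ => by positivity]
        congr 2
        conv_rhs => rw [← Nat.prod_factorization_pow_eq_self hn0]
        rw [Nat.prod_factorization_eq_prod_primeFactors]
        push_cast; rfl
    _ ≤ B ^ P * (n : ℝ) ^ ε := by
        gcongr
        rw [← prod_filter, prod_const]
        refine pow_le_pow_right₀ hB1 ?_
        calc _ ≤ (Icc 1 P).card := card_le_card fun p hp => by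
              have h1 := mem_filter.mp hp
              exact mem_Icc.mpr ⟨(Nat.prime_of_mem_primeFactors h1.1).one_le, h1.2⟩
          _ = P := by simp

/-- `lvl` is a constant times N^(2n+2), so the divisor bound is used with exponent η/(2n+2). -/
lemma exists_divBound (n : ℕ) {η : ℝ} (hη : 0 < η) : ∃ C : ℝ, 1 ≤ C ∧
    ∀ N : ℕ, 1 ≤ N → DivBound (C * (N : ℝ) ^ η) (lvl n N) := by
  set δ : ℝ := η / (2 * n + 2) with hδ
  have hδ0 : 0 < δ := by positivity
  obtain ⟨C, hC, h⟩ := exists_card_divisors_le hδ0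
  obtain ⟨K, hK⟩ : ∃ K : ℝ, K = (((n + 1).factorial ^ 2 * 2 ^ (n + 1) : ℕ) : ℝ) := ⟨_, rfl⟩
  have hK1 : 1 ≤ K := by
    rw [hK]
    exact_mod_cast Nat.mul_pos (pow_pos (Nat.factorial_pos _) 2) (by positivity)
  have hL : ∀ N : ℕ, (lvl n N : ℝ) ^ δ = K ^ δ * (N : ℝ) ^ η := by
    intro N
    have : (lvl n N : ℝ) = K * (N : ℝ) ^ (2 * n + 2) := by
      rw [lvl, hK]; push_cast; ring
    rw [this, Real.mul_rpow (by positivity) (by positivity), ← Real.rpow_natCast (N : ℝ),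
      ← Real.rpow_mul (by positivity)]
    congr 2
    rw [hδ]; push_cast; field_simp
  have hKδ : 1 ≤ K ^ δ := Real.one_le_rpow hK1 hδ0.le
  refine ⟨(C + 1 + 1 / δ) * K ^ δ, ?_, fun N hN => ?_⟩
  · have : 0 < 1 / δ := by positivity
    nlinarith
  have hl1 : (1 : ℝ) ≤ lvl n N := by exact_mod_cast hN.trans (le_lvl n N)
  have hLδ : 1 ≤ (lvl n N : ℝ) ^ δ := Real.one_le_rpow hl1 hδ0.le
  have hlog : 1 + Real.log (lvl n N) ≤ (C + 1 + 1 / δ) * (lvl n N : ℝ) ^ δ := by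
    have h1 : Real.log (lvl n N) ≤ (lvl n N : ℝ) ^ δ / δ := Real.log_le_rpow_div (by positivity) hδ0
    have h2 : (C + 1 + 1 / δ) * (lvl n N : ℝ) ^ δ =
      C * (lvl n N : ℝ) ^ δ + (lvl n N : ℝ) ^ δ + (lvl n N : ℝ) ^ δ / δ := by ring
    have h3 : 0 ≤ C * (lvl n N : ℝ) ^ δ := by positivity
    linarith
  have e : (C + 1 + 1 / δ) * K ^ δ * (N : ℝ) ^ η = (C + 1 + 1 / δ) * (lvl n N : ℝ) ^ δ := by
    rw [hL]; ring
  rw [e]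
  refine ⟨?_, fun m hm hmL => ?_, hlog⟩
  · have := Real.log_nonneg hl1
    linarith
  · calc (m.divisors.card : ℝ) ≤ C * (m : ℝ) ^ δ := h m hm
      _ ≤ (C + 1 + 1 / δ) * (lvl n N : ℝ) ^ δ := by
        have : 0 < 1 / δ := by positivity
        gcongr
        linarith

/-! ### The sawtooth function -/

/-- The sawtooth function. -/
noncomputable def saw (x : ℝ) : ℝ := Int.fract x - 1 / 2

/-- The periodic second Bernoulli function. -/
noncomputable def bern (x : ℝ) : ℝ := Int.fract x ^ 2 - Int.fract x + 1 / 6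

/-- `bern` has derivative 2 `saw` inside a period, and without a wrap the two sides agree. When x +
Δ reaches the next integer the sawtooth drops by 1, which only lowers the left side. -/
lemma bern_add_sub_le {Δ : ℝ} (hΔ : 0 < Δ) (hΔ1 : Δ ≤ 1) (x : ℝ) :
    bern (x + Δ) - bern x ≤ 2 * Δ * (saw x + Δ / 2) := by
  have h0 := Int.fract_nonneg x
  have h1 := Int.fract_lt_one x
  have hx := Int.floor_add_fract x
  rw [bern, bern, saw]
  rcases lt_or_ge (Int.fract x + Δ) 1 with h | h
  · have e : Int.fract (x + Δ) = Int.fract x + Δ := by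
      rw [Int.fract_eq_iff]
      exact ⟨by linarith, h, ⌊x⌋, by linarith⟩
    rw [e]; apply le_of_eq; ring
  · have e : Int.fract (x + Δ) = Int.fract x + Δ - 1 := by
      rw [Int.fract_eq_iff]
      exact ⟨by linarith, by linarith, ⌊x⌋ + 1, by push_cast; linarith⟩
    rw [e]; nlinarith

lemma le_bern_sub_bern {Δ : ℝ} (hΔ : 0 < Δ) (hΔ1 : Δ ≤ 1) (x : ℝ) :
    2 * Δ * (saw x - Δ / 2) ≤ bern x - bern (x - Δ) := by
  have h0 := Int.fract_nonneg x
  have h1 := Int.fract_lt_one x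
  have hx := Int.floor_add_fract x
  rw [bern, bern, saw]
  rcases le_or_gt Δ (Int.fract x) with h | h
  · have e : Int.fract (x - Δ) = Int.fract x - Δ := by
      rw [Int.fract_eq_iff]
      exact ⟨by linarith, by linarith, ⌊x⌋, by linarith⟩
    rw [e]; apply le_of_eq; ring
  · have e : Int.fract (x - Δ) = Int.fract x - Δ + 1 := by
      rw [Int.fract_eq_iff]
      exact ⟨by linarith, by linarith, ⌊x⌋ - 1, by push_cast; linarith⟩
    rw [e]; nlinarith

lemma hasSum_bern (x : ℝ) :
    HasSum (fun n : ℕ => 1 / (n : ℝ) ^ 2 * Real.cos (2 * Real.pi * n * x)) (Real.pi ^ 2 * bern x) := by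
  have h := hasSum_one_div_nat_pow_mul_cos (k := 1) one_ne_zero (x := Int.fract x)
    ⟨Int.fract_nonneg x, (Int.fract_lt_one x).le⟩
  have e : ∀ n : ℕ, Real.cos (2 * Real.pi * n * Int.fract x) = Real.cos (2 * Real.pi * n * x) := by
    intro n
    have : 2 * Real.pi * n * Int.fract x = 2 * Real.pi * n * x - ((n * ⌊x⌋ : ℤ) : ℝ) * (2 * Real.pi) := by
      rw [Int.fract]; push_cast; ring
    rw [this, Real.cos_sub_int_mul_two_pi]
  simp only [e] at h
  convert h using 1
  rw [bern]
  simp [Polynomial.bernoulli, sum_range_succ, bernoulli_two]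
  norm_num [bernoulli_one, bernoulli_zero]
  ring

lemma norm_ex_sub_one_le (x : ℝ) : ‖ex x - 1‖ ≤ 2 * Real.pi * |x| := by
  rw [norm_ex_sub_one]
  have h := Real.abs_sin_le_abs (x := Real.pi * x)
  rw [abs_mul, abs_of_pos Real.pi_pos] at h
  linarith

lemma cos_eq_re_ex (x : ℝ) (n : ℕ) : Real.cos (2 * Real.pi * n * x) = (ex (n * x)).re := by
  rw [ex, ← Complex.exp_ofReal_mul_I_re]
  congr 2
  push_cast; ring

/-- The Fourier series of `bern` converges absolutely, so it can be differenced termwise: |e(hδ) -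
1| ≤ 2πh|δ| is used for h ≤ H, and the trivial bound 2 with Σ_{h>H} h^(-2) ≤ 1/H beyond. -/
lemma abs_sum_bern_sub_le {ι : Type*} (s : Finset ι) (w : ι → ℝ) (hw : ∀ i ∈ s, 0 ≤ w i)
    (y : ι → ℝ) (δ : ℝ) {H : ℕ} (hH : 1 ≤ H) :
    |∑ i ∈ s, w i * (bern (y i + δ) - bern (y i))| ≤
      2 * |δ| * ∑ h ∈ Icc 1 H, 1 / (h : ℝ) * ‖∑ i ∈ s, (w i : ℂ) * ex (h * y i)‖ +
        2 / H * ∑ i ∈ s, w i := by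
  set W := ∑ i ∈ s, w i with hW
  have hW0 : 0 ≤ W := sum_nonneg hw
  set S : ℕ → ℂ := fun h => ∑ i ∈ s, (w i : ℂ) * ex (h * y i) with hS
  have hSW : ∀ h, ‖S h‖ ≤ W := fun h => (norm_sum_le _ _).trans (le_of_eq (sum_congr rfl fun i hi => by
    rw [norm_mul, norm_ex, mul_one, Complex.norm_real, Real.norm_of_nonneg (hw i hi)]))
  set u : ℕ → ℝ := fun n => 1 / (n : ℝ) ^ 2 * ((ex (n * δ) - 1) * S n).re with hu
  have hsum : HasSum u (Real.pi ^ 2 * ∑ i ∈ s, w i * (bern (y i + δ) - bern (y i))) := by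
    have h : HasSum _ _ := hasSum_sum (s := s) fun i _ =>
      (((hasSum_bern (y i + δ)).sub (hasSum_bern (y i))).mul_left (w i))
    have e1 : u = fun n : ℕ => ∑ i ∈ s, w i * (1 / (n : ℝ) ^ 2 * Real.cos (2 * Real.pi * n * (y i + δ)) -
        1 / (n : ℝ) ^ 2 * Real.cos (2 * Real.pi * n * y i)) := by
      funext n
      rw [hu, hS]
      simp only
      rw [mul_sum, Complex.re_sum, mul_sum]
      refine sum_congr rfl fun i _ => ?_
      rw [cos_eq_re_ex, cos_eq_re_ex, ← mul_sub, ← Complex.sub_re, mul_add, ex_add]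
      rw [show (ex (n * δ) - 1) * ((w i : ℂ) * ex (n * y i)) =
        (w i : ℂ) * (ex (n * y i) * ex (n * δ) - ex (n * y i)) by ring, Complex.re_ofReal_mul]
      ring
    have e2 : Real.pi ^ 2 * ∑ i ∈ s, w i * (bern (y i + δ) - bern (y i)) =
        ∑ i ∈ s, w i * (Real.pi ^ 2 * bern (y i + δ) - Real.pi ^ 2 * bern (y i)) := by
      rw [mul_sum]
      exact sum_congr rfl fun i _ => by ring
    rw [e1, e2]
    exact h
  have hu1 : ∀ n : ℕ, 1 ≤ n → |u n| ≤ 2 * Real.pi * |δ| * (1 / (n : ℝ) * ‖S n‖) := by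
    intro n hn
    have hn' : (0 : ℝ) < n := by exact_mod_cast hn
    simp only [hu]
    rw [abs_mul, abs_of_nonneg (by positivity)]
    calc _ ≤ 1 / (n : ℝ) ^ 2 * (2 * Real.pi * |n * δ| * ‖S n‖) := by
          gcongr
          refine (Complex.abs_re_le_norm _).trans ?_
          rw [norm_mul]; gcongr; exact norm_ex_sub_one_le _
      _ = _ := by rw [abs_mul, abs_of_pos hn']; field_simp
  have hu2 : ∀ n : ℕ, |u n| ≤ 2 * W * ((n : ℝ) ^ 2)⁻¹ := by
    intro n
    simp only [hu]
    rw [abs_mul, abs_of_nonneg (by positivity), one_div, mul_comm]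
    gcongr
    refine (Complex.abs_re_le_norm _).trans ?_
    rw [norm_mul]
    gcongr
    · refine (norm_sub_le _ _).trans ?_
      rw [norm_ex, norm_one]; norm_num
    · exact hSW n
  set A := ∑ h ∈ Icc 1 H, 1 / (h : ℝ) * ‖S h‖ with hA
  have hA0 : 0 ≤ A := sum_nonneg fun _ _ => by positivity
  have hpart : ∀ M ≥ H, |∑ n ∈ range (M + 1), u n| ≤ 2 * Real.pi * |δ| * A + 2 * W / H := by
    intro M hM
    have e : ∑ n ∈ range (M + 1), u n = ∑ n ∈ Icc 1 H, u n + ∑ n ∈ Ioc H M, u n := by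
      have h0 : u 0 = 0 := by simp [hu]
      have hr : range (M + 1) = insert 0 (Icc 1 H ∪ Ioc H M) := by
        ext n; simp only [mem_range, mem_insert, mem_union, mem_Icc, mem_Ioc]; omega
      rw [hr, sum_insert (by simp), h0, zero_add, sum_union]
      rw [disjoint_left]
      intro n
      simp only [mem_Icc, mem_Ioc]; omega
    rw [e]
    refine (abs_add_le _ _).trans (add_le_add ?_ ?_)
    · rw [hA, mul_sum]
      exact (abs_sum_le_sum_abs _ _).trans (sum_le_sum fun n hn => hu1 n (mem_Icc.mp hn).1)
    · refine (abs_sum_le_sum_abs _ _).trans ((sum_le_sum fun n _ => hu2 n).trans ?_)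
      rw [← mul_sum, div_eq_mul_inv]
      gcongr
      refine (sum_Ioc_inv_sq_le_sub (by omega) hM).trans ?_
      have : (0 : ℝ) ≤ (M : ℝ)⁻¹ := by positivity
      linarith
  have hlim : |Real.pi ^ 2 * ∑ i ∈ s, w i * (bern (y i + δ) - bern (y i))| ≤
      2 * Real.pi * |δ| * A + 2 * W / H := by
    refine le_of_tendsto (((hsum.tendsto_sum_nat).comp (Filter.tendsto_add_atTop_nat 1)).abs) ?_
    filter_upwards [Filter.eventually_ge_atTop H] with M hM
    exact hpart M hM
  rw [abs_mul, abs_of_nonneg (by positivity)] at hlim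
  have hpi : 1 < Real.pi := by linarith [Real.pi_gt_three]
  have hfin : Real.pi ^ 2 * |∑ i ∈ s, w i * (bern (y i + δ) - bern (y i))| ≤
      Real.pi ^ 2 * (2 * |δ| * A + 2 / H * W) := by
    refine hlim.trans ?_
    have h1 : 0 ≤ |δ| * A := by positivity
    have h2 : 0 ≤ W / H := by positivity
    have h3 : Real.pi ≤ Real.pi ^ 2 := by nlinarith
    have h4 : 1 ≤ Real.pi ^ 2 := by nlinarith
    calc 2 * Real.pi * |δ| * A + 2 * W / H = 2 * Real.pi * (|δ| * A) + 2 * 1 * (W / H) := by ring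
      _ ≤ 2 * Real.pi ^ 2 * (|δ| * A) + 2 * Real.pi ^ 2 * (W / H) := by gcongr
      _ = _ := by ring
  exact le_of_mul_le_mul_left hfin (by positivity)

/-- The Erdős–Turán inequality for weighted sums of the sawtooth function. -/
lemma abs_sum_saw_le {ι : Type*} (s : Finset ι) (w : ι → ℝ) (hw : ∀ i ∈ s, 0 ≤ w i)
    (y : ι → ℝ) {Δ : ℝ} (hΔ : 0 < Δ) (hΔ1 : Δ ≤ 1) {H : ℕ} (hH : 1 ≤ H) :
    |∑ i ∈ s, w i * saw (y i)| ≤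
      ∑ h ∈ Icc 1 H, 1 / (h : ℝ) * ‖∑ i ∈ s, (w i : ℂ) * ex (h * y i)‖ +
        (1 / (Δ * H) + Δ) * ∑ i ∈ s, w i := by
  have hW0 : 0 ≤ ∑ i ∈ s, w i := sum_nonneg hw
  -- The forward difference of `bern` bounds the sawtooth sum from below, the backward one from
  -- above; division by 2Δ turns the tail 2/H into 1/(ΔH).
  have h1 := (abs_le.mp (abs_sum_bern_sub_le s w hw y Δ hH)).1
  have h2 := (abs_le.mp (abs_sum_bern_sub_le s w hw y (-Δ) hH)).1
  rw [abs_neg] at h2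
  rw [abs_of_pos hΔ] at h1 h2
  set W := ∑ i ∈ s, w i
  set A := ∑ h ∈ Icc 1 H, 1 / (h : ℝ) * ‖∑ i ∈ s, (w i : ℂ) * ex (h * y i)‖
  set T := ∑ i ∈ s, w i * saw (y i) with hT
  have hH' : (0 : ℝ) < H := by exact_mod_cast hH
  have h3 : ∑ i ∈ s, w i * (bern (y i + Δ) - bern (y i)) ≤ 2 * Δ * (T + Δ / 2 * W) := by
    calc _ ≤ ∑ i ∈ s, w i * (2 * Δ * (saw (y i) + Δ / 2)) :=
          sum_le_sum fun i hi => mul_le_mul_of_nonneg_left (bern_add_sub_le hΔ hΔ1 _) (hw i hi)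
      _ = _ := by
          rw [hT, mul_add, mul_sum, mul_sum, mul_sum, ← sum_add_distrib]
          exact sum_congr rfl fun i _ => by ring
  have h4 : ∑ i ∈ s, w i * (bern (y i + -Δ) - bern (y i)) ≤ -(2 * Δ * (T - Δ / 2 * W)) := by
    calc _ ≤ ∑ i ∈ s, w i * (-(2 * Δ * (saw (y i) - Δ / 2))) :=
          sum_le_sum fun i hi => mul_le_mul_of_nonneg_left (by
            have := le_bern_sub_bern hΔ hΔ1 (y i); rw [← sub_eq_add_neg]; linarith) (hw i hi)
      _ = _ := by
          rw [hT, mul_sub, mul_sum, mul_sum, mul_sum, ← sum_sub_distrib, ← sum_neg_distrib]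
          exact sum_congr rfl fun i _ => by ring
  have key : ∀ t : ℝ, 2 * Δ * t ≤ 2 * Δ * A + 2 / H * W + 2 * Δ * (Δ / 2 * W) →
      t ≤ A + (1 / (Δ * H) + Δ) * W := by
    intro t ht
    have e : 2 * Δ * A + 2 / H * W + 2 * Δ * (Δ / 2 * W) =
        2 * Δ * (A + (1 / (Δ * H) + Δ / 2) * W) := by field_simp; ring
    rw [e] at ht
    have := le_of_mul_le_mul_left ht (by positivity)
    refine this.trans ?_
    gcongr; linarith
  rw [abs_le]
  constructor
  · have := key (-T) (by linarith)
    linarith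
  · exact key T (by linarith)

/-- Partial summation trades the weights 1/j for unweighted averages over j ≤ H, the form in which
the Weyl sums are bounded, at the cost of a logarithm. -/
lemma sum_div_le {a : ℕ → ℝ} {E : ℝ} {N : ℕ} (hE : 0 ≤ E)
    (h : ∀ H ≤ N, ∑ j ∈ Icc 1 H, a j ≤ H * E) :
    ∑ j ∈ Icc 1 N, 1 / (j : ℝ) * a j ≤ E * (2 + Real.log N) := by
  have hid : ∀ H : ℕ, ∑ j ∈ Icc 1 H, 1 / (j : ℝ) * a j = (∑ j ∈ Icc 1 H, a j) / (H + 1) +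
      ∑ i ∈ Icc 1 H, (∑ j ∈ Icc 1 i, a j) / (i * (i + 1)) := by
    intro H
    induction H with
    | zero => simp
    | succ H ih =>
      rw [sum_Icc_succ_top (by omega), ih, sum_Icc_succ_top (by omega) (fun i : ℕ =>
        (∑ j ∈ Icc 1 i, a j) / ((i : ℝ) * (i + 1))), sum_Icc_succ_top (by omega)]
      push_cast; field_simp; ring
  rw [hid]
  have h1 : (∑ j ∈ Icc 1 N, a j) / (N + 1) ≤ E := by
    rw [div_le_iff₀ (by positivity)]
    have := h N le_rfl
    linarith
  have h2 : ∑ i ∈ Icc 1 N, (∑ j ∈ Icc 1 i, a j) / ((i : ℝ) * (i + 1)) ≤ E * (1 + Real.log N) := by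
    calc _ ≤ ∑ i ∈ Icc 1 N, E * (1 / (i : ℝ)) := by
          refine sum_le_sum fun i hi => ?_
          have hi := mem_Icc.mp hi
          have hi' : (0 : ℝ) < i := by exact_mod_cast hi.1
          rw [div_le_iff₀ (by positivity)]
          have h3 := h i hi.2
          have : E * (1 / (i : ℝ)) * (i * (i + 1)) = i * E + E := by field_simp
          linarith
      _ ≤ _ := by
          rw [← mul_sum]
          gcongr
          have := harmonic_le_one_add_log N
          rw [harmonic_eq_sum_Icc] at this
          push_cast at this
          simpa using this
  linarith

/-! ### From exponential sums to the Beatty sequence -/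

-- The filters in `beattyPrimeSum` and `initialPrimeSum` elaborate over `ℤ`, with the primes lifted
-- through the `Finset` monad. Injectivity of the cast brings the sum back to `ℕ`.
open Classical in
lemma sum_filter_lift (s : Finset ℕ) (P : ℤ → Prop) :
    ∑ p ∈ (s >>= fun a => (pure (a : ℤ) : Finset ℤ)).filter P, Real.log (p : ℝ) =
      ∑ p ∈ s, if P (p : ℤ) then Real.log (p : ℝ) else 0 := by
  have e : (s >>= fun a => (pure (a : ℤ) : Finset ℤ)) = s.image (fun n : ℕ => (n : ℤ)) := by
    refine (bind_pure_comp _ _).trans ?_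
    rw [fmap_def]
    ext x; simp
  rw [e, sum_filter, sum_image fun a _ b _ h => by exact_mod_cast h]
  exact sum_congr rfl fun p _ => by push_cast; rfl

open Classical in
lemma beattyPrimeSum_eq (g : Polynomial ℤ) (α β : ℝ) (N : ℕ) : beattyPrimeSum g α β N =
    ∑ p ∈ primesUpTo N, if g.eval (p : ℤ) ∈ beatty α β then Real.log (p : ℝ) else 0 := by
  rw [beattyPrimeSum]
  exact sum_filter_lift _ fun m => g.eval m ∈ beatty α β

open Classical in
lemma initialPrimeSum_eq (g : Polynomial ℤ) (α β : ℝ) (N : ℕ) : initialPrimeSum g α β N =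
    ∑ p ∈ primesUpTo N, if ((g.eval (p : ℤ) : ℤ) : ℝ) ≤ α + β - 1 then Real.log (p : ℝ) else 0 := by
  rw [initialPrimeSum]
  exact sum_filter_lift _ fun m => ((g.eval m : ℤ) : ℝ) ≤ α + β - 1

lemma log_nonneg_of_mem {N p : ℕ} (_ : p ∈ primesUpTo N) : 0 ≤ Real.log p := Real.log_natCast_nonneg p

lemma primeSum_nonneg (N : ℕ) : 0 ≤ primeSum N := sum_nonneg fun _ h => log_nonneg_of_mem h

lemma primeSum_le (N : ℕ) : primeSum N ≤ 2 * N := by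
  have h := Chebyshev.theta_le_log4_mul_x (x := (N : ℝ)) (by positivity)
  have e : primeSum N = Chebyshev.theta N := by
    rw [Chebyshev.theta, Nat.floor_natCast, primeSum]
    refine sum_congr ?_ fun _ _ => rfl
    ext p
    simp only [primesUpTo, mem_filter, mem_range, mem_Ioc]
    constructor
    · rintro ⟨h1, h2⟩; exact ⟨⟨h2.pos, by omega⟩, h2⟩
    · rintro ⟨h1, h2⟩; exact ⟨by omega, h2⟩
  rw [e]
  refine h.trans ?_
  have : Real.log 4 ≤ 2 := by
    rw [show (4 : ℝ) = 2 ^ 2 by norm_num, Real.log_pow]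
    have := Real.log_two_lt_d9
    push_cast; linarith
  gcongr

lemma inv_sqrt_le_sav {n q : ℕ} {x : ℝ} (hx : 0 ≤ x) : 1 / √x ≤ sav n q x := by
  rw [sav]
  have : 0 ≤ 1 / (q : ℝ) := by positivity
  have : 0 ≤ q / x ^ (n + 1) := by positivity
  linarith

lemma le_lvl_of_sav_le_one {n q N : ℕ} (hN : 1 ≤ N) (h : sav n q N ≤ 1) : q ≤ lvl n N := by
  have hN' : (0 : ℝ) < N := by exact_mod_cast hN
  have h1 : q / (N : ℝ) ^ (n + 1) ≤ 1 := by
    rw [sav] at h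
    have : 0 ≤ 1 / (q : ℝ) := by positivity
    have : 0 ≤ 1 / √(N : ℝ) := by positivity
    linarith
  rw [div_le_one (by positivity)] at h1
  have h2 : q ≤ N ^ (n + 1) := by exact_mod_cast h1
  calc q ≤ N ^ (n + 1) := h2
    _ ≤ N ^ (2 * n + 2) := Nat.pow_le_pow_right hN (by omega)
    _ ≤ lvl n N := by
      rw [lvl]
      exact Nat.le_mul_of_pos_left _ (by have := Nat.factorial_pos (n + 1); positivity)

/-- Erdős–Turán with H = N and Δ = s^κ. The shift v multiplies each exponential sum by a number of
modulus 1, which is why the constant is uniform in β. -/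
lemma exists_saw_sum_le (n : ℕ) (hn : 1 ≤ n) {η : ℝ} (hη : 0 < η) : ∃ C : ℝ, 0 < C ∧
    ∀ (N : ℕ) (θ : ℝ) (a : ℤ) (q : ℕ) (f : ℤ → ℝ) (v : ℝ), 1 ≤ N → IsApprox θ a q →
    IsPhase (n + 1) θ f → sav n q N ≤ 1 →
    |∑ p ∈ primesUpTo N, Real.log p * saw (f p + v)| ≤
      C * (N : ℝ) ^ η * (N * sav n q N ^ (1 / 4 ^ n : ℝ)) := by
  -- The prime sums cost D^(2n+10) and the logarithm of `sum_div_le` one more D; the exponent η/m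
  -- makes D^m a multiple of N^η.
  set m := 2 * n + 11 with hm
  obtain ⟨c, hc, h₁⟩ := exists_prime_sum_le n hn
  obtain ⟨C, hC, h₂⟩ := exists_divBound n (η := η / m) (by positivity)
  refine ⟨(2 * c + 4) * C ^ m, by positivity, ?_⟩
  intro N θ a q f v hN hθ hf hs1
  have hN' : (1 : ℝ) ≤ N := by exact_mod_cast hN
  have hD := h₂ N hN
  set D := C * (N : ℝ) ^ (η / m) with hDdef
  have hD1 := hD.one_le
  have hDm : D ^ m = C ^ m * (N : ℝ) ^ η := by
    rw [hDdef, mul_pow, ← Real.rpow_natCast ((N : ℝ) ^ _), ← Real.rpow_mul (by positivity)]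
    congr 2
    exact div_mul_cancel₀ η (by positivity)
  set s := sav n q N with hs
  have hs0 : 0 < s := sav_pos hθ.one_le (by linarith)
  set κ : ℝ := 1 / 4 ^ n with hκ
  have hκ0 : 0 < κ := by positivity
  have hκ1 : κ ≤ 1 := by
    rw [hκ, div_le_one (by positivity)]; exact one_le_pow₀ (by norm_num)
  set Δ := s ^ κ with hΔ
  have hΔ0 : 0 < Δ := by positivity
  have hΔ1 : Δ ≤ 1 := Real.rpow_le_one hs0.le hs1 hκ0.le
  have hΔN : 1 / (Δ * N) ≤ Δ := by
    have h3 : 1 / √(N : ℝ) ≤ Δ := by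
      refine (inv_sqrt_le_sav (n := n) (q := q) (by linarith)).trans ?_
      conv_lhs => rw [← hs, ← Real.rpow_one s]
      exact Real.rpow_le_rpow_of_exponent_ge hs0 hs1 hκ1
    have h4 : 1 / (N : ℝ) ≤ Δ * Δ := by
      calc 1 / (N : ℝ) = (1 / √(N : ℝ)) * (1 / √(N : ℝ)) := by
            rw [div_mul_div_comm, Real.mul_self_sqrt (by linarith), one_mul]
        _ ≤ _ := by gcongr
    rw [div_le_iff₀ (by positivity)] at h4 ⊢
    linarith
  have h3 := abs_sum_saw_le (primesUpTo N) (fun p => Real.log p) (fun p hp => log_nonneg_of_mem hp)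
    (fun p => f p + v) hΔ0 hΔ1 hN
  have h4 : ∀ h : ℕ, ‖∑ p ∈ primesUpTo N, (Real.log p : ℂ) * ex (h * (f p + v))‖ =
      ‖∑ p ∈ primesUpTo N, (Real.log p : ℂ) * ex (h * f p)‖ := by
    intro h
    simp_rw [mul_add, ex_add, ← mul_assoc]
    rw [← sum_mul, norm_mul, norm_ex, mul_one]
  simp only [h4] at h3
  have h5 := sum_div_le (N := N) (E := c * D ^ (2 * n + 10) * (N * Δ))
    (a := fun h : ℕ => ‖∑ p ∈ primesUpTo N, (Real.log p : ℂ) * ex (h * f p)‖) (by positivity) (by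
      intro H hH
      rcases Nat.eq_zero_or_pos H with rfl | hH1
      · simp
      · refine (h₁ D H N θ a q f hD hθ (le_lvl_of_sav_le_one hN hs1) hH1 hH hf hs1).trans
          (le_of_eq ?_)
        rw [← hs, ← hΔ]; ring)
  have h6 : 2 + Real.log N ≤ 2 * D := by
    have : Real.log N ≤ Real.log (lvl n N) := by
      gcongr; exact le_lvl n N
    linarith [hD.log_le]
  have hDm1 : 1 ≤ D ^ m := one_le_pow₀ hD1
  refine h3.trans ?_
  calc _ ≤ c * D ^ (2 * n + 10) * (N * Δ) * (2 * D) + (Δ + Δ) * (2 * N) := by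
        refine add_le_add (h5.trans ?_) (mul_le_mul ?_ (primeSum_le N) (primeSum_nonneg N) ?_)
        · gcongr
        · linarith
        · linarith
    _ = (2 * c * D ^ m + 4 * 1) * (N * Δ) := by rw [hm]; ring
    _ ≤ (2 * c * D ^ m + 4 * D ^ m) * (N * Δ) := by gcongr
    _ = _ := by rw [hDm]; ring

/-- m = ⌊jα + β⌋ means m - β ≤ jα < m - β + 1. The lower bound on m forces jα > α - 1 > 0, so j ≥ 1
is automatic. -/
lemma mem_beatty_iff {α β : ℝ} (hα : 1 < α) {m : ℤ} (hm : α + β - 1 < m) :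
    m ∈ beatty α β ↔ ∃ j : ℤ, (m - β) / α ≤ j ∧ (j : ℝ) < (m - β + 1) / α := by
  have hα0 : 0 < α := by linarith
  constructor
  · rintro ⟨j, hj, h⟩
    have h := (Int.floor_eq_iff.mp h.symm)
    refine ⟨j, ?_, ?_⟩
    · rw [div_le_iff₀ hα0]; push_cast; linarith [h.1]
    · rw [lt_div_iff₀ hα0]; push_cast; linarith [h.2]
  · rintro ⟨j, h1, h2⟩
    rw [div_le_iff₀ hα0] at h1
    rw [lt_div_iff₀ hα0] at h2
    have hj : 0 < j := by
      have : 0 < (j : ℝ) * α := by linarith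
      exact_mod_cast pos_of_mul_pos_left this hα0.le
    lift j to ℕ using hj.le
    refine ⟨j, by exact_mod_cast hj, ?_⟩
    push_cast at h1 h2
    exact (Int.floor_eq_iff.mpr ⟨by linarith, by linarith⟩).symm

lemma notMem_beatty {α β : ℝ} (hα : 1 < α) {m : ℤ} (hm : (m : ℝ) ≤ α + β - 1) :
    m ∉ beatty α β := by
  rintro ⟨j, hj, h⟩
  have h := (Int.floor_eq_iff.mp h.symm)
  have hj' : (1 : ℝ) ≤ j := by exact_mod_cast hj
  have : α ≤ j * α := le_mul_of_one_le_left (by linarith) hj'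
  linarith [h.2]

lemma ceil_sub_ceil_eq {x y : ℝ} : ((⌈y⌉ - ⌈x⌉ : ℤ) : ℝ) = y - x + (saw (-y) - saw (-x)) := by
  rw [saw, saw, Int.fract, Int.fract, Int.floor_neg, Int.floor_neg]
  push_cast; ring

lemma ceil_sub_ceil_eq_ite {x y : ℝ} (hxy : x ≤ y) (hyx : y < x + 1)
    [Decidable (∃ j : ℤ, x ≤ j ∧ (j : ℝ) < y)] :
    ⌈y⌉ - ⌈x⌉ = if ∃ j : ℤ, x ≤ j ∧ (j : ℝ) < y then 1 else 0 := by
  have h1 : ⌈x⌉ ≤ ⌈y⌉ := Int.ceil_mono hxy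
  have h2 : ⌈y⌉ ≤ ⌈x⌉ + 1 := by
    rw [← Int.ceil_add_one]; exact Int.ceil_mono hyx.le
  split_ifs with h
  · obtain ⟨j, hj1, hj2⟩ := h
    have := Int.ceil_le.mpr hj1
    have := Int.lt_ceil.mpr hj2
    omega
  · push Not at h
    have := h ⌈x⌉ (Int.le_ceil x)
    have := Int.ceil_le.mpr this
    omega

-- ⌈y⌉ - ⌈x⌉ counts the integers in [x, y), here at most one, and is the Beatty indicator up to the
-- condition j ≥ 1. That condition matters only for the initial primes, each of which costs at most
-- log p.
open Classical in
lemma abs_beattyPrimeSum_sub_le {α : ℝ} (hα : 1 < α) (g : Polynomial ℤ) (β : ℝ) (N : ℕ) :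
    |beattyPrimeSum g α β N - 1 / α * primeSum N| ≤
      |∑ p ∈ primesUpTo N, Real.log p * saw (-1 / α * (g.eval (p : ℤ) : ℤ) + (β - 1) / α)| +
      |∑ p ∈ primesUpTo N, Real.log p * saw (-1 / α * (g.eval (p : ℤ) : ℤ) + β / α)| +
      initialPrimeSum g α β N := by
  have hα0 : 0 < α := by linarith
  set A := ∑ p ∈ primesUpTo N, Real.log p * saw (-1 / α * (g.eval (p : ℤ) : ℤ) + (β - 1) / α) with hA
  set B := ∑ p ∈ primesUpTo N, Real.log p * saw (-1 / α * (g.eval (p : ℤ) : ℤ) + β / α) with hB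
  have key : |beattyPrimeSum g α β N - 1 / α * primeSum N - (A - B)| ≤ initialPrimeSum g α β N := by
    rw [beattyPrimeSum_eq, initialPrimeSum_eq, primeSum, hA, hB, mul_sum,
      ← sum_sub_distrib, ← sum_sub_distrib, ← sum_sub_distrib]
    refine (abs_sum_le_sum_abs _ _).trans (sum_le_sum fun p hp => ?_)
    set m : ℤ := g.eval (p : ℤ) with hm
    have hlog := log_nonneg_of_mem hp
    have hxy : ((m : ℝ) - β) / α ≤ (m - β + 1) / α := by gcongr; linarith
    have hyx : ((m : ℝ) - β + 1) / α < (m - β) / α + 1 := by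
      rw [add_div]
      have : 1 / α < 1 := by rw [div_lt_one hα0]; exact hα
      linarith
    have h1 := ceil_sub_ceil_eq (x := ((m : ℝ) - β) / α) (y := (m - β + 1) / α)
    rw [ceil_sub_ceil_eq_ite hxy hyx] at h1
    rw [show -(((m : ℝ) - β + 1) / α) = -1 / α * m + (β - 1) / α by ring,
      show -(((m : ℝ) - β) / α) = -1 / α * m + β / α by ring,
      show ((m : ℝ) - β + 1) / α - (m - β) / α = 1 / α by ring] at h1
    split_ifs with h2 h3 h3
    · exact absurd h2 (notMem_beatty hα h3)
    · rw [if_pos ((mem_beatty_iff hα (not_le.mp h3)).mp h2)] at h1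
      push_cast at h1
      rw [show ∀ x y : ℝ, Real.log p - 1 / α * Real.log p - (Real.log p * x - Real.log p * y) =
        Real.log p * (1 - (1 / α + (x - y))) by intros; ring, ← h1]
      simp
    · rw [show ∀ x y : ℝ, 0 - 1 / α * Real.log p - (Real.log p * x - Real.log p * y) =
        -(Real.log p * (1 / α + (x - y))) by intros; ring, ← h1, abs_neg, abs_mul, abs_of_nonneg hlog]
      split_ifs <;> simp [hlog]
    · rw [if_neg (fun h => h2 ((mem_beatty_iff hα (not_le.mp h3)).mpr h))] at h1
      push_cast at h1
      rw [show ∀ x y : ℝ, 0 - 1 / α * Real.log p - (Real.log p * x - Real.log p * y) =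
        -(Real.log p * (1 / α + (x - y))) by intros; ring, ← h1]
      simp
  have h1 := abs_le.mp key
  have h2 := abs_le.mp (le_refl |A|)
  have h3 := abs_le.mp (le_refl |B|)
  rw [abs_le]
  constructor <;> linarith [h1.1, h1.2, h2.1, h2.2, h3.1, h3.2]

lemma IsApprox.neg {θ : ℝ} {a : ℤ} {q : ℕ} (h : IsApprox θ a q) : IsApprox (-θ) (-a) q := by
  refine ⟨h.one_le, ?_, ?_⟩
  · exact h.coprime.neg_left
  · have := h.abs_sub_le
    rw [← abs_neg] at this
    convert this using 2
    push_cast; ring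

lemma initialPrimeSum_nonneg (g : Polynomial ℤ) (α β : ℝ) (N : ℕ) : 0 ≤ initialPrimeSum g α β N := by
  rw [initialPrimeSum_eq]
  exact sum_nonneg fun p _ => by split_ifs <;> simp [Real.log_natCast_nonneg]

open Classical in
lemma abs_beattyPrimeSum_sub_le_primeSum {α : ℝ} (hα : 1 < α) (g : Polynomial ℤ) (β : ℝ) (N : ℕ) :
    |beattyPrimeSum g α β N - 1 / α * primeSum N| ≤ primeSum N := by
  have h0 : 0 ≤ beattyPrimeSum g α β N := by
    rw [beattyPrimeSum_eq]
    exact sum_nonneg fun p _ => by split_ifs <;> simp [Real.log_natCast_nonneg]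
  have h1 : beattyPrimeSum g α β N ≤ primeSum N := by
    rw [beattyPrimeSum_eq]
    exact sum_le_sum fun p _ => by split_ifs <;> simp [Real.log_natCast_nonneg]
  have h2 : 1 / α ≤ 1 := by rw [div_le_one (by linarith)]; exact hα.le
  have h3 : 1 / α * primeSum N ≤ 1 * primeSum N := by
    have := primeSum_nonneg N
    gcongr
  have h4 : 0 ≤ 1 / α * primeSum N := mul_nonneg (by positivity) (primeSum_nonneg N)
  rw [abs_le]; constructor <;> linarith

/-- If `sav` exceeds 1, the trivial bound by `primeSum N` ≤ 2N suffices. Otherwise the sawtooth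
estimate applies twice, with phase -g/α. -/
lemma exists_beatty_le (n : ℕ) (hn : 1 ≤ n) {α : ℝ} (hα : 1 < α) {η : ℝ} (hη : 0 < η) :
    ∃ C : ℝ, 0 < C ∧ ∀ (g : Polynomial ℤ) (β : ℝ) (N : ℕ) (a : ℤ) (q : ℕ),
    g.natDegree = n + 1 → 1 ≤ N → IsApprox (g.leadingCoeff / α) a q →
    |beattyPrimeSum g α β N - 1 / α * primeSum N| ≤
      C * (N : ℝ) ^ η * (N * sav n q N ^ (1 / 4 ^ n : ℝ)) + initialPrimeSum g α β N := by
  obtain ⟨C, hC, h⟩ := exists_saw_sum_le n hn hη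
  refine ⟨2 * C + 2, by positivity, ?_⟩
  intro g β N a q hg hN hθ
  have hN' : (1 : ℝ) ≤ N := by exact_mod_cast hN
  have hNη : 1 ≤ (N : ℝ) ^ η := Real.one_le_rpow hN' hη.le
  have hs0 := sav_pos (n := n) hθ.one_le (by linarith : (0 : ℝ) < N)
  set Y := (N : ℝ) * sav n q N ^ (1 / 4 ^ n : ℝ) with hY
  have hY0 : 0 ≤ Y := by positivity
  rcases le_or_gt (sav n q N) 1 with hs | hs
  · have hf := isPhase_eval g (-1 / α)
    rw [hg, show -1 / α * (g.leadingCoeff : ℝ) = -(g.leadingCoeff / α) by ring] at hf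
    have h1 := h N _ _ q _ ((β - 1) / α) hN hθ.neg hf hs
    have h2 := h N _ _ q _ (β / α) hN hθ.neg hf hs
    refine (abs_beattyPrimeSum_sub_le hα g β N).trans ?_
    have h3 : 0 ≤ 2 * ((N : ℝ) ^ η * Y) := by positivity
    rw [← hY] at h1 h2
    linarith
  · have h1 : 1 ≤ sav n q N ^ (1 / 4 ^ n : ℝ) := Real.one_le_rpow hs.le (by positivity)
    have h2 : (N : ℝ) ≤ Y := le_mul_of_one_le_right (by linarith) h1
    have h3 : Y ≤ (N : ℝ) ^ η * Y := le_mul_of_one_le_left hY0 hNη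
    have h4 := abs_beattyPrimeSum_sub_le_primeSum hα g β N
    have h5 := primeSum_le N
    have h6 := initialPrimeSum_nonneg g α β N
    have h7 : 0 ≤ 2 * C * ((N : ℝ) ^ η * Y) := by positivity
    linarith

/-! ### Error terms -/

lemma gam_succ (n : ℕ) : gam (n + 1) = 1 / 4 ^ n := by
  rw [gam, show (1 : ℝ) - ((n + 1 : ℕ) : ℝ) = -(n : ℝ) by push_cast; ring,
    Real.rpow_neg (by norm_num), Real.rpow_natCast, one_div]

lemma gam_succ_pos (n : ℕ) : 0 < gam (n + 1) := by rw [gam_succ]; positivity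

lemma succ_mul_gam_le (n : ℕ) : ((n : ℝ) + 1) * gam (n + 1) ≤ 1 := by
  rw [gam_succ, mul_one_div, div_le_one (by positivity)]
  have h1 : n + 1 ≤ 2 ^ n := Nat.lt_two_pow_self
  have h2 : (2 : ℝ) ^ n ≤ 4 ^ n := by gcongr; norm_num
  have h3 : ((n : ℝ) + 1) ≤ 2 ^ n := by exact_mod_cast h1
  linarith

lemma gam_succ_le_one (n : ℕ) : gam (n + 1) ≤ 1 := by
  have h1 := succ_mul_gam_le n
  have h2 := gam_succ_pos n
  have h3 : 0 ≤ (n : ℝ) * gam (n + 1) := by positivity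
  linarith

/-- Subadditivity of t ↦ t^γ for γ ≤ 1 separates the three terms of `sav`. -/
lemma mul_sav_rpow_le (n : ℕ) {N q : ℕ} (hN : 1 ≤ N) :
    N * sav n q N ^ (1 / 4 ^ n : ℝ) ≤ N * (q : ℝ) ^ (-gam (n + 1)) +
      (N : ℝ) ^ (1 - gam (n + 1) / 2) +
      (q : ℝ) ^ gam (n + 1) * (N : ℝ) ^ (1 - ((n + 1 : ℕ) : ℝ) * gam (n + 1)) := by
  have hN' : (0 : ℝ) < N := by exact_mod_cast hN
  have hγ0 := gam_succ_pos n
  have hγ1 := gam_succ_le_one n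
  rw [← gam_succ]
  set γ := gam (n + 1) with hγ
  have h1 : sav n q N ^ γ ≤ (1 / (q : ℝ)) ^ γ + (1 / √(N : ℝ)) ^ γ +
      (q / (N : ℝ) ^ (n + 1)) ^ γ := by
    rw [sav]
    refine (Real.rpow_add_le_add_rpow (by positivity) (by positivity) hγ0.le hγ1).trans ?_
    gcongr
    exact Real.rpow_add_le_add_rpow (by positivity) (by positivity) hγ0.le hγ1
  have e1 : (1 / (q : ℝ)) ^ γ = (q : ℝ) ^ (-γ) := by
    rw [one_div, Real.inv_rpow (by positivity), Real.rpow_neg (by positivity)]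
  have e2 : N * (1 / √(N : ℝ)) ^ γ = (N : ℝ) ^ (1 - γ / 2) := by
    rw [one_div, Real.inv_rpow (by positivity), Real.sqrt_eq_rpow, ← Real.rpow_mul hN'.le,
      Real.rpow_sub hN', Real.rpow_one, div_eq_mul_inv]
    congr 3; ring
  have e3 : N * (q / (N : ℝ) ^ (n + 1)) ^ γ =
      (q : ℝ) ^ γ * (N : ℝ) ^ (1 - ((n + 1 : ℕ) : ℝ) * γ) := by
    rw [Real.div_rpow (by positivity) (by positivity), Real.rpow_sub hN', Real.rpow_one,
      Real.rpow_mul hN'.le, Real.rpow_natCast]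
    ring
  calc _ ≤ N * ((1 / (q : ℝ)) ^ γ + (1 / √(N : ℝ)) ^ γ + (q / (N : ℝ) ^ (n + 1)) ^ γ) := by gcongr
    _ = _ := by rw [mul_add, mul_add, e1, e2, e3]

lemma le_errorBound (n : ℕ) {ε : ℝ} {N q : ℕ} (hN : 1 ≤ N) :
    (N : ℝ) ^ ε * (N * sav n q N ^ (1 / 4 ^ n : ℝ)) ≤ errorBound (n + 1) ε N q := by
  rw [errorBound]
  have h1 := mul_sav_rpow_le n (q := q) hN
  -- The third term of `errorBound` is not needed for the estimate; it enters only as a nonnegative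
  -- summand.
  have h2 : 0 ≤ (q : ℝ) ^ (gam (n + 1) / (1 - gam (n + 1))) *
    (N : ℝ) ^ ((1 - (((n + 1 : ℕ) : ℝ) + 1) * gam (n + 1)) / (1 - gam (n + 1))) := by positivity
  gcongr
  linarith

lemma one_le_errorBound (n : ℕ) {ε : ℝ} (hε : 0 < ε) {N q : ℕ} (hN : 1 ≤ N) :
    1 ≤ errorBound (n + 1) ε N q := by
  have hN' : (1 : ℝ) ≤ N := by exact_mod_cast hN
  have h1 : 1 ≤ (N : ℝ) ^ (1 - gam (n + 1) / 2) :=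
    Real.one_le_rpow hN' (by linarith [gam_succ_le_one n, gam_succ_pos n])
  have h2 : 1 ≤ (N : ℝ) ^ ε := Real.one_le_rpow hN' hε.le
  rw [errorBound]
  refine one_le_mul_of_one_le_of_one_le h2 ?_
  have a1 : 0 ≤ (N : ℝ) * (q : ℝ) ^ (-gam (n + 1)) := by positivity
  have a2 : 0 ≤ (q : ℝ) ^ (gam (n + 1) / (1 - gam (n + 1))) *
    (N : ℝ) ^ ((1 - (((n + 1 : ℕ) : ℝ) + 1) * gam (n + 1)) / (1 - gam (n + 1))) := by positivity
  have a3 : 0 ≤ (q : ℝ) ^ gam (n + 1) * (N : ℝ) ^ (1 - ((n + 1 : ℕ) : ℝ) * gam (n + 1)) := by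
    positivity
  linarith

lemma one_le_typeErrorBound (n : ℕ) {t ε : ℝ} (hε : 0 < ε) {N : ℕ} (hN : 1 ≤ N) :
    1 ≤ typeErrorBound (n + 1) t ε N := by
  have hN' : (1 : ℝ) ≤ N := by exact_mod_cast hN
  have h1 : 1 ≤ (N : ℝ) ^ (1 - gam (n + 1) / 2 + ε) :=
    Real.one_le_rpow hN' (by linarith [gam_succ_le_one n, gam_succ_pos n])
  rw [typeErrorBound]
  have : 0 ≤ (N : ℝ) ^ (1 - ((n + 1 : ℕ) : ℝ) * gam (n + 1) / (t + 1) + ε) := by positivity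
  linarith

/-- For a fixed polynomial the initial segment has bounded size. -/
lemma exists_initialPrimeSum_le (g : Polynomial ℤ) (α β : ℝ) (hg : 0 < g.natDegree)
    (hlc : 1 ≤ g.leadingCoeff) : ∃ C : ℝ, 0 ≤ C ∧ ∀ N : ℕ, initialPrimeSum g α β N ≤ C := by
  set G := g.map (Int.castRingHom ℝ) with hG
  have hinj : Function.Injective (Int.castRingHom ℝ) := Int.cast_injective
  have ht : Filter.Tendsto (fun x => G.eval x) Filter.atTop Filter.atTop := by
    apply Polynomial.tendsto_atTop_of_leadingCoeff_nonneg
    · rw [hG, Polynomial.degree_map_eq_of_injective hinj]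
      exact Polynomial.natDegree_pos_iff_degree_pos.mp hg
    · rw [hG, Polynomial.leadingCoeff_map_of_injective hinj]
      simp only [eq_intCast]
      exact_mod_cast (by omega : 0 ≤ g.leadingCoeff)
  have ht2 := (ht.comp tendsto_natCast_atTop_atTop).eventually_gt_atTop (α + β - 1)
  obtain ⟨M, hM⟩ := Filter.eventually_atTop.mp ht2
  refine ⟨primeSum M, primeSum_nonneg M, fun N => ?_⟩
  rw [initialPrimeSum_eq, ← sum_filter, primeSum]
  refine sum_le_sum_of_subset_of_nonneg (fun p hp => ?_) fun p _ _ => Real.log_natCast_nonneg p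
  have hp := mem_filter.mp hp
  have hp1 := mem_filter.mp hp.1
  refine mem_filter.mpr ⟨?_, hp1.2⟩
  rw [mem_range]
  by_contra hpM
  have h1 := hM p (by omega)
  have h2 : G.eval ((p : ℕ) : ℝ) = ((g.eval (p : ℤ) : ℤ) : ℝ) := by
    rw [hG]
    simp
  simp only [Function.comp] at h1
  rw [h2] at h1
  linarith [hp.2]

/-! ### Numbers of finite type -/

lemma distInt_natCast_mul_pos {x : ℝ} (hx : Irrational x) {n : ℕ} (hn : 1 ≤ n) :
    0 < distInt (n * x) := by
  refine lt_of_le_of_ne (distInt_nonneg _) fun h => ?_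
  rw [distInt, eq_comm, abs_eq_zero, sub_eq_zero] at h
  exact (hx.natCast_mul (by omega : n ≠ 0)).ne_int _ h

/-- Every negative ρ belongs to the set, since n^ρ‖nx‖ ≤ n^ρ → 0. -/
lemma IsOfFiniteType.nonneg {x t : ℝ} (h : IsOfFiniteType x t) : 0 ≤ t := by
  refine le_of_forall_lt fun ρ hρ => ?_
  obtain ⟨ρ', h1, h2⟩ := exists_between hρ
  refine h1.trans_le (h.2.1 ?_)
  refine Filter.Tendsto.liminf_eq ?_
  rw [← ENNReal.ofReal_zero]
  refine ENNReal.tendsto_ofReal ?_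
  have h3 : Filter.Tendsto (fun n : ℕ => (n : ℝ) ^ ρ') Filter.atTop (nhds 0) := by
    have := (tendsto_rpow_neg_atTop (y := -ρ') (by linarith)).comp
      (tendsto_natCast_atTop_atTop (R := ℝ))
    simpa [Function.comp_def] using this
  refine squeeze_zero (fun n => mul_nonneg (by positivity) (distInt_nonneg _)) (fun n => ?_) h3
  calc _ ≤ (n : ℝ) ^ ρ' * 1 := by
        gcongr
        linarith [distInt_le_half (n * x)]
    _ = _ := mul_one _

/-- For ρ > t the lower limit is positive, which handles all large n; the finitely many others have
a positive minimum because x is irrational. -/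
lemma IsOfFiniteType.exists_le_distInt {x t ρ : ℝ} (h : IsOfFiniteType x t) (hρ : t < ρ) :
    ∃ c : ℝ, 0 < c ∧ ∀ n : ℕ, 1 ≤ n → c ≤ (n : ℝ) ^ ρ * distInt (n * x) := by
  have h1 : Filter.liminf (fun n : ℕ => ENNReal.ofReal ((n : ℝ) ^ ρ * distInt ((n : ℝ) * x)))
      Filter.atTop ≠ 0 := fun h0 => absurd (h.2.1 h0) (not_le.mpr hρ)
  obtain ⟨c, hc0, hc⟩ := exists_between (pos_iff_ne_zero.mpr h1)
  obtain ⟨M, hM⟩ := Filter.eventually_atTop.mp (Filter.eventually_lt_of_lt_liminf hc)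
  have hpos : ∀ n : ℕ, 1 ≤ n → 0 < (n : ℝ) ^ ρ * distInt (n * x) := fun n hn =>
    mul_pos (Real.rpow_pos_of_pos (by exact_mod_cast hn) _) (distInt_natCast_mul_pos h.1 hn)
  have hctop : c ≠ ⊤ := (hc.trans_le le_top).ne
  obtain ⟨m, hm, hmin⟩ := exists_min_image (Icc 1 (M + 1))
    (fun n : ℕ => (n : ℝ) ^ ρ * distInt (n * x)) ⟨1, by simp⟩
  refine ⟨min c.toReal ((m : ℝ) ^ ρ * distInt (m * x)),
    lt_min (ENNReal.toReal_pos hc0.ne' hctop) (hpos m (mem_Icc.mp hm).1), fun n hn => ?_⟩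
  rcases le_or_gt n (M + 1) with hnM | hnM
  · exact (min_le_right _ _).trans (hmin n (mem_Icc.mpr ⟨hn, hnM⟩))
  · refine (min_le_left _ _).trans ?_
    exact (ENNReal.lt_ofReal_iff_toReal_lt hctop).mp (hM n (by omega)) |>.le

/-- Dirichlet's theorem gives q ≤ Q with ‖qx‖ ≤ 1/Q, and c ≤ q^ρ‖qx‖ keeps q from being small. -/
lemma IsOfFiniteType.exists_approx {x t ρ : ℝ} (h : IsOfFiniteType x t) (hρ : t < ρ) :
    ∃ c : ℝ, 0 < c ∧ ∀ Q : ℝ, 1 ≤ Q → ∃ (a : ℤ) (q : ℕ), IsApprox x a q ∧ (q : ℝ) ≤ Q ∧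
      c * Q ≤ (q : ℝ) ^ ρ := by
  obtain ⟨c, hc, h1⟩ := h.exists_le_distInt hρ
  refine ⟨c, hc, fun Q hQ => ?_⟩
  have hQ0 : 0 < ⌊Q⌋₊ := Nat.floor_pos.mpr hQ
  obtain ⟨r, hr, hrQ⟩ := Real.exists_rat_abs_sub_le_and_den_le x hQ0
  have hd : (0 : ℝ) < r.den := by exact_mod_cast r.pos
  have hfl : Q ≤ ⌊Q⌋₊ + 1 := (Nat.lt_floor_add_one Q).le
  have hr1 : |x - r.num / r.den| ≤ 1 / (Q * r.den) := by
    have e : ((r : ℚ) : ℝ) = r.num / r.den := Rat.cast_def r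
    rw [← e]
    refine hr.trans ?_
    gcongr
  have hdQ : (r.den : ℝ) ≤ Q := (by exact_mod_cast hrQ : (r.den : ℝ) ≤ ⌊Q⌋₊).trans
    (Nat.floor_le (by linarith))
  refine ⟨r.num, r.den, ⟨r.pos, ?_, ?_⟩, hdQ, ?_⟩
  · exact Int.isCoprime_iff_gcd_eq_one.mpr r.reduced
  · refine hr1.trans ?_
    rw [sq]; gcongr
  · have h2 : distInt (r.den * x) ≤ 1 / Q := by
      refine (distInt_le _ r.num).trans ?_
      have e : (r.den : ℝ) * x - r.num = r.den * (x - r.num / r.den) := by field_simp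
      rw [e, abs_mul, abs_of_pos hd]
      calc _ ≤ r.den * (1 / (Q * r.den)) := by gcongr
        _ = 1 / Q := by field_simp
    have h3 : c ≤ (r.den : ℝ) ^ ρ * (1 / Q) := (h1 r.den r.pos).trans (by gcongr)
    rw [mul_one_div, le_div_iff₀ (by linarith)] at h3
    exact h3

lemma exists_sav_le_typeErrorBound (n : ℕ) {x t ε : ℝ} (h : IsOfFiniteType x t) (hε : 0 < ε) :
    ∃ C : ℝ, 0 < C ∧ ∀ N : ℕ, 1 ≤ N → ∃ (a : ℤ) (q : ℕ), IsApprox x a q ∧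
      (N : ℝ) ^ (ε / 2) * (N * sav n q N ^ (1 / 4 ^ n : ℝ)) ≤
        C * typeErrorBound (n + 1) t ε N := by
  have ht := h.nonneg
  -- Half of ε pays for replacing t by ρ, the other half for the factor N^(ε/2).
  set ρ := t + ε / 2 with hρ
  have hρ0 : 0 < ρ := by positivity
  obtain ⟨c, hc, hQ⟩ := h.exists_approx (by linarith : t < ρ)
  have hγ0 := gam_succ_pos n
  have hkγ := succ_mul_gam_le n
  set γ := gam (n + 1) with hγ
  set k : ℝ := (n : ℝ) + 1 with hk
  have hk0 : 0 < k := by positivity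
  refine ⟨(c ^ (1 / ρ)) ^ (-γ) + 1, by positivity, fun N hN => ?_⟩
  have hN' : (1 : ℝ) ≤ N := by exact_mod_cast hN
  have hN0 : (0 : ℝ) < N := by linarith
  -- This Q balances Nq^(-γ), where q ≥ c^(1/ρ) N^(k/(ρ+1)), against q^γ N^(1-kγ), where q ≤ Q: both
  -- are O(N^(1-kγ/(ρ+1))).
  set Q : ℝ := (N : ℝ) ^ (k * ρ / (ρ + 1)) with hQdef
  obtain ⟨a, q, hθ, hqQ, hcq⟩ := hQ Q (Real.one_le_rpow hN' (by positivity))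
  refine ⟨a, q, hθ, ?_⟩
  have hq0 : (0 : ℝ) < q := by exact_mod_cast hθ.one_le
  set X : ℝ := (N : ℝ) ^ (1 - k * γ / (ρ + 1)) with hX
  have hX0 : 0 < X := by positivity
  have h1 : N * (q : ℝ) ^ (-γ) ≤ (c ^ (1 / ρ)) ^ (-γ) * X := by
    have e1 : c ^ (1 / ρ) * (N : ℝ) ^ (k / (ρ + 1)) ≤ q := by
      have e2 : (c * Q) ^ (1 / ρ) ≤ ((q : ℝ) ^ ρ) ^ (1 / ρ) := by gcongr
      rw [← Real.rpow_mul hq0.le, mul_one_div_cancel hρ0.ne', Real.rpow_one,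
        Real.mul_rpow hc.le (by positivity), hQdef, ← Real.rpow_mul hN0.le] at e2
      convert e2 using 3
      field_simp
    calc _ ≤ N * (c ^ (1 / ρ) * (N : ℝ) ^ (k / (ρ + 1))) ^ (-γ) := by
          gcongr 1
          exact Real.rpow_le_rpow_of_nonpos (by positivity) e1 (by linarith)
      _ = (c ^ (1 / ρ)) ^ (-γ) * ((N : ℝ) ^ (1 : ℝ) * (N : ℝ) ^ (k / (ρ + 1) * (-γ))) := by
          rw [Real.mul_rpow (by positivity) (by positivity), ← Real.rpow_mul hN0.le, Real.rpow_one]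
          ring
      _ = _ := by
          rw [← Real.rpow_add hN0, hX]
          congr 2; ring
  have h2 : (q : ℝ) ^ γ * (N : ℝ) ^ (1 - k * γ) ≤ X := by
    calc _ ≤ Q ^ γ * (N : ℝ) ^ (1 - k * γ) := by gcongr
      _ = X := by
        rw [hQdef, ← Real.rpow_mul hN0.le, ← Real.rpow_add hN0, hX]
        congr 1
        field_simp; ring
  have h3 := mul_sav_rpow_le n (q := q) hN
  push_cast at h3
  rw [← hγ, ← hk] at h3
  have h4 : (N : ℝ) ^ (ε / 2) * X ≤ (N : ℝ) ^ (1 - k * γ / (t + 1) + ε) := by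
    rw [hX, ← Real.rpow_add hN0]
    apply Real.rpow_le_rpow_of_exponent_le hN'
    have e1 : k * γ / (t + 1) - k * γ / (ρ + 1) = k * γ * (ε / 2) / ((t + 1) * (ρ + 1)) := by
      rw [hρ]; field_simp; ring
    have e2 : k * γ * (ε / 2) / ((t + 1) * (ρ + 1)) ≤ ε / 2 := by
      rw [div_le_iff₀ (by positivity)]
      calc k * γ * (ε / 2) ≤ 1 * (ε / 2) := by gcongr
        _ = ε / 2 * (1 * 1) := by ring
        _ ≤ ε / 2 * ((t + 1) * (ρ + 1)) := by gcongr <;> linarith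
    linarith
  have h5 : (N : ℝ) ^ (ε / 2) * (N : ℝ) ^ (1 - γ / 2) ≤ (N : ℝ) ^ (1 - γ / 2 + ε) := by
    rw [← Real.rpow_add hN0]
    apply Real.rpow_le_rpow_of_exponent_le hN'
    linarith
  rw [typeErrorBound]
  push_cast
  rw [← hγ, ← hk]
  set K := (c ^ (1 / ρ)) ^ (-γ) with hK
  have hK0 : 0 < K := by positivity
  calc _ ≤ (N : ℝ) ^ (ε / 2) * (K * X + (N : ℝ) ^ (1 - γ / 2) + X) := by
        gcongr; linarith
    _ = (K + 1) * ((N : ℝ) ^ (ε / 2) * X) + 1 * ((N : ℝ) ^ (ε / 2) * (N : ℝ) ^ (1 - γ / 2)) := by ring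
    _ ≤ (K + 1) * (N : ℝ) ^ (1 - k * γ / (t + 1) + ε) + (K + 1) * (N : ℝ) ^ (1 - γ / 2 + ε) := by
        gcongr
        linarith
    _ = _ := by ring

end BeattyPrimes

/-! ### Assembly: uniform bounds, then fixed g and β -/

theorem theorem1 (k : ℕ) (hk : 2 ≤ k) (α : ℝ) (hα : 1 < α) (hirr : Irrational α)
    (ε : ℝ) (hε : 0 < ε) :
    -- the asymptotic formula for a given polynomial and a given `β`
    (∀ (g : Polynomial ℤ) (β : ℝ), g.natDegree = k → 1 ≤ g.leadingCoeff →
      ∃ C : ℝ, 0 < C ∧ ∀ (N : ℕ) (a : ℤ) (q : ℕ), 3 ≤ N → 1 ≤ q → IsCoprime a (q : ℤ) →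
        |(g.leadingCoeff : ℝ) / α - (a : ℝ) / (q : ℝ)| ≤ 1 / (q : ℝ) ^ 2 →
        |BeattyPrimes.beattyPrimeSum g α β N - 1 / α * BeattyPrimes.primeSum N|
          ≤ C * BeattyPrimes.errorBound k ε N q) ∧
    -- the formula with a constant that depends on `k`, `α`, `ε` only
    (∃ C : ℝ, 0 < C ∧ ∀ (g : Polynomial ℤ) (β : ℝ), g.natDegree = k → 1 ≤ g.leadingCoeff →
      ∀ (N : ℕ) (a : ℤ) (q : ℕ), 3 ≤ N → 1 ≤ q → IsCoprime a (q : ℤ) →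
        |(g.leadingCoeff : ℝ) / α - (a : ℝ) / (q : ℝ)| ≤ 1 / (q : ℝ) ^ 2 →
        |BeattyPrimes.beattyPrimeSum g α β N - 1 / α * BeattyPrimes.primeSum N|
          ≤ C * BeattyPrimes.errorBound k ε N q + BeattyPrimes.initialPrimeSum g α β N) ∧
    -- finite type: the formula for a given polynomial and a given `β`
    (∀ (g : Polynomial ℤ) (β t : ℝ), g.natDegree = k → 1 ≤ g.leadingCoeff →
      BeattyPrimes.IsOfFiniteType ((g.leadingCoeff : ℝ) / α) t →
      ∃ C : ℝ, 0 < C ∧ ∀ N : ℕ, 3 ≤ N →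
        |BeattyPrimes.beattyPrimeSum g α β N - 1 / α * BeattyPrimes.primeSum N|
          ≤ C * BeattyPrimes.typeErrorBound k t ε N) ∧
    -- finite type: the formula with a constant that depends on `k`, `α`, `ε` and the
    -- leading coefficient only
    (∀ (b : ℤ) (t : ℝ), 1 ≤ b → BeattyPrimes.IsOfFiniteType ((b : ℝ) / α) t →
      ∃ C : ℝ, 0 < C ∧ ∀ (g : Polynomial ℤ) (β : ℝ), g.natDegree = k → g.leadingCoeff = b →
        ∀ N : ℕ, 3 ≤ N →
          |BeattyPrimes.beattyPrimeSum g α β N - 1 / α * BeattyPrimes.primeSum N|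
            ≤ C * BeattyPrimes.typeErrorBound k t ε N
              + BeattyPrimes.initialPrimeSum g α β N) := by
  obtain ⟨n, rfl⟩ : ∃ n, k = n + 1 := ⟨k - 1, by omega⟩
  have hn : 1 ≤ n := by omega
  have h2 : ∃ C : ℝ, 0 < C ∧ ∀ (g : Polynomial ℤ) (β : ℝ), g.natDegree = n + 1 →
      1 ≤ g.leadingCoeff → ∀ (N : ℕ) (a : ℤ) (q : ℕ), 3 ≤ N → 1 ≤ q → IsCoprime a (q : ℤ) →
        |(g.leadingCoeff : ℝ) / α - (a : ℝ) / (q : ℝ)| ≤ 1 / (q : ℝ) ^ 2 →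
        |BeattyPrimes.beattyPrimeSum g α β N - 1 / α * BeattyPrimes.primeSum N|
          ≤ C * BeattyPrimes.errorBound (n + 1) ε N q + BeattyPrimes.initialPrimeSum g α β N := by
    obtain ⟨C, hC, h⟩ := BeattyPrimes.exists_beatty_le n hn hα hε
    refine ⟨C, hC, fun g β hg _ N a q hN hq hc hab => ?_⟩
    refine (h g β N a q hg (by omega) ⟨hq, hc, hab⟩).trans ?_
    rw [mul_assoc]
    gcongr
    exact BeattyPrimes.le_errorBound n (by omega)
  have h4 : ∀ (b : ℤ) (t : ℝ), BeattyPrimes.IsOfFiniteType ((b : ℝ) / α) t →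
      ∃ C : ℝ, 0 < C ∧ ∀ (g : Polynomial ℤ) (β : ℝ), g.natDegree = n + 1 → g.leadingCoeff = b →
        ∀ N : ℕ, 3 ≤ N →
          |BeattyPrimes.beattyPrimeSum g α β N - 1 / α * BeattyPrimes.primeSum N|
            ≤ C * BeattyPrimes.typeErrorBound (n + 1) t ε N
              + BeattyPrimes.initialPrimeSum g α β N := by
    intro b t ht
    obtain ⟨C, hC, h⟩ := BeattyPrimes.exists_beatty_le n hn hα (half_pos hε)
    obtain ⟨C', hC', h'⟩ := BeattyPrimes.exists_sav_le_typeErrorBound n ht hε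
    refine ⟨C * C', by positivity, fun g β hg hb N hN => ?_⟩
    obtain ⟨a, q, hθ, hs⟩ := h' N (by omega)
    refine (h g β N a q hg (by omega) (by rw [hb]; exact hθ)).trans ?_
    rw [mul_assoc, mul_assoc]
    gcongr
  refine ⟨?_, h2, ?_, fun b t _ => h4 b t⟩
  · intro g β hg hlc
    obtain ⟨C, hC, h⟩ := h2
    -- For fixed g and β the initial sum is bounded, since g tends to infinity, and a constant is
    -- absorbed because `errorBound` is at least 1.
    obtain ⟨C', hC', h'⟩ := BeattyPrimes.exists_initialPrimeSum_le g α β (by omega) hlc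
    refine ⟨C + C', by positivity, fun N a q hN hq hc hab => ?_⟩
    have h1 := h g β hg hlc N a q hN hq hc hab
    have h3 := le_mul_of_one_le_right hC'
      (BeattyPrimes.one_le_errorBound n hε (N := N) (q := q) (by omega))
    linarith [h' N]
  · intro g β t hg hlc ht
    obtain ⟨C, hC, h⟩ := h4 g.leadingCoeff t ht
    obtain ⟨C', hC', h'⟩ := BeattyPrimes.exists_initialPrimeSum_le g α β (by omega) hlc
    refine ⟨C + C', by positivity, fun N hN => ?_⟩
    have h1 := h g β hg rfl N hN
    have h3 := le_mul_of_one_le_right hC'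
      (BeattyPrimes.one_le_typeErrorBound n (t := t) hε (N := N) (by omega))
    linarith [h' N]
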